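/- Graphs are finite and may have loops and parallel edges. A signed graph $(G,\sigma)$ is a graph whose edges are labelled positive or negative. Switching at an edge cut $\partial_G(X)$ changes the signs of all edges of the cut; the frustration index $l(G,\sigma)$ is the least number of negative edges in a signature obtained from $\sigma$ by switching at an edge cut. $(G,\sigma)$ is critically $k$-frustrated if $l(G,\sigma)=k$ and $l(G\setminus e,\sigma)=k-1$ for every edge $e$. To subdivide a nonempty set of $t$ parallel edges of the same sign between $x$ and $y$ means to replace it by a new vertex $w$, $t$ positive parallel edges between $x$ and $w$, and $t$ parallel edges of the original sign between $w$ and $y$; a signed graph is irreducible if it cannot be obtained from a signed graph by one or more such subdivisions. A cycle (a connected 2-regular subgraph) is negative if it has an odd number of negative edges. Let $\mathcal S^*(k)$ be the class of critically $k$-frustrated signed graphs that are irreducible and contain no two edge-disjoint negative cycles. Canonical embedding. Let $G'$ be a 2-connected plane cubic graph and let $C'$ be the cycle bounding one of its faces. Insert $2k$ distinct new vertices $z_1,\dots,z_{2k}$, in this cyclic order, on the edges of $C'$, and add the $k$ edges $z_iz_{k+i}$, $1\le i\le k$. Let $G$ be the resulting graph, and let $\sigma$ make the edges $z_iz_{k+i}$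 negative and all other edges positive. The weight $\omega(e)$ of an edge $e$ of $C'$ is the number of vertices $z_i$ inserted on $e$, and $\omega(H)=\sum_{e\in E(H)\cap E(C')}\omega(e)$ for a subgraph $H$ of $G'$. For a face $F$ of $G'$ let $C_F$ be the cycle of $G'$ bounding it. $F$ is a bridge face if $C_F$ shares an edge with $C'$ and the subgraph $C_F\cap C'$ (common vertices and common edges) is disconnected. Proposition. Let $k\ge 4$, suppose that $(G,\sigma)$, obtained as above, belongs to $\mathcal S^*(k)$, and let $F$ be a bridge face. Then $G'\setminus(E(C_F)\cap E(C'))$ has exactly two connected components $A_1$ and $A_2$, which can be named such that 1. $A_1$ is the boundary cycle $C_{F'}$ of a single face $F'$ of $G'$ (not the face bounded by $C'$ into which the negative edges are drawn), and the corresponding subgraph of $G$ (with the inserted vertices $z_i$) is a cycle of length $4$; 2. $\omega(A_2)=2k-2$. Moreover, $C_F$ has length at least $6$. -/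

import Mathlib

/-! ## Multigraphs (loops and parallel edges allowed) -/

namespace Graph

variable {α β : Type*}

/-- The degree of a vertex of a finite graph; a loop counts twice. -/
noncomputable def deg (G : Graph α β) (x : α) : ℕ :=
  (G.incidenceSet x).ncard + (G.loopSet x).ncard

/-- A graph is connected if it has a vertex and any two vertices are joined by a walk. -/
def IsConn (G : Graph α β) : Prop :=
  G.vertexSet.Nonempty ∧
    ∀ x ∈ G.vertexSet, ∀ y ∈ G.vertexSet, Relation.ReflTransGen G.Adj x y

/-- `A` is a connected component of `G`: a maximal connected subgraph. -/
def IsComponentOf (A G : Graph α β) : Prop :=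
  Maximal (fun H : Graph α β => H ≤ G ∧ H.IsConn) A

/-- A cycle: a connected 2-regular graph. -/
def IsCyc (H : Graph α β) : Prop :=
  H.IsConn ∧ ∀ x ∈ H.vertexSet, H.deg x = 2

/-- 2-connected: at least two vertices, no loop, connected, and without a cut vertex. -/
def IsTwoConnected (G : Graph α β) : Prop :=
  G.vertexSet.Nontrivial ∧ G.Loopless ∧ G.IsConn ∧
    ∀ v ∈ G.vertexSet, (G.deleteVerts {v}).IsConn

/-- Every vertex has degree three. -/
def IsCubic (G : Graph α β) : Prop :=
  ∀ v ∈ G.vertexSet, G.deg v = 3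

/-- The edge cut `∂(X)`: the edges with one end in `X` and the other outside `X`. -/
def cut (G : Graph α β) (X : Set α) : Set β :=
  {e | ∃ x ∈ X, ∃ y ∉ X, G.IsLink e x y}

theorem cut_subset (G : Graph α β) (X : Set α) : G.cut X ⊆ G.edgeSet := by
  rintro e ⟨x, _, y, _, h⟩
  exact h.edge_mem

end Graph

/-! ## Signed graphs -/

/-- A signed graph: a graph with a set of negative edges; the other edges are positive. -/
structure SignedGraph (α β : Type*) where
  graph : Graph α β
  neg : Set β
  neg_subset : neg ⊆ graph.edgeSet

namespace SignedGraph

variable {α β : Type*}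

/-- Switching at the cut `∂(X)`: the signs of the edges of the cut are changed. -/
def switch (S : SignedGraph α β) (X : Set α) : SignedGraph α β where
  graph := S.graph
  neg := symmDiff S.neg (S.graph.cut X)
  neg_subset := by
    intro e he
    rcases he with he | he
    · exact S.neg_subset he.1
    · exact S.graph.cut_subset X he.1

/-- Two signed graphs are switching equivalent if one arises from the other by switching
at an edge cut. -/
def SwitchingEquiv (S T : SignedGraph α β) : Prop :=
  ∃ X ⊆ S.graph.vertexSet, T = S.switch X

/-- The frustration index of a finite signed graph: the least number of negative edges in a
switching equivalent signed graph. -/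
noncomputable def frustrationIndex (S : SignedGraph α β) : ℕ :=
  sInf {n | ∃ T, S.SwitchingEquiv T ∧ T.neg.ncard = n}

/-- The signed graph obtained by deleting an edge. -/
def deleteEdge (S : SignedGraph α β) (e : β) : SignedGraph α β where
  graph := S.graph.deleteEdges {e}
  neg := S.neg \ {e}
  neg_subset := by
    intro f hf
    have := S.neg_subset hf.1
    simp only [Graph.edgeSet_deleteEdges]
    exact ⟨this, hf.2⟩

/-- Critically `k`-frustrated: the frustration index is `k`, and it is `k - 1` after the deletion
of any edge. -/
def IsCritical (k : ℕ) (S : SignedGraph α β) : Prop :=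
  S.frustrationIndex = k ∧
    ∀ e ∈ S.graph.edgeSet, (S.deleteEdge e).frustrationIndex + 1 = k

/-- `T` arises from `S` by subdividing a nonempty set `P` of parallel edges of the same sign between
`x` and `y`. There is one new vertex `w`; the positive edge from `x` to `w` that replaces
`e ∈ P` keeps the name `e`, and the edge from `w` to `y` that replaces it is `f e`, with the old sign
of `e`. -/
def SubdivisionStep (S T : SignedGraph α β) : Prop :=
  ∃ (x y w : α) (P : Set β) (f : β → β),
    w ∉ S.graph.vertexSet ∧
    P.Nonempty ∧ (∀ e ∈ P, S.graph.IsLink e x y) ∧ (P ⊆ S.neg ∨ Disjoint P S.neg) ∧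
    Set.InjOn f P ∧ (∀ e ∈ P, f e ∉ S.graph.edgeSet) ∧
    T.graph.vertexSet = insert w S.graph.vertexSet ∧
    T.graph.edgeSet = S.graph.edgeSet ∪ f '' P ∧
    (∀ e ∈ S.graph.edgeSet \ P, ∀ u v, T.graph.IsLink e u v ↔ S.graph.IsLink e u v) ∧
    (∀ e ∈ P, T.graph.IsLink e x w ∧ T.graph.IsLink (f e) w y) ∧
    T.neg = (S.neg \ P) ∪ f '' (P ∩ S.neg)

/-- `T` is a proper subdivision of `S`: it arises from `S` by one or more subdivisions
of multiedges. -/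
def IsProperSubdivision (S T : SignedGraph α β) : Prop :=
  Relation.TransGen SubdivisionStep S T

/-- Irreducible: not a proper subdivision of any signed graph. A signed graph of which `T` is a
subdivision has fewer vertices and edges than `T`, and can be labelled by those of `T`. -/
def IsIrreducible (T : SignedGraph α β) : Prop :=
  ∀ S : SignedGraph α β, ¬ S.IsProperSubdivision T

/-- `H` is a negative cycle: a subgraph that is a cycle with an odd number of negative edges. -/
def IsNegativeCycle (S : SignedGraph α β) (H : Graph α β) : Prop :=
  H ≤ S.graph ∧ H.IsCyc ∧ Odd (H.edgeSet ∩ S.neg).ncard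

/-- Prime critically `k`-frustrated signed graphs: critically `k`-frustrated, irreducible, and
without two edge-disjoint negative cycles. -/
def IsPrimeCritical (k : ℕ) (S : SignedGraph α β) : Prop :=
  S.IsCritical k ∧ S.IsIrreducible ∧
    ∀ H₁ H₂ : Graph α β, S.IsNegativeCycle H₁ → S.IsNegativeCycle H₂ →
      ¬ Disjoint H₁.edgeSet H₂.edgeSet

end SignedGraph

/-! ## Embedded graphs as combinatorial maps -/

/-- A combinatorial map on a set `D` of darts (oriented edges). A dart starts at its tail;
`rev` reverses a dart, and `rot` sends a dart to the next one around its tail. -/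
structure CombMap (D : Type*) where
  rot : Equiv.Perm D
  rev : Equiv.Perm D
  rev_rev : ∀ d, rev (rev d) = d
  rev_ne : ∀ d, rev d ≠ d

namespace CombMap

variable {D : Type*} (M : CombMap D)

/-- The dart that follows `d` on the boundary walk of the face on the left of `d` (the side is
a matter of convention). It starts at the head of `d`. -/
def next : Equiv.Perm D := M.rev.trans M.rot

/-- Vertices, edges and faces are the orbits of `rot`, `rev` and `next`. -/
def Vertex : Type _ := Quotient (Equiv.Perm.SameCycle.setoid M.rot)

def Edge : Type _ := Quotient (Equiv.Perm.SameCycle.setoid M.rev)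

def Face : Type _ := Quotient (Equiv.Perm.SameCycle.setoid M.next)

def tail (d : D) : M.Vertex := Quotient.mk _ d

def head (d : D) : M.Vertex := M.tail (M.rev d)

def edge (d : D) : M.Edge := Quotient.mk _ d

def face (d : D) : M.Face := Quotient.mk _ d

theorem edge_eq_iff {d d' : D} : M.edge d = M.edge d' ↔ d' = d ∨ d' = M.rev d := by
  have key : ∀ n : ℕ, (M.rev ^ n) d = d ∨ (M.rev ^ n) d = M.rev d := by
    intro n
    induction n with
    | zero => left; rfl
    | succ n ih =>
      rw [pow_succ', Equiv.Perm.mul_apply]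
      rcases ih with h | h <;> rw [h]
      · right; rfl
      · left; exact M.rev_rev d
  have keyz : ∀ n : ℤ, (M.rev ^ n) d = d ∨ (M.rev ^ n) d = M.rev d := by
    have hinv : M.rev⁻¹ = M.rev := by
      ext a
      rw [Equiv.Perm.inv_eq_iff_eq]
      exact (M.rev_rev a).symm
    intro n
    obtain ⟨m, rfl | rfl⟩ := n.eq_nat_or_neg
    · exact_mod_cast key m
    · rw [← inv_zpow', hinv]
      exact_mod_cast key m
  constructor
  · intro h
    obtain ⟨n, hn⟩ : M.rev.SameCycle d d' := Quotient.exact h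
    rcases keyz n with h' | h'
    · left; rw [← hn, h']
    · right; rw [← hn, h']
  · rintro (rfl | rfl)
    · rfl
    · exact Quotient.sound (s := Equiv.Perm.SameCycle.setoid M.rev) ⟨1, by simp⟩

/-- The underlying multigraph of a combinatorial map. -/
def graph : Graph M.Vertex M.Edge where
  vertexSet := Set.univ
  IsLink e x y := ∃ d, M.edge d = e ∧ M.tail d = x ∧ M.head d = y
  isLink_symm := by
    rintro e -
    refine ⟨?_⟩
    rintro x y ⟨d, rfl, rfl, rfl⟩
    refine ⟨M.rev d, M.edge_eq_iff.2 (Or.inr (M.rev_rev d).symm), rfl, ?_⟩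
    simp only [head, M.rev_rev]
  eq_or_eq_of_isLink_of_isLink := by
    rintro e x y v w ⟨d, hd, rfl, rfl⟩ ⟨d', hd', rfl, rfl⟩
    rcases M.edge_eq_iff.1 (hd.trans hd'.symm) with h | h
    · left; rw [h]
    · right; rw [h, head, M.rev_rev]
  left_mem_of_isLink := fun _ _ _ _ => Set.mem_univ _

/-- A plane map: the graph is connected and the surface is the sphere, by Euler's formula
`|V| - |E| + |F| = 2`. -/
def IsPlane : Prop :=
  M.graph.IsConn ∧ Nat.card M.Vertex + Nat.card M.Face = Nat.card M.Edge + 2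

/-- The subgraph `C_F` formed by the vertices and edges on the boundary walk of the face `F`. -/
def boundary (F : M.Face) : Graph M.Vertex M.Edge :=
  (M.graph.induce {v | ∃ d, M.face d = F ∧ M.tail d = v}).restrict
    {e | ∃ d, M.face d = F ∧ M.edge d = e}

end CombMap

/-! ## Canonical embeddings -/

/-- The data of a canonical embedding: a 2-connected plane cubic graph `G'` with a facial
cycle `C'` (the face that contains the dart `start`), and `2 k` further vertices
`z_0, …, z_{2k-1}` placed in this cyclic order on the edges of `C'`. If `d_0 = start, d_1, …` is the
sequence of the darts around `C'`, then `z_i` subdivides the edge of `d_{pos i}`; vertices on the same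
edge are placed in increasing order of their indices in the direction of the dart. -/
structure CanonicalEmbedding (k : ℕ) (D : Type*) where
  map : CombMap D
  plane : map.IsPlane
  cubic : map.graph.IsCubic
  twoConnected : map.graph.IsTwoConnected
  start : D
  pos : Fin (2 * k) → ℕ
  pos_mono : Monotone pos
  pos_lt : ∀ i, pos i < {d | map.face d = map.face start}.ncard

namespace CanonicalEmbedding

variable {k : ℕ} {D : Type*} (Γ : CanonicalEmbedding k D)

/-- The plane cubic graph `G'`. -/
abbrev graph' : Graph Γ.map.Vertex Γ.map.Edge := Γ.map.graph

/-- The face of `G'` that contains the cross cap. -/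
def outer : Γ.map.Face := Γ.map.face Γ.start

/-- The boundary cycle `C'` of that face. -/
def outerCycle : Graph Γ.map.Vertex Γ.map.Edge := Γ.map.boundary Γ.outer

/-- The dart of `C'` on which `z_i` is placed. -/
def dart (i : Fin (2 * k)) : D := (Γ.map.next ^ Γ.pos i) Γ.start

/-- The vertices of `G`: the vertices of `G'`, and the vertices `z_i`. -/
abbrev Vert : Type _ := Γ.map.Vertex ⊕ Fin (2 * k)

/-- The edges of `G`. The edge `inl e` is the first of the segments into which the edge `e` of `G'` is
subdivided (and is `e` itself if there are no vertices on `e`); `inr (inl i)` is the segment that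
follows `z_i` on `C`; `inr (inr i)` is the negative edge `z_i z_{k+i}`. -/
abbrev Ed : Type _ := Γ.map.Edge ⊕ (Fin (2 * k) ⊕ Fin k)

/-- The ends of the edges of `G`, each edge with one of its orientations (unsubdivided
edges with both). -/
inductive Link : Γ.Ed → Γ.Vert → Γ.Vert → Prop
  | whole (d : D) (h : ∀ i, Γ.map.edge (Γ.dart i) ≠ Γ.map.edge d) :
      Link (.inl (Γ.map.edge d)) (.inl (Γ.map.tail d)) (.inl (Γ.map.head d))
  | first (i : Fin (2 * k)) (h : ∀ j < i, Γ.map.edge (Γ.dart j) ≠ Γ.map.edge (Γ.dart i)) :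
      Link (.inl (Γ.map.edge (Γ.dart i))) (.inl (Γ.map.tail (Γ.dart i))) (.inr i)
  | middle (i j : Fin (2 * k)) (hij : j.val = i.val + 1) (h : Γ.dart i = Γ.dart j) :
      Link (.inr (.inl i)) (.inr i) (.inr j)
  | last (i : Fin (2 * k)) (h : ∀ j, j.val = i.val + 1 → Γ.dart i ≠ Γ.dart j) :
      Link (.inr (.inl i)) (.inr i) (.inl (Γ.map.head (Γ.dart i)))
  | negative (i : Fin k) :
      Link (.inr (.inr i)) (.inr ⟨i.val, by omega⟩) (.inr ⟨k + i.val, by omega⟩)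

theorem Link.unique {e : Γ.Ed} {x y v w : Γ.Vert} (h : Γ.Link e x y) (h' : Γ.Link e v w) :
    (x = v ∧ y = w) ∨ (x = w ∧ y = v) := by
  obtain ⟨e', he'⟩ : ∃ e', e' = e := ⟨e, rfl⟩
  rw [← he'] at h'
  cases h with
  | whole d hd =>
    cases h' with
    | whole d' hd' =>
      rcases Γ.map.edge_eq_iff.1 (Sum.inl.inj he') with h | h
      · left; rw [h]; exact ⟨rfl, rfl⟩
      · right; rw [h]; simp [CombMap.head, Γ.map.rev_rev]
    | first i hi => exact absurd (Sum.inl.inj he') (hd i)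
    | middle => cases he'
    | last => cases he'
    | negative => cases he'
  | first i hi =>
    cases h' with
    | whole d' hd' => exact absurd (Sum.inl.inj he').symm (hd' i)
    | first j hj =>
      have hij : i = j := by
        rcases lt_trichotomy i j with h | h | h
        · exact absurd (Sum.inl.inj he').symm (hj i h)
        · exact h
        · exact absurd (Sum.inl.inj he') (hi j h)
      subst hij
      exact Or.inl ⟨rfl, rfl⟩
    | middle => cases he'
    | last => cases he'
    | negative => cases he'
  | middle i j hij hd =>
    cases h' with
    | middle i' j' hij' hd' =>
      have : i' = i := Sum.inl.inj (Sum.inr.inj he')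
      subst this
      have : j = j' := Fin.ext (by omega)
      subst this
      exact Or.inl ⟨rfl, rfl⟩
    | last i' hi' =>
      have : i' = i := Sum.inl.inj (Sum.inr.inj he')
      subst this
      exact absurd hd (hi' j hij)
    | whole => cases he'
    | first => cases he'
    | negative => cases he'
  | last i hi =>
    cases h' with
    | middle i' j' hij' hd' =>
      have : i' = i := Sum.inl.inj (Sum.inr.inj he')
      subst this
      exact absurd hd' (hi j' hij')
    | last i' hi' =>
      have : i' = i := Sum.inl.inj (Sum.inr.inj he')
      subst this
      exact Or.inl ⟨rfl, rfl⟩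
    | whole => cases he'
    | first => cases he'
    | negative => cases he'
  | negative i =>
    cases h' with
    | negative i' =>
      have : i' = i := Sum.inr.inj (Sum.inr.inj he')
      subst this
      exact Or.inl ⟨rfl, rfl⟩
    | whole => cases he'
    | first => cases he'
    | middle => cases he'
    | last => cases he'

/-- The graph `G` obtained from `G'` by subdividing the edges of `C'` by the vertices `z_i` and adding
the edges `z_i z_{k+i}`. -/
def graph : Graph Γ.Vert Γ.Ed where
  vertexSet := Set.univ
  IsLink e x y := Γ.Link e x y ∨ Γ.Link e y x
  isLink_symm := fun _ _ => ⟨fun _ _ h => h.symm⟩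
  eq_or_eq_of_isLink_of_isLink := by
    rintro e x y v w (h | h) (h' | h') <;>
      rcases Link.unique Γ h h' with ⟨h₁, h₂⟩ | ⟨h₁, h₂⟩ <;> tauto
  left_mem_of_isLink := fun _ _ _ _ => Set.mem_univ _

/-- The signed graph `(G, σ)`: the edges `z_i z_{k+i}` are negative and all others are positive. -/
def signedGraph : SignedGraph Γ.Vert Γ.Ed where
  graph := Γ.graph
  neg := Set.range fun i : Fin k => Sum.inr (Sum.inr i)
  neg_subset := by
    rintro _ ⟨i, rfl⟩
    exact (Γ.graph.edge_mem_iff_exists_isLink _).2 ⟨_, _, Or.inl (Link.negative i)⟩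

/-- The weight of an edge of `G'`: the number of the vertices `z_i` placed on it. -/
noncomputable def edgeWeight (e : Γ.map.Edge) : ℕ :=
  {i | Γ.map.edge (Γ.dart i) = e}.ncard

/-- The weight of a subgraph of `G'`: the total weight of its edges on `C'`. -/
noncomputable def weight (H : Graph Γ.map.Vertex Γ.map.Edge) : ℕ :=
  ∑ᶠ e ∈ H.edgeSet ∩ Γ.outerCycle.edgeSet, Γ.edgeWeight e

/-- The subgraph of `G` that corresponds to a subgraph `H` of `G'`: every edge of `H` is replaced by the
path into which it is subdivided. -/
def subdivided (H : Graph Γ.map.Vertex Γ.map.Edge) : Graph Γ.Vert Γ.Ed :=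
  (Γ.graph.induce
      (Sum.inl '' H.vertexSet ∪ Sum.inr '' {i | Γ.map.edge (Γ.dart i) ∈ H.edgeSet})).restrict
    (Sum.inl '' H.edgeSet ∪
      (fun i => Sum.inr (Sum.inl i)) '' {i | Γ.map.edge (Γ.dart i) ∈ H.edgeSet})

/-- The edges that the boundary of the face `F` shares with `C'`. -/
def sharedEdges (F : Γ.map.Face) : Set Γ.map.Edge :=
  (Γ.map.boundary F).edgeSet ∩ Γ.outerCycle.edgeSet

/-- A boundary face: its boundary shares an edge with `C'`. -/
def IsBoundaryFace (F : Γ.map.Face) : Prop :=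
  (Γ.sharedEdges F).Nonempty

/-- A bridge face: a boundary face for which the subgraph `C_F ∩ C'` is disconnected. -/
def IsBridgeFace (F : Γ.map.Face) : Prop :=
  Γ.IsBoundaryFace F ∧ ¬ (Γ.map.boundary F ⊓ Γ.outerCycle).IsConn

end CanonicalEmbedding

/-! ## Cubic multigraphs in which small edge cuts are tight -/

/-! Write d(A, B) for the number of edges between A and B. The signature σ has k negative edges, so
it is minimum: no cut has more negative than positive edges. By criticality every positive edge lies
in a cut with equally many of both. Let H span no negative edge, and let ∂(X) be such an
equilibrated cut through an edge inside H. Comparing ∂(X) with the cuts of X \ H and X ∪ H shows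
that d(H ∩ X, H \ X) exceeds neither d(H ∩ X, Hᶜ) nor d(H \ X, Hᶜ) (`SignedGraph.isTightCubic`).

In a cubic graph this alone controls small boundaries: a nonempty such H has boundary at least 3,
boundary 3 forces a single vertex, and boundary at most 4 forces at most four vertices
(`IsTightCubic.card_le_four`). For the last claim, if H had boundary 4 and at least five vertices,
every edge inside H would be separated by a split of H with two edges across and two from each part
to Hᶜ. Crossing splits leave only four vertices, and nested splits are excluded by descent.

Planarity enters through one fact: two edges between the same pair of faces form a cut
(`CombMap.exists_cut_pair`). It follows from exactness of the mod 2 cochain complex at the edges, a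
dimension count with Euler's formula. A bridge face F shares two edges with C', since in a cubic map
faces that meet in a vertex share an edge there. These two edges are a cut ∂(X) of G'. Adding to X
an interval of the z_i gives a set in G with at most two positive edges in its cut, hence at most
two negative ones. The negative edges join antipodal z_i, so the interval or its complement has at
most two members. That side has boundary at most 4, so it consists of two vertices of G' and two z_i
(`CanonicalEmbedding.shared_pair`): a digon of G' and a 4-cycle of G. A third shared edge is
impossible because the weights between shared edges add up, and for k ≥ 4 the sum 2 + 2 is neither 2
nor 2k − 2. The other side carries the remaining 2k − 2 vertices and is connected because G' has no
bridge.

For the length of C_F, let H consist of the vertices of C_F and the two z_i on the digon. If the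
length were at most 5, the boundary of H would be at most 5, so a tight split of H would have at
most two edges across. But the split that separates the ends of the inner digon edge crosses this
edge, the rest of C_F, and the path through the two z_i (`IsBridgeConfig.six_le`). -/

section Multigraph

variable {V : Type*}

/-- The number of edges between `A` and `B` in the multigraph with multiplicity function `m`. -/
def between (m : V → V → ℕ) (A B : Finset V) : ℕ := ∑ a ∈ A, ∑ b ∈ B, m a b

variable {m : V → V → ℕ} {A B C H P Q R S T : Finset V}

theorem between_comm (hm : ∀ u v, m u v = m v u) (A B : Finset V) :
    between m A B = between m B A := by
  unfold between
  rw [Finset.sum_comm]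
  exact Finset.sum_congr rfl fun a _ => Finset.sum_congr rfl fun b _ => hm _ _

theorem between_mono (hA : A ⊆ P) (hB : B ⊆ Q) : between m A B ≤ between m P Q :=
  (Finset.sum_le_sum fun _ _ => Finset.sum_le_sum_of_subset hB).trans
    (Finset.sum_le_sum_of_subset hA)

theorem le_between {a b : V} (ha : a ∈ A) (hb : b ∈ B) : m a b ≤ between m A B := by
  have := between_mono (m := m) (Finset.singleton_subset_iff.2 ha) (Finset.singleton_subset_iff.2 hb)
  simpa [between] using this

variable [DecidableEq V]

theorem between_union_left (h : Disjoint A B) (C : Finset V) :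
    between m (A ∪ B) C = between m A C + between m B C :=
  Finset.sum_union h

theorem between_union_right (h : Disjoint B C) (A : Finset V) :
    between m A (B ∪ C) = between m A B + between m A C := by
  simp only [between, Finset.sum_union h, Finset.sum_add_distrib]

variable [Fintype V]

theorem between_compl_of_union (h : Disjoint P Q) (hH : P ∪ Q = H) :
    between m P Pᶜ = between m P Q + between m P Hᶜ := by
  rw [← between_union_right]
  · congr 1
    subst hH
    ext x
    have : x ∈ P → x ∉ Q := fun hx => Finset.disjoint_left.1 h hx
    simp only [Finset.mem_compl, Finset.mem_union]
    tauto
  · subst hH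
    exact disjoint_compl_right.mono_left Finset.subset_union_right

/-- A cubic loopless multigraph in which every edge inside a set `H` with property `p` lies in
a cut of `H` such that no side of the cut has more edges to the other side than to the complement
of `H`. -/
structure IsTightCubic (m : V → V → ℕ) (p : Finset V → Prop) : Prop where
  symm : ∀ u v, m u v = m v u
  loopless : ∀ u, m u u = 0
  degree : ∀ u, ∑ v, m u v = 3
  mono : ∀ H K, K ⊆ H → p H → p K
  tight : ∀ H, p H → ∀ u ∈ H, ∀ v ∈ H, m u v ≠ 0 → ∃ P ⊆ H, u ∈ P ∧ v ∈ H \ P ∧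
    between m P (H \ P) ≤ between m P Hᶜ ∧ between m P (H \ P) ≤ between m (H \ P) Hᶜ

/-- A partition of `H` with two edges between the parts, and two edges from either part to the
complement of `H`. -/
structure IsEvenSplit (m : V → V → ℕ) (H P Q : Finset V) : Prop where
  disj : Disjoint P Q
  union : P ∪ Q = H
  left_nonempty : P.Nonempty
  right_nonempty : Q.Nonempty
  cross : between m P Q = 2
  left : between m P Hᶜ = 2
  right : between m Q Hᶜ = 2

theorem IsEvenSplit.symm (hm : ∀ u v, m u v = m v u) (h : IsEvenSplit m H P Q) :
    IsEvenSplit m H Q P :=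
  ⟨h.disj.symm, by rw [Finset.union_comm, h.union], h.right_nonempty, h.left_nonempty,
    by rw [between_comm hm, h.cross], h.right, h.left⟩

namespace IsTightCubic

variable {p : Finset V → Prop} (hm : IsTightCubic m p)
include hm

theorem boundary_singleton (u : V) : between m {u} {u}ᶜ = 3 := by
  have h := hm.degree u
  rw [← Finset.sum_add_sum_compl {u}] at h
  simpa [between, hm.loopless] using h

/-- Without an edge inside `H`, all three edges at each vertex leave `H`. -/
theorem exists_edge_of_lt (h : between m H Hᶜ < 3 * H.card) : ∃ u ∈ H, ∃ v ∈ H, m u v ≠ 0 := by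
  by_contra! hne
  have : between m H Hᶜ = ∑ u ∈ H, 3 := by
    refine Finset.sum_congr rfl fun u hu => ?_
    rw [← hm.degree u, ← Finset.sum_add_sum_compl H, Finset.sum_eq_zero fun v hv => hne u hu v hv,
      zero_add]
  rw [this, Finset.sum_const, smul_eq_mul] at h
  omega

/-- Bundles tightness with the additivity of boundaries, in the form from which the later counts
follow by linear arithmetic. -/
theorem exists_split (hp : p H) {u v : V} (hu : u ∈ H) (hv : v ∈ H) (huv : m u v ≠ 0) :
    ∃ P Q, Disjoint P Q ∧ P ∪ Q = H ∧ u ∈ P ∧ v ∈ Q ∧ 1 ≤ between m P Q ∧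
      between m P Q ≤ between m P Hᶜ ∧ between m P Q ≤ between m Q Hᶜ ∧
      between m H Hᶜ = between m P Hᶜ + between m Q Hᶜ ∧
      between m P Pᶜ = between m P Q + between m P Hᶜ ∧
      between m Q Qᶜ = between m P Q + between m Q Hᶜ := by
  obtain ⟨P, hPH, huP, hvP, h1, h2⟩ := hm.tight H hp u hu v hv huv
  have hd : Disjoint P (H \ P) := Finset.disjoint_sdiff
  have hun : P ∪ H \ P = H := Finset.union_sdiff_of_subset hPH
  refine ⟨P, H \ P, hd, hun, huP, hvP, (Nat.one_le_iff_ne_zero.2 huv).trans (le_between huP hvP),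
    h1, h2, ?_, between_compl_of_union hd hun, ?_⟩
  · rw [← between_union_left hd, hun]
  · rw [between_compl_of_union hd.symm ((Finset.union_comm _ _).trans hun), between_comm hm.symm]

/-- In a smallest counterexample the at most two boundary edges bound twice the number of edges
across a tight split. So the split has one edge across and one from each part to the outside, and
either part is a smaller counterexample. -/
theorem three_le_boundary (hp : p H) (hne : H.Nonempty) : 3 ≤ between m H Hᶜ := by
  induction H using Finset.strongInduction with
  | H H ih =>
    by_contra! hlt
    have hc : 1 ≤ H.card := hne.card_pos
    obtain ⟨u, hu, v, hv, huv⟩ := hm.exists_edge_of_lt (H := H) (by omega)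
    obtain ⟨P, Q, hd, hun, huP, hvQ, h1, h2, h3, h4, h5, h6⟩ := hm.exists_split hp hu hv huv
    have hPH : P ⊂ H := by
      refine ⟨hun ▸ Finset.subset_union_left, fun hHP => ?_⟩
      exact Finset.disjoint_left.1 hd (hHP hv) hvQ
    have := ih P hPH (hm.mono _ _ hPH.1 hp) ⟨u, huP⟩
    omega

/-- With three boundary edges, one part of a tight split sends at most one edge outside, hence at
most one across, and its boundary is below 3. -/
theorem card_le_one (hp : p H) (hb : between m H Hᶜ = 3) : H.card ≤ 1 := by
  by_contra! hlt
  obtain ⟨u, hu, v, hv, huv⟩ := hm.exists_edge_of_lt (H := H) (by omega)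
  obtain ⟨P, Q, hd, hun, huP, hvQ, h1, h2, h3, h4, h5, h6⟩ := hm.exists_split hp hu hv huv
  have := hm.three_le_boundary (hm.mono _ _ (hun ▸ Finset.subset_union_left) hp) ⟨u, huP⟩
  have := hm.three_le_boundary (hm.mono _ _ (hun ▸ Finset.subset_union_right) hp) ⟨v, hvQ⟩
  omega

/-- The four boundary edges allow at most two edges across. With only one across, both parts would
have boundary exactly 3, so both would be single vertices. -/
theorem exists_evenSplit (hp : p H) (hb : between m H Hᶜ = 4) (hc : 3 ≤ H.card) {u v : V}
    (hu : u ∈ H) (hv : v ∈ H) (huv : m u v ≠ 0) :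
    ∃ P Q, IsEvenSplit m H P Q ∧ u ∈ P ∧ v ∈ Q := by
  obtain ⟨P, Q, hd, hun, huP, hvQ, h1, h2, h3, h4, h5, h6⟩ := hm.exists_split hp hu hv huv
  have hP := hm.mono _ _ (hun ▸ Finset.subset_union_left : P ⊆ H) hp
  have hQ := hm.mono _ _ (hun ▸ Finset.subset_union_right : Q ⊆ H) hp
  have b1 := hm.three_le_boundary hP ⟨u, huP⟩
  have b2 := hm.three_le_boundary hQ ⟨v, hvQ⟩
  have hcard : P.card + Q.card = H.card := by rw [← Finset.card_union_of_disjoint hd, hun]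
  have key : between m P Q ≠ 1 := by
    intro h
    have c1 := hm.card_le_one hP (by omega)
    have c2 := hm.card_le_one hQ (by omega)
    omega
  exact ⟨P, Q, ⟨hd, hun, ⟨u, huP⟩, ⟨v, hvQ⟩, by omega, by omega, by omega⟩, huP, hvQ⟩

theorem exists_edge_of_boundary_eq_four (hb : between m T Tᶜ = 4) (hne : T.Nonempty) :
    ∃ u ∈ T, ∃ v ∈ T, m u v ≠ 0 := by
  refine hm.exists_edge_of_lt ?_
  have h1 : 1 ≤ T.card := hne.card_pos
  have h2 : T.card ≠ 1 := by
    intro h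
    obtain ⟨t, rfl⟩ := Finset.card_eq_one.1 h
    rw [hm.boundary_singleton] at hb
    omega
  omega

/-- Two crossing even splits have only four vertices. -/
theorem card_le_four_of_crossing (hp : p H) (h : IsEvenSplit m H P Q) (h' : IsEvenSplit m H R S)
    (hPR : (P ∩ R).Nonempty) (hPS : (P ∩ S).Nonempty) (hQR : (Q ∩ R).Nonempty)
    (hQS : (Q ∩ S).Nonempty) : H.card ≤ 4 := by
  have hd := h.disj
  have hd' := h'.disj
  have hPH : P ⊆ H := h.union ▸ Finset.subset_union_left
  have hQH : Q ⊆ H := h.union ▸ Finset.subset_union_right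
  have split : ∀ X ⊆ H, X ∩ R ∪ X ∩ S = X := by
    intro X hX
    rw [← Finset.inter_union_distrib_left, h'.union, Finset.inter_eq_left.2 hX]
  have split' : ∀ X ⊆ H, P ∩ X ∪ Q ∩ X = X := by
    intro X hX
    rw [← Finset.union_inter_distrib_right, h.union, Finset.inter_eq_right.2 hX]
  have hRH : R ⊆ H := h'.union ▸ Finset.subset_union_left
  have hSH : S ⊆ H := h'.union ▸ Finset.subset_union_right
  have dR : ∀ X Y : Finset V, Disjoint (X ∩ R) (Y ∩ S) := fun X Y =>
    hd'.mono Finset.inter_subset_right Finset.inter_subset_right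
  have dP : ∀ X Y : Finset V, Disjoint (P ∩ X) (Q ∩ Y) := fun X Y =>
    hd.mono Finset.inter_subset_left Finset.inter_subset_left
  have ePQ := h.cross
  have eRS := h'.cross
  have eP := h.left
  have eQ := h.right
  rw [← split P hPH, ← split Q hQH, between_union_left (dR _ _), between_union_right (dR _ _),
    between_union_right (dR _ _)] at ePQ
  rw [← split' R hRH, ← split' S hSH, between_union_left (dP _ _), between_union_right (dP _ _),
    between_union_right (dP _ _)] at eRS
  rw [← split P hPH, between_union_left (dR _ _)] at eP
  rw [← split Q hQH, between_union_left (dR _ _)] at eQ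
  have split_P := split P hPH
  have split_Q := split Q hQH
  have dab := dR P P
  have dcd := dR Q Q
  have dac := dP R R
  have dad := dP R S
  have dbc := dP S R
  have dbd := dP S S
  set a := P ∩ R
  set b := P ∩ S
  set c := Q ∩ R
  set d := Q ∩ S
  have hH : (a ∪ b) ∪ (c ∪ d) = H := by rw [split_P, split_Q, h.union]
  have ba : between m a aᶜ = between m a (b ∪ (c ∪ d)) + between m a Hᶜ :=
    between_compl_of_union (by simp [dab, dac, dad]) (by rw [← hH, Finset.union_assoc])
  have bb : between m b bᶜ = between m b (a ∪ (c ∪ d)) + between m b Hᶜ :=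
    between_compl_of_union (by simp [dab.symm, dbc, dbd])
      (by rw [← hH, ← Finset.union_assoc, Finset.union_comm b a])
  have bc : between m c cᶜ = between m c (d ∪ (a ∪ b)) + between m c Hᶜ :=
    between_compl_of_union (by simp [dcd, dac.symm, dbc.symm])
      (by rw [← hH, Finset.union_comm (a ∪ b), Finset.union_assoc])
  have bd : between m d dᶜ = between m d (c ∪ (a ∪ b)) + between m d Hᶜ :=
    between_compl_of_union (by simp [dcd.symm, dad.symm, dbd.symm])
      (by rw [← hH, ← Finset.union_assoc, Finset.union_comm d c, Finset.union_comm])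
  rw [between_union_right (by simp [dbc, dbd]), between_union_right dcd] at ba
  rw [between_union_right (by simp [dac, dad]), between_union_right dcd] at bb
  rw [between_union_right (by simp [dad.symm, dbd.symm]), between_union_right dab] at bc
  rw [between_union_right (by simp [dac.symm, dbc.symm]), between_union_right dab] at bd
  rw [between_comm hm.symm b a] at bb
  rw [between_comm hm.symm c a, between_comm hm.symm c b] at bc
  rw [between_comm hm.symm d a, between_comm hm.symm d b, between_comm hm.symm d c] at bd
  rw [between_comm hm.symm c b] at eRS
  have pa : p a := hm.mono _ _ (Finset.inter_subset_left.trans hPH) hp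
  have pb : p b := hm.mono _ _ (Finset.inter_subset_left.trans hPH) hp
  have pc : p c := hm.mono _ _ (Finset.inter_subset_left.trans hQH) hp
  have pd : p d := hm.mono _ _ (Finset.inter_subset_left.trans hQH) hp
  have la := hm.three_le_boundary pa hPR
  have lb := hm.three_le_boundary pb hPS
  have lc := hm.three_le_boundary pc hQR
  have ld := hm.three_le_boundary pd hQS
  -- The four corners have boundaries of total 4 + 2(2 + 2 − d(a, d) − d(b, c)) ≤ 12, because only
  -- the diagonal edges lie in both splits. Each boundary is at least 3, so each is exactly 3.
  have ca := hm.card_le_one pa (by omega)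
  have cb := hm.card_le_one pb (by omega)
  have cc := hm.card_le_one pc (by omega)
  have cd := hm.card_le_one pd (by omega)
  have : H.card ≤ (a.card + b.card) + (c.card + d.card) := by
    rw [← hH]
    exact (Finset.card_union_le _ _).trans
      (add_le_add (Finset.card_union_le _ _) (Finset.card_union_le _ _))
  omega

/-- Even splits of a set with at least five vertices do not cross: if the second split cuts `P`, it
cannot cut `Q` as well. -/
theorem subset_or_subset_of_evenSplit (hp : p H) (hc : 5 ≤ H.card) (h : IsEvenSplit m H P Q)
    (h' : IsEvenSplit m H R S) (hPR : (P ∩ R).Nonempty) (hPS : (P ∩ S).Nonempty) :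
    Q ⊆ R ∨ Q ⊆ S := by
  have hQH : Q ⊆ H := h.union ▸ Finset.subset_union_right
  by_contra! hQ
  have h1 : (Q ∩ S).Nonempty := by
    obtain ⟨x, hx, hxR⟩ := Finset.not_subset.1 hQ.1
    have := hQH hx
    rw [← h'.union, Finset.mem_union] at this
    exact ⟨x, Finset.mem_inter.2 ⟨hx, this.resolve_left hxR⟩⟩
  have h2 : (Q ∩ R).Nonempty := by
    obtain ⟨x, hx, hxR⟩ := Finset.not_subset.1 hQ.2
    have := hQH hx
    rw [← h'.union, Finset.mem_union] at this
    exact ⟨x, Finset.mem_inter.2 ⟨hx, this.resolve_right hxR⟩⟩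
  have := hm.card_le_four_of_crossing hp h h' hPR hPS h2 h1
  omega

/-- There are no two nested even splits of a set with more than four vertices. -/
theorem not_nested_evenSplit (hp : p H) (hc : 5 ≤ H.card) (hSH : IsEvenSplit m H S (T ∪ Q))
    (hQH : IsEvenSplit m H (S ∪ T) Q) (hST : Disjoint S T) (hTQ : Disjoint T Q)
    (hT : T.Nonempty) : False := by
  induction T using Finset.strongInduction generalizing S Q with
  | H T ih =>
    have hSQ : Disjoint S Q := hSH.disj.mono_right Finset.subset_union_right
    have hTH : T ⊆ H := by
      rw [← hSH.union]
      exact Finset.subset_union_left.trans Finset.subset_union_right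
    have e1 := hSH.cross
    rw [between_union_right hTQ] at e1
    have e2 := hQH.cross
    rw [between_union_left hST] at e2
    have e3 := hQH.left
    rw [between_union_left hST, hSH.left] at e3
    -- Both `S` and `S ∪ T` send two edges out of `H`. So `T` sends none, and its boundary is 4 − 2
    -- d(S, Q). As this is at least 3, it equals 4, and `T` contains an edge.
    have hT0 : between m T Hᶜ = 0 := by omega
    have bT : between m T Tᶜ = between m T (S ∪ Q) + between m T Hᶜ :=
      between_compl_of_union (by simp [hST.symm, hTQ])
        (by rw [← hSH.union, ← Finset.union_assoc, Finset.union_comm T S, Finset.union_assoc])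
    rw [between_union_right hSQ, between_comm hm.symm T S] at bT
    have lT := hm.three_le_boundary (hm.mono _ _ hTH hp) hT
    have b4 : between m H Hᶜ = 4 := by
      rw [← hSH.union, between_union_left hSH.disj, hSH.union, hSH.left, hSH.right]
    obtain ⟨u, hu, v, hv, huv⟩ := hm.exists_edge_of_boundary_eq_four (T := T) (by omega) hT
    have main : ∀ R R', IsEvenSplit m H R R' → (T ∩ R).Nonempty → (T ∩ R').Nonempty →
        S ⊆ R → False := by
      intro R R' hR hTR hTR' hSR
      have hRH : R ⊆ H := hR.union ▸ Finset.subset_union_left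
      have hR'H : R' ⊆ H := hR.union ▸ Finset.subset_union_right
      have hSR' : Disjoint S R' := hR.disj.mono_left hSR
      have hQ := hm.subset_or_subset_of_evenSplit hp hc hQH hR
        (hTR.mono (Finset.inter_subset_inter_right Finset.subset_union_right))
        (hTR'.mono (Finset.inter_subset_inter_right Finset.subset_union_right))
      rcases hQ with hQ | hQ
      -- Here the part `R'` lies inside `T`, which has no edge to the complement of `H`, whereas
      -- `R'` has two.
      · have hR'T : R' ⊆ T := by
          intro x hx
          have hxH := hR'H hx
          rw [← hSH.union, Finset.mem_union, Finset.mem_union] at hxH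
          rcases hxH with h | h | h
          · exact absurd hx (Finset.disjoint_left.1 hSR' h)
          · exact h
          · exact absurd hx (Finset.disjoint_left.1 hR.disj (hQ h))
        have := between_mono (m := m) hR'T (subset_refl Hᶜ)
        have := hR.right
        omega
      -- Here `S`, `T ∩ R`, `R'` is again a nested pair of splits, with a smaller middle part: this
      -- is the descent.
      · have hQR : Disjoint R Q := hR.disj.mono_right hQ
        have u1 : S ∪ T ∩ R = R := by
          ext x
          constructor
          · intro hx
            rcases Finset.mem_union.1 hx with h | h
            · exact hSR h
            · exact (Finset.mem_inter.1 h).2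
          · intro hx
            have hxH := hRH hx
            rw [← hSH.union, Finset.mem_union, Finset.mem_union] at hxH
            rcases hxH with h | h | h
            · exact Finset.mem_union_left _ h
            · exact Finset.mem_union_right _ (Finset.mem_inter.2 ⟨h, hx⟩)
            · exact absurd h (Finset.disjoint_left.1 hQR hx)
        have d1 : Disjoint (T ∩ R) R' := hR.disj.mono_left Finset.inter_subset_right
        have u2 : T ∩ R ∪ R' = T ∪ Q := by
          ext x
          constructor
          · intro hx
            rcases Finset.mem_union.1 hx with h | h
            · exact Finset.mem_union_left _ (Finset.mem_inter.1 h).1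
            · have hxH := hR'H h
              rw [← hSH.union, Finset.mem_union] at hxH
              exact hxH.resolve_left fun h' => Finset.disjoint_left.1 hSR' h' h
          · intro hx
            rcases Finset.mem_union.1 hx with h | h
            · have hxH := hTH h
              rw [← hR.union, Finset.mem_union] at hxH
              rcases hxH with h' | h'
              · exact Finset.mem_union_left _ (Finset.mem_inter.2 ⟨h, h'⟩)
              · exact Finset.mem_union_right _ h'
            · exact Finset.mem_union_right _ (hQ h)
        refine ih (T ∩ R) ⟨Finset.inter_subset_left, fun hle => ?_⟩ (S := S) (Q := R') ?_ ?_
          (hST.mono_right Finset.inter_subset_left) d1 hTR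
        · obtain ⟨x, hx⟩ := hTR'
          rw [Finset.mem_inter] at hx
          exact Finset.disjoint_left.1 hR.disj (Finset.mem_inter.1 (hle hx.1)).2 hx.2
        · rw [u2]; exact hSH
        · rw [u1]; exact hR
    have hc3 : 3 ≤ H.card := by omega
    obtain ⟨R, R', hR, huR, hvR'⟩ := hm.exists_evenSplit hp b4 hc3 (hTH hu) (hTH hv) huv
    have n1 : (T ∩ R).Nonempty := ⟨u, Finset.mem_inter.2 ⟨hu, huR⟩⟩
    have n2 : (T ∩ R').Nonempty := ⟨v, Finset.mem_inter.2 ⟨hv, hvR'⟩⟩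
    rcases hm.subset_or_subset_of_evenSplit hp hc (hSH.symm hm.symm) hR
      (n1.mono (Finset.inter_subset_inter_right Finset.subset_union_left))
      (n2.mono (Finset.inter_subset_inter_right Finset.subset_union_left)) with h | h
    · exact main R R' hR n1 n2 h
    · exact main R' R (hR.symm hm.symm) n2 n1 h

theorem card_le_four (hp : p H) (hb : between m H Hᶜ ≤ 4) : H.card ≤ 4 := by
  by_contra! hc
  have hc5 : 5 ≤ H.card := hc
  have hne : H.Nonempty := Finset.card_pos.1 (by omega)
  have h3 := hm.three_le_boundary hp hne
  have hb4 : between m H Hᶜ = 4 := by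
    have := fun h => hm.card_le_one hp h
    omega
  obtain ⟨u, hu, v, hv, huv⟩ := hm.exists_edge_of_lt (H := H) (by omega)
  obtain ⟨P, Q, h, -, -⟩ := hm.exists_evenSplit hp hb4 (by omega) hu hv huv
  have hPH : P ⊆ H := h.union ▸ Finset.subset_union_left
  -- The part `P` has boundary 2 + 2 = 4 and so contains an edge. A split along this edge cuts `P`,
  -- hence does not cut `Q`, and the two splits are nested.
  have bP := between_compl_of_union (m := m) h.disj h.union
  rw [h.cross, h.left] at bP
  obtain ⟨x, hx, y, hy, hxy⟩ := hm.exists_edge_of_boundary_eq_four bP h.left_nonempty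
  obtain ⟨R, S, h', hxR, hyS⟩ := hm.exists_evenSplit hp hb4 (by omega) (hPH hx) (hPH hy) hxy
  have main : ∀ R S, IsEvenSplit m H R S → (P ∩ R).Nonempty → Q ⊆ R → False := by
    intro R S h' hPR hQR
    have hSQ : Disjoint S Q := h'.disj.symm.mono_right hQR
    have hRH : R ⊆ H := h'.union ▸ Finset.subset_union_left
    have hSH : S ⊆ H := h'.union ▸ Finset.subset_union_right
    have hSP : S ⊆ P := by
      intro x hx
      have := hSH hx
      rw [← h.union, Finset.mem_union] at this
      exact this.resolve_right (Finset.disjoint_left.1 hSQ hx)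
    have u1 : P ∩ R ∪ Q = R := by
      ext x
      constructor
      · intro hx
        rcases Finset.mem_union.1 hx with h | h
        · exact (Finset.mem_inter.1 h).2
        · exact hQR h
      · intro hx
        have := hRH hx
        rw [← h.union, Finset.mem_union] at this
        rcases this with h | h
        · exact Finset.mem_union_left _ (Finset.mem_inter.2 ⟨h, hx⟩)
        · exact Finset.mem_union_right _ h
    have u2 : S ∪ P ∩ R = P := by
      ext x
      constructor
      · intro hx
        rcases Finset.mem_union.1 hx with h | h
        · exact hSP h
        · exact (Finset.mem_inter.1 h).1
      · intro hx
        have := hPH hx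
        rw [← h'.union, Finset.mem_union] at this
        rcases this with h | h
        · exact Finset.mem_union_right _ (Finset.mem_inter.2 ⟨hx, h⟩)
        · exact Finset.mem_union_left _ h
    refine hm.not_nested_evenSplit hp hc5 (S := S) (T := P ∩ R) (Q := Q) ?_ ?_
      (h'.disj.symm.mono_right Finset.inter_subset_right)
      (h.disj.mono_left Finset.inter_subset_left) hPR
    · rw [u1]; exact h'.symm hm.symm
    · rw [u2]; exact h
  have n1 : (P ∩ R).Nonempty := ⟨x, Finset.mem_inter.2 ⟨hx, hxR⟩⟩
  have n2 : (P ∩ S).Nonempty := ⟨y, Finset.mem_inter.2 ⟨hy, hyS⟩⟩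
  rcases hm.subset_or_subset_of_evenSplit hp hc5 h h' n1 n2 with hQ | hQ
  · exact main R S h' n1 hQ
  · exact main S R (h'.symm hm.symm) n2 hQ

end IsTightCubic

end Multigraph

/-! ## Plane maps: the cycle space is generated by the faces -/

namespace CombMap

variable {D : Type*} (M : CombMap D)

theorem next_apply (d : D) : M.next d = M.rot (M.rev d) := rfl

theorem next_rev (d : D) : M.next (M.rev d) = M.rot d := by rw [next_apply, M.rev_rev]

theorem tail_rot (d : D) : M.tail (M.rot d) = M.tail d :=
  Quotient.sound (s := Equiv.Perm.SameCycle.setoid M.rot) ⟨-1, by simp⟩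

theorem tail_next (d : D) : M.tail (M.next d) = M.head d := M.tail_rot _

theorem face_next (d : D) : M.face (M.next d) = M.face d :=
  Quotient.sound (s := Equiv.Perm.SameCycle.setoid M.next) ⟨-1, by simp⟩

theorem face_rot (d : D) : M.face (M.rot d) = M.face (M.rev d) := by
  rw [← M.next_rev, M.face_next]

theorem head_rev (d : D) : M.head (M.rev d) = M.tail d := by rw [head, M.rev_rev]

theorem tail_rev (d : D) : M.tail (M.rev d) = M.head d := rfl

theorem edge_rev (d : D) : M.edge (M.rev d) = M.edge d :=
  M.edge_eq_iff.2 (Or.inr (M.rev_rev d).symm)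

theorem exists_tail_eq (v : M.Vertex) : ∃ d, M.tail d = v := Quotient.exists_rep v

theorem exists_edge_eq (e : M.Edge) : ∃ d, M.edge d = e := Quotient.exists_rep e

theorem exists_face_eq (φ : M.Face) : ∃ d, M.face d = φ := Quotient.exists_rep φ

instance [Finite D] : Finite M.Vertex := Quotient.finite _

instance [Finite D] : Finite M.Edge := Quotient.finite _

instance [Finite D] : Finite M.Face := Quotient.finite _

variable {M}

theorem isLink_edge_iff {d : D} {x y : M.Vertex} : M.graph.IsLink (M.edge d) x y ↔
    (M.tail d = x ∧ M.head d = y) ∨ (M.tail d = y ∧ M.head d = x) := by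
  constructor
  · rintro ⟨d', hd', rfl, rfl⟩
    rcases M.edge_eq_iff.1 hd' with rfl | rfl
    · exact Or.inl ⟨rfl, rfl⟩
    · exact Or.inr ⟨M.tail_rev _, M.head_rev _⟩
  · rintro (⟨rfl, rfl⟩ | ⟨rfl, rfl⟩)
    · exact ⟨d, rfl, rfl, rfl⟩
    · exact ⟨M.rev d, M.edge_rev d, M.tail_rev _, M.head_rev _⟩

theorem isLink_edge (d : D) : M.graph.IsLink (M.edge d) (M.tail d) (M.head d) :=
  ⟨d, rfl, rfl, rfl⟩

theorem edge_mem_cut_iff {d : D} {X : Set M.Vertex} :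
    M.edge d ∈ M.graph.cut X ↔ ¬ (M.tail d ∈ X ↔ M.head d ∈ X) := by
  constructor
  · rintro ⟨x, hx, y, hy, h⟩
    rcases isLink_edge_iff.1 h with ⟨rfl, rfl⟩ | ⟨rfl, rfl⟩ <;> tauto
  · intro h
    by_cases ht : M.tail d ∈ X
    · exact ⟨_, ht, _, by tauto, isLink_edge d⟩
    · exact ⟨_, by tauto, _, ht, (isLink_edge d).symm⟩

/-- A property of vertices that is carried along all edges holds everywhere in a connected map. -/
theorem vertex_induction (hM : M.graph.IsConn) {p : M.Vertex → Prop} {v₀ : M.Vertex} (h₀ : p v₀)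
    (h : ∀ d, p (M.tail d) → p (M.head d)) (v : M.Vertex) : p v := by
  have := hM.2 v₀ (Set.mem_univ _) v (Set.mem_univ _)
  induction this with
  | refl => exact h₀
  | tail _ hadj ih =>
    obtain ⟨e, d, rfl, rfl, rfl⟩ := hadj
    exact h d ih

/-- A property of darts that is invariant under `rot` and `rev` holds everywhere in a
connected map. -/
theorem dart_induction (hM : M.graph.IsConn) {p : D → Prop} {d₀ : D} (h₀ : p d₀)
    (hrot : ∀ d, p d ↔ p (M.rot d)) (hrev : ∀ d, p d → p (M.rev d)) (d : D) : p d := by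
  have htail : ∀ a b, M.tail a = M.tail b → p a → p b := by
    intro a b hab ha
    obtain ⟨n, rfl⟩ : M.rot.SameCycle a b := Quotient.exact hab
    have : ∀ n : ℤ, p ((M.rot ^ n) a) := by
      intro n
      induction n using Int.induction_on with
      | zero => simpa using ha
      | succ i ih =>
        rw [add_comm, zpow_add, zpow_one, Equiv.Perm.mul_apply]
        exact (hrot _).1 ih
      | pred i ih =>
        rw [hrot, ← Equiv.Perm.mul_apply, ← zpow_one_add]
        simpa using ih
    exact this n
  have := M.vertex_induction hM (p := fun v => ∀ d, M.tail d = v → p d) (v₀ := M.tail d₀)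
    (fun d hd => htail _ _ hd.symm h₀)
    (fun d hd a ha => htail (M.rev d) a ((M.tail_rev d).trans ha.symm) (hrev _ (hd d rfl))) (M.tail d)
  exact this d rfl

/-! ### Exactness of the mod 2 cochain complex at the edges -/

section Homology

variable (M)

/-- The simplicial coboundary of a `0`-cochain modulo two. -/
noncomputable def coboundary : (M.Vertex → ZMod 2) →ₗ[ZMod 2] (M.Edge → ZMod 2) :=
  { toFun := fun f e => f (M.tail e.out) + f (M.head e.out)
    map_add' := fun f g => by ext e; simp only [Pi.add_apply]; ring
    map_smul' := fun c f => by ext e; simp only [Pi.smul_apply, smul_add, RingHom.id_apply] }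

open Classical in
/-- The sum of a `1`-cochain along every face boundary, modulo two. -/
noncomputable def faceSum [Fintype D] : (M.Edge → ZMod 2) →ₗ[ZMod 2] (M.Face → ZMod 2) :=
  LinearMap.pi fun φ => ∑ d with M.face d = φ, LinearMap.proj (M.edge d)

theorem coboundary_edge (f : M.Vertex → ZMod 2) (d : D) :
    M.coboundary f (M.edge d) = f (M.tail d) + f (M.head d) := by
  have h : M.edge (M.edge d).out = M.edge d := Quotient.out_eq (M.edge d)
  change f (M.tail (M.edge d).out) + f (M.head (M.edge d).out) = _
  rcases M.edge_eq_iff.1 h with h | h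
  · rw [← h]
  · have h' : M.rev d = (M.edge d).out := by rw [congrArg M.rev h, M.rev_rev]
    rw [← h', tail_rev, head_rev, add_comm]

open Classical in
theorem faceSum_apply [Fintype D] (g : M.Edge → ZMod 2) (φ : M.Face) :
    M.faceSum g φ = ∑ d with M.face d = φ, g (M.edge d) := by
  simp [faceSum]

/-- The head of a dart is the tail of the next one, and `next` permutes the darts of a face, so
every value is counted twice. -/
theorem faceSum_coboundary [Fintype D] (f : M.Vertex → ZMod 2) :
    M.faceSum (M.coboundary f) = 0 := by
  classical
  ext φ
  rw [faceSum_apply]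
  simp only [coboundary_edge, Finset.sum_add_distrib, ← M.tail_next]
  have : ∑ d with M.face d = φ, f (M.tail (M.next d)) = ∑ d with M.face d = φ, f (M.tail d) := by
    refine Finset.sum_equiv M.next (fun d => ?_) (fun d _ => rfl)
    simp [M.face_next]
  rw [this]
  exact CharTwo.add_self_eq_zero _

open Classical in
theorem faceSum_single [Fintype D] (d : D) : M.faceSum (Pi.single (M.edge d) 1) =
    Pi.single (M.face d) 1 + Pi.single (M.face (M.rev d)) 1 := by
  ext φ
  rw [faceSum_apply]
  have key : ∀ d', (Pi.single (M.edge d) 1 : M.Edge → ZMod 2) (M.edge d') =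
      (if d' = d then 1 else 0) + (if d' = M.rev d then 1 else 0) := by
    intro d'
    rw [Pi.single_apply, eq_comm (a := M.edge d'), M.edge_eq_iff]
    by_cases h1 : d' = d
    · subst h1
      simp [(M.rev_ne d').symm]
    · simp [h1]
  simp only [key, Finset.sum_add_distrib, Finset.sum_ite_eq', Finset.mem_filter, Finset.mem_univ,
    true_and, Pi.add_apply, Pi.single_apply, eq_comm (a := φ)]

variable {M}

-- A dimension count. Connectedness gives rank at least V − 1 for `coboundary` and at least F − 1
-- for `faceSum`. So the kernel of `faceSum` has dimension at most E − F + 1, which by Euler's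
-- formula is V − 1. The range of `coboundary` already lies in this kernel, so the two coincide.
open Classical in
theorem ker_faceSum_le [Fintype D] (hM : M.IsPlane) :
    LinearMap.ker M.faceSum ≤ LinearMap.range M.coboundary := by
  obtain ⟨hconn, heuler⟩ := hM
  have : Fintype M.Vertex := Fintype.ofFinite _
  have : Fintype M.Edge := Fintype.ofFinite _
  have : Fintype M.Face := Fintype.ofFinite _
  obtain ⟨v₀, -⟩ := hconn.1
  obtain ⟨d₀, -⟩ := M.exists_tail_eq v₀
  have hle : LinearMap.range M.coboundary ≤ LinearMap.ker M.faceSum := by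
    rintro _ ⟨f, rfl⟩
    exact M.faceSum_coboundary f
  have hker : Module.finrank (ZMod 2) (LinearMap.ker M.coboundary) ≤ 1 := by
    have : LinearMap.ker M.coboundary ≤ Submodule.span (ZMod 2) {fun _ => 1} := by
      intro f hf
      rw [Submodule.mem_span_singleton]
      refine ⟨f v₀, ?_⟩
      ext v
      have := M.vertex_induction hconn (p := fun v => f v = f v₀) (v₀ := v₀) rfl (fun d hd => ?_) v
      · simp [this]
      · have h := congrFun hf (M.edge d)
        rw [coboundary_edge, Pi.zero_apply, CharTwo.add_eq_zero] at h
        rw [← h, hd]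
    exact (Submodule.finrank_mono this).trans ((finrank_span_le_card _).trans (by simp))
  have hrange : Fintype.card M.Face ≤ Module.finrank (ZMod 2) (LinearMap.range M.faceSum) + 1 := by
    have htop : LinearMap.range M.faceSum ⊔
        Submodule.span (ZMod 2) {Pi.single (M.face d₀) (1 : ZMod 2)} = ⊤ := by
      -- Modulo the range, the unit vectors of the faces on the two sides of an edge agree, so one
      -- unit vector generates the quotient.
      have hsingle : ∀ d, (Pi.single (M.face d) 1 : M.Face → ZMod 2) ∈
          LinearMap.range M.faceSum ⊔
            Submodule.span (ZMod 2) {Pi.single (M.face d₀) (1 : ZMod 2)} := by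
        have step : ∀ d, (Pi.single (M.face d) 1 + Pi.single (M.face (M.rev d)) 1 :
            M.Face → ZMod 2) ∈ LinearMap.range M.faceSum ⊔
            Submodule.span (ZMod 2) {Pi.single (M.face d₀) (1 : ZMod 2)} := fun d =>
          Submodule.mem_sup_left ⟨_, M.faceSum_single d⟩
        refine M.dart_induction hconn (d₀ := d₀) ?_ ?_ ?_
        · exact Submodule.mem_sup_right (Submodule.mem_span_singleton_self _)
        · intro d
          rw [M.face_rot]
          exact ⟨fun h => (Submodule.add_mem_iff_right _ h).1 (step d),
            fun h => (Submodule.add_mem_iff_left _ h).1 (step d)⟩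
        · intro d h
          exact (Submodule.add_mem_iff_right _ h).1 (step d)
      rw [eq_top_iff]
      intro h _
      rw [← Finset.univ_sum_single h]
      refine Submodule.sum_mem _ fun φ _ => ?_
      obtain ⟨d, rfl⟩ := M.exists_face_eq φ
      have : (Pi.single (M.face d) (h (M.face d)) : M.Face → ZMod 2) =
          h (M.face d) • Pi.single (M.face d) 1 := by
        rw [← Pi.single_smul]; simp
      rw [this]
      exact Submodule.smul_mem _ _ (hsingle d)
    have h1 := Submodule.finrank_add_le_finrank_add_finrank (LinearMap.range M.faceSum)
      (Submodule.span (ZMod 2) {Pi.single (M.face d₀) (1 : ZMod 2)})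
    rw [htop, finrank_top, Module.finrank_fintype_fun_eq_card] at h1
    have h2 := finrank_span_le_card (R := ZMod 2)
      {(Pi.single (M.face d₀) (1 : ZMod 2) : M.Face → ZMod 2)}
    rw [Set.toFinset_singleton, Finset.card_singleton] at h2
    omega
  have r1 := LinearMap.finrank_range_add_finrank_ker M.coboundary
  have r2 := LinearMap.finrank_range_add_finrank_ker M.faceSum
  rw [Module.finrank_fintype_fun_eq_card] at r1 r2
  rw [Nat.card_eq_fintype_card, Nat.card_eq_fintype_card, Nat.card_eq_fintype_card] at heuler
  exact (Submodule.eq_of_le_of_finrank_le hle (by omega)).ge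

end Homology

/-- In a plane map, two edges that separate the same pair of faces form a cut. -/
theorem exists_cut_pair [Finite D] (hM : M.IsPlane) {d₁ d₂ : D} (hne : M.edge d₁ ≠ M.edge d₂)
    (h : M.face d₁ = M.face d₂) (h' : M.face (M.rev d₁) = M.face (M.rev d₂)) :
    ∃ X, M.graph.cut X = {M.edge d₁, M.edge d₂} := by
  classical
  have : Fintype D := Fintype.ofFinite D
  -- Both edges contribute the same two unit vectors to the face sums, which cancel modulo 2. So the
  -- indicator of the pair is a coboundary, that is, the indicator of a cut.
  obtain ⟨f, hf⟩ := ker_faceSum_le hM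
    (show Pi.single (M.edge d₁) 1 + Pi.single (M.edge d₂) 1 ∈ LinearMap.ker M.faceSum by
      rw [LinearMap.mem_ker, map_add, faceSum_single, faceSum_single, h, h']
      exact funext fun _ => CharTwo.add_self_eq_zero (R := ZMod 2) _)
  refine ⟨{v | f v = 1}, ?_⟩
  ext e
  obtain ⟨d, rfl⟩ := M.exists_edge_eq e
  have hd := congrFun hf (M.edge d)
  rw [coboundary_edge, Pi.add_apply, Pi.single_apply, Pi.single_apply] at hd
  rw [edge_mem_cut_iff, Set.mem_insert_iff, Set.mem_singleton_iff, Set.mem_ofPred_eq,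
    Set.mem_ofPred_eq]
  have key : ∀ a b : ZMod 2, ¬ (a = 1 ↔ b = 1) ↔ a + b = 1 := by decide
  rw [key, hd]
  by_cases h1 : M.edge d = M.edge d₁
  · simp [h1, hne]
  · by_cases h2 : M.edge d = M.edge d₂
    · simp [h2, hne.symm]
    · simp [h1, h2]

/-- An edge with the same face on both sides is counted twice in the sum of that face, so its
indicator is a coboundary. -/
theorem exists_cut_singleton [Finite D] (hM : M.IsPlane) {d : D}
    (h : M.face d = M.face (M.rev d)) : ∃ X, M.graph.cut X = {M.edge d} := by
  classical
  have : Fintype D := Fintype.ofFinite D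
  obtain ⟨f, hf⟩ := ker_faceSum_le hM
    (show Pi.single (M.edge d) 1 ∈ LinearMap.ker M.faceSum by
      rw [LinearMap.mem_ker, faceSum_single, ← h]
      exact funext fun _ => CharTwo.add_self_eq_zero _)
  refine ⟨{v | f v = 1}, ?_⟩
  ext e
  obtain ⟨d', rfl⟩ := M.exists_edge_eq e
  have hd := congrFun hf (M.edge d')
  rw [coboundary_edge, Pi.single_apply] at hd
  rw [edge_mem_cut_iff, Set.mem_singleton_iff, Set.mem_ofPred_eq, Set.mem_ofPred_eq]
  have key : ∀ a b : ZMod 2, ¬ (a = 1 ↔ b = 1) ↔ a + b = 1 := by decide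
  rw [key, hd]
  by_cases h1 : M.edge d' = M.edge d <;> simp [h1]

end CombMap

/-! ### Orbits of a permutation as initial segments of its iterates -/

theorem Equiv.Perm.setOf_sameCycle_eq_image {α : Type*} [Finite α] (f : Equiv.Perm α) (x : α) :
    {y | f.SameCycle x y} = (fun i => (f ^ i) x) '' Set.Iio (Function.minimalPeriod f x) := by
  have hpos : 0 < Function.minimalPeriod f x :=
    Function.minimalPeriod_pos_of_mem_periodicPts (Function.Injective.mem_periodicPts f.injective x)
  ext y
  constructor
  · intro h
    obtain ⟨i, -, hi⟩ := Equiv.Perm.SameCycle.exists_pow_eq' h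
    refine ⟨i % Function.minimalPeriod f x, Nat.mod_lt _ hpos, ?_⟩
    simp only [← Equiv.Perm.iterate_eq_pow] at hi ⊢
    rw [Function.iterate_mod_minimalPeriod_eq, hi]
  · rintro ⟨i, -, rfl⟩
    exact ⟨i, by simp⟩

theorem Equiv.Perm.ncard_sameCycle {α : Type*} [Finite α] (f : Equiv.Perm α) (x : α) :
    {y | f.SameCycle x y}.ncard = Function.minimalPeriod f x := by
  rw [f.setOf_sameCycle_eq_image, Set.InjOn.ncard_image]
  · simp [← Finset.coe_Iio, Set.ncard_coe_finset]
  · intro i hi j hj hij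
    simp only [← Equiv.Perm.iterate_eq_pow] at hij
    exact Function.iterate_injOn_Iio_minimalPeriod hi hj hij

theorem Equiv.Perm.pow_ncard_sameCycle {α : Type*} [Finite α] (f : Equiv.Perm α) (x : α) :
    (f ^ {y | f.SameCycle x y}.ncard) x = x := by
  rw [f.ncard_sameCycle, ← Equiv.Perm.iterate_eq_pow]
  exact Function.isPeriodicPt_minimalPeriod f x

theorem Equiv.Perm.exists_pow_eq_of_sameCycle {α : Type*} [Finite α] {f : Equiv.Perm α} {x y : α}
    (h : f.SameCycle x y) : ∃ i < {y | f.SameCycle x y}.ncard, (f ^ i) x = y := by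
  rw [f.ncard_sameCycle]
  have : y ∈ {y | f.SameCycle x y} := h
  rw [f.setOf_sameCycle_eq_image] at this
  exact this

theorem Equiv.Perm.pow_injOn_sameCycle {α : Type*} [Finite α] {f : Equiv.Perm α} {x : α} {i j : ℕ}
    (hi : i < {y | f.SameCycle x y}.ncard) (hj : j < {y | f.SameCycle x y}.ncard)
    (h : (f ^ i) x = (f ^ j) x) : i = j := by
  rw [f.ncard_sameCycle] at hi hj
  simp only [← Equiv.Perm.iterate_eq_pow] at h
  exact Function.iterate_injOn_Iio_minimalPeriod hi hj h

/-! ## Cubic 2-connected plane maps -/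

namespace CombMap

variable {D : Type*}

/-- The map of a 2-connected plane cubic graph. -/
structure IsCubicPlane (M : CombMap D) : Prop where
  plane : M.IsPlane
  cubic : M.graph.IsCubic
  twoConnected : M.graph.IsTwoConnected

variable {M : CombMap D}

theorem mem_boundary_vertexSet {φ : M.Face} {v : M.Vertex} :
    v ∈ (M.boundary φ).vertexSet ↔ ∃ d, M.face d = φ ∧ M.tail d = v := Iff.rfl

/-- The induced vertex set imposes no further condition: the head of a dart of the face is the tail
of the next dart of the face. -/
theorem boundary_isLink {φ : M.Face} {d : D} {x y : M.Vertex} :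
    (M.boundary φ).IsLink (M.edge d) x y ↔
      (M.face d = φ ∨ M.face (M.rev d) = φ) ∧ M.graph.IsLink (M.edge d) x y := by
  have key : (∃ d', M.face d' = φ ∧ M.edge d' = M.edge d) ↔
      (M.face d = φ ∨ M.face (M.rev d) = φ) := by
    constructor
    · rintro ⟨d', hd', he⟩
      rcases M.edge_eq_iff.1 he with rfl | rfl
      · exact Or.inl hd'
      · exact Or.inr (by rwa [M.rev_rev])
    · rintro (h | h)
      · exact ⟨d, h, rfl⟩
      · exact ⟨M.rev d, h, M.edge_rev d⟩
  have htail : ∀ d', M.face d' = φ → ∃ d'', M.face d'' = φ ∧ M.tail d'' = M.tail d' :=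
    fun d' h => ⟨d', h, rfl⟩
  have hhead : ∀ d', M.face d' = φ → ∃ d'', M.face d'' = φ ∧ M.tail d'' = M.head d' :=
    fun d' h => ⟨M.next d', (M.face_next d').trans h, M.tail_next d'⟩
  constructor
  · rintro ⟨h1, h2, h3⟩
    exact ⟨key.1 h1, h2⟩
  · rintro ⟨h1, h2⟩
    have ends : (∃ d', M.face d' = φ ∧ M.tail d' = M.tail d) ∧
        (∃ d', M.face d' = φ ∧ M.tail d' = M.head d) := by
      rcases h1 with h1 | h1
      · exact ⟨htail _ h1, hhead _ h1⟩
      · refine ⟨?_, ?_⟩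
        · have := hhead _ h1
          rwa [M.head_rev] at this
        · exact htail _ h1
    refine ⟨key.2 h1, h2, ?_⟩
    rcases isLink_edge_iff.1 h2 with ⟨rfl, rfl⟩ | ⟨rfl, rfl⟩
    · exact ends
    · exact ends.symm

theorem edge_mem_boundary {φ : M.Face} {d : D} :
    M.edge d ∈ (M.boundary φ).edgeSet ↔ (M.face d = φ ∨ M.face (M.rev d) = φ) := by
  constructor
  · intro h
    obtain ⟨x, y, hxy⟩ := Graph.exists_isLink_of_mem_edgeSet h
    exact (boundary_isLink.1 hxy).1
  · intro h
    exact (boundary_isLink.2 ⟨h, isLink_edge d⟩).edge_mem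

theorem boundary_isConn [Finite D] (φ : M.Face) : (M.boundary φ).IsConn := by
  obtain ⟨d₀, hd₀⟩ := M.exists_face_eq φ
  refine ⟨⟨M.tail d₀, d₀, hd₀, rfl⟩, ?_⟩
  rintro _ ⟨d, hd, rfl⟩ _ ⟨d', hd', rfl⟩
  obtain ⟨i, -, rfl⟩ : ∃ i < orderOf M.next, (M.next ^ i) d = d' :=
    Equiv.Perm.SameCycle.exists_pow_eq' (Quotient.exact (hd.trans hd'.symm))
  clear hd'
  induction i with
  | zero => exact Relation.ReflTransGen.refl
  | succ i ih =>
    refine ih.tail ⟨M.edge ((M.next ^ i) d), boundary_isLink.2 ⟨Or.inl ?_, ?_⟩⟩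
    · rw [← hd]
      exact Quotient.sound (s := Equiv.Perm.SameCycle.setoid M.next) ⟨-i, by simp⟩
    · rw [pow_succ', Equiv.Perm.mul_apply, M.tail_next]
      exact isLink_edge _

namespace IsCubicPlane

variable (hM : M.IsCubicPlane)
include hM

theorem isConn : M.graph.IsConn := hM.plane.1

theorem tail_ne_head (d : D) : M.tail d ≠ M.head d := by
  have := hM.twoConnected.2.1
  exact (isLink_edge d).ne

theorem ncard_tail_eq [Finite D] (v : M.Vertex) : {d | M.tail d = v}.ncard = 3 := by
  have := hM.twoConnected.2.1
  have h := hM.cubic v (Set.mem_univ _)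
  have h0 : M.graph.loopSet v = ∅ := by
    ext e
    simp
  have h1 : M.graph.incidenceSet v = M.edge '' {d | M.tail d = v} := by
    ext e
    constructor
    · rintro ⟨y, d, rfl, rfl, rfl⟩
      exact ⟨d, rfl, rfl⟩
    · rintro ⟨d, rfl, rfl⟩
      exact ⟨_, isLink_edge d⟩
  rw [Graph.deg, h0, Set.ncard_empty, h1, Set.InjOn.ncard_image] at h
  · exact h
  · intro d hd d' hd' he
    rcases M.edge_eq_iff.1 he with rfl | rfl
    · rfl
    · exact absurd (hd.trans hd'.symm) (hM.tail_ne_head d)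

theorem ncard_rot [Finite D] (d : D) : {d' | M.rot.SameCycle d d'}.ncard = 3 := by
  rw [← hM.ncard_tail_eq (M.tail d)]
  congr 1
  ext d'
  constructor
  · intro h
    exact Quotient.sound (s := Equiv.Perm.SameCycle.setoid M.rot) h.symm
  · intro h
    exact (Quotient.exact h : M.rot.SameCycle d' d).symm

theorem rot_rot_rot [Finite D] (d : D) : M.rot (M.rot (M.rot d)) = d := by
  have := M.rot.pow_ncard_sameCycle d
  rwa [hM.ncard_rot] at this

theorem rot_ne [Finite D] (d : D) : M.rot d ≠ d := by
  intro h
  have := Equiv.Perm.pow_injOn_sameCycle (f := M.rot) (x := d) (i := 1) (j := 0)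
    (by rw [hM.ncard_rot]; norm_num) (by rw [hM.ncard_rot]; norm_num) (by simpa using h)
  omega

theorem tail_eq_iff [Finite D] {d d' : D} :
    M.tail d = M.tail d' ↔ d' = d ∨ d' = M.rot d ∨ d' = M.rot (M.rot d) := by
  constructor
  · intro h
    obtain ⟨i, hi, rfl⟩ := Equiv.Perm.exists_pow_eq_of_sameCycle
      (Quotient.exact h : M.rot.SameCycle d d')
    rw [hM.ncard_rot] at hi
    interval_cases i
    · exact Or.inl rfl
    · exact Or.inr (Or.inl rfl)
    · exact Or.inr (Or.inr rfl)
  · rintro (rfl | rfl | rfl)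
    · rfl
    · rw [M.tail_rot]
    · rw [M.tail_rot, M.tail_rot]

/-- A 2-connected cubic graph has no bridge. -/
theorem cut_ne_singleton [Finite D] (X : Set M.Vertex) (e : M.Edge) : M.graph.cut X ≠ {e} := by
  intro h
  have he : e ∈ M.graph.cut X := by rw [h]; rfl
  obtain ⟨x, hx, y, hy, d, rfl, rfl, rfl⟩ := he
  -- The edge of `rot d` leads from `tail d` to another vertex of `X`. Without `tail d` the graph
  -- still connects that vertex with `head d`, outside `X`, but the only edge of the cut ends in
  -- `tail d`.
  have h1 : M.edge (M.rot d) ∉ M.graph.cut X := by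
    rw [h, Set.mem_singleton_iff, M.edge_eq_iff]
    rintro (h' | h')
    · exact hM.rot_ne d h'.symm
    · have := hM.tail_ne_head (M.rot d)
      rw [← M.tail_rev, ← h', M.tail_rot] at this
      exact this rfl
  rw [edge_mem_cut_iff, not_not, M.tail_rot] at h1
  have hx' := h1.1 hx
  have hne : M.head (M.rot d) ≠ M.tail d := by
    have := hM.tail_ne_head (M.rot d)
    rw [M.tail_rot] at this
    exact this.symm
  have hconn := (hM.twoConnected.2.2.2 (M.tail d) (Set.mem_univ _)).2 (M.head (M.rot d))
    (by simpa using ⟨Set.mem_univ _, hne⟩) (M.head d)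
    (by simpa using ⟨Set.mem_univ _, (hM.tail_ne_head d).symm⟩)
  have hstay : ∀ z, Relation.ReflTransGen (M.graph.deleteVerts {M.tail d}).Adj (M.head (M.rot d)) z →
      z ∈ X := by
    intro z hz
    induction hz with
    | refl => exact hx'
    | tail _ hadj ih =>
      obtain ⟨e, hlink⟩ := hadj
      rw [Graph.deleteVerts_isLink] at hlink
      obtain ⟨⟨d', rfl, rfl, rfl⟩, h3, h4⟩ := hlink
      by_contra hout
      have : M.edge d' ∈ M.graph.cut X := edge_mem_cut_iff.2 (by tauto)
      rw [h, Set.mem_singleton_iff, eq_comm, M.edge_eq_iff] at this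
      rcases this with rfl | rfl
      · exact h3 rfl
      · exact h4 (M.head_rev d)
  exact hy (hstay _ hconn)

theorem face_ne_face_rev [Finite D] (d : D) : M.face d ≠ M.face (M.rev d) := by
  intro h
  obtain ⟨X, hX⟩ := exists_cut_singleton hM.plane h
  exact hM.cut_ne_singleton X _ hX

/-- The faces of `d` and `rot d` are the two sides of the edge of `d`. With `face_rot_rot_ne`, the
three faces around a vertex are pairwise distinct. -/
theorem face_rot_ne [Finite D] (d : D) : M.face (M.rot d) ≠ M.face d := by
  rw [M.face_rot]
  exact (hM.face_ne_face_rev d).symm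

theorem face_rot_rot_ne [Finite D] (d : D) : M.face (M.rot (M.rot d)) ≠ M.face d := by
  have := hM.face_rot_ne (M.rot (M.rot d))
  rw [hM.rot_rot_rot] at this
  exact this.symm

theorem eq_of_face_edge [Finite D] {d d' : D} (hf : M.face d = M.face d')
    (he : M.edge d = M.edge d') : d = d' := by
  rcases M.edge_eq_iff.1 he with rfl | rfl
  · rfl
  · exact absurd hf (hM.face_ne_face_rev d)

/-- Two distinct edges between the same pair of faces have no common end. -/
theorem eq_of_sides [Finite D] {d d' : D} (ht : M.tail d = M.tail d')
    (h : (M.face d = M.face d' ∧ M.face (M.rev d) = M.face (M.rev d')) ∨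
      (M.face d = M.face (M.rev d') ∧ M.face (M.rev d) = M.face d')) : d = d' := by
  rcases hM.tail_eq_iff.1 ht with rfl | rfl | rfl
  · rfl
  · rw [← M.face_rot, ← M.face_rot] at h
    rcases h with h | h
    · exact absurd h.1.symm (hM.face_rot_ne d)
    · exact absurd h.1.symm (hM.face_rot_rot_ne d)
  · rw [← M.face_rot, ← M.face_rot, hM.rot_rot_rot] at h
    rcases h with h | h
    · exact absurd h.1.symm (hM.face_rot_rot_ne d)
    · exact absurd h.2.symm (hM.face_rot_ne (M.rot d))

/-- Two faces that share a vertex share an edge at this vertex. -/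
theorem exists_shared_of_tail [Finite D] {d d' : D} (ht : M.tail d = M.tail d')
    (hf : M.face d ≠ M.face d') :
    ∃ c, M.tail c = M.tail d ∧ ((M.face c = M.face d ∧ M.face (M.rev c) = M.face d') ∨
      (M.face c = M.face d' ∧ M.face (M.rev c) = M.face d)) := by
  rcases hM.tail_eq_iff.1 ht with rfl | rfl | rfl
  · exact absurd rfl hf
  · exact ⟨d, rfl, Or.inl ⟨rfl, (M.face_rot d).symm⟩⟩
  · refine ⟨M.rot (M.rot d), ht.symm, Or.inr ⟨rfl, ?_⟩⟩
    rw [← M.face_rot, hM.rot_rot_rot]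

theorem ncard_boundary_edgeSet [Finite D] (φ : M.Face) :
    (M.boundary φ).edgeSet.ncard = {d | M.face d = φ}.ncard := by
  have : (M.boundary φ).edgeSet = M.edge '' {d | M.face d = φ} := by
    ext e
    obtain ⟨d, rfl⟩ := M.exists_edge_eq e
    rw [edge_mem_boundary]
    constructor
    · rintro (h | h)
      · exact ⟨d, h, rfl⟩
      · exact ⟨M.rev d, h, M.edge_rev d⟩
    · rintro ⟨d', hd', he⟩
      rcases M.edge_eq_iff.1 he with rfl | rfl
      · exact Or.inl hd'
      · exact Or.inr (by rwa [M.rev_rev])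
  rw [this, Set.InjOn.ncard_image]
  intro d hd d' hd' he
  exact hM.eq_of_face_edge (hd.trans hd'.symm) he

/-- Two distinct faces whose boundaries share an edge and have a disconnected intersection share two
edges; each of them is given by its dart in the second face. -/
theorem exists_two_shared [Finite D] {φ ψ : M.Face}
    (hs : ((M.boundary φ).edgeSet ∩ (M.boundary ψ).edgeSet).Nonempty)
    (hc : ¬ (M.boundary φ ⊓ M.boundary ψ).IsConn) :
    φ ≠ ψ ∧ ∃ d₁ d₂, d₁ ≠ d₂ ∧ M.face d₁ = ψ ∧ M.face d₂ = ψ ∧ M.face (M.rev d₁) = φ ∧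
      M.face (M.rev d₂) = φ := by
  have hne : φ ≠ ψ := by
    rintro rfl
    rw [inf_idem] at hc
    exact hc (boundary_isConn φ)
  refine ⟨hne, ?_⟩
  obtain ⟨e, he1, he2⟩ := hs
  obtain ⟨d₁, rfl, h1, h2⟩ : ∃ d, M.edge d = e ∧ M.face d = ψ ∧ M.face (M.rev d) = φ := by
    obtain ⟨d, rfl⟩ := M.exists_edge_eq e
    rw [edge_mem_boundary] at he1 he2
    rcases he2 with h2 | h2
    · exact ⟨d, rfl, h2, he1.resolve_left fun h => hne (h.symm.trans h2)⟩
    · exact ⟨M.rev d, M.edge_rev d, h2, by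
        rw [M.rev_rev]; exact he1.resolve_right fun h => hne (h.symm.trans h2)⟩
  by_contra! hcon
  apply hc
  -- A common vertex of the two boundaries is an end of a common edge. If `d₁` gives the only common
  -- edge, the intersection is this edge with its ends, which is connected.
  have hends : ∀ v ∈ (M.boundary φ ⊓ M.boundary ψ).vertexSet, v = M.tail d₁ ∨ v = M.head d₁ := by
    rintro v ⟨⟨d, hd, rfl⟩, ⟨d', hd', ht⟩⟩
    obtain ⟨c, hc, h | h⟩ := hM.exists_shared_of_tail ht.symm (by rw [hd, hd']; exact hne)
    · have : d₁ = M.rev c := by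
        by_contra hne'
        exact hcon d₁ (M.rev c) hne' h1 (h.2.trans hd') h2
          (by rw [M.rev_rev, h.1, hd])
      right
      rw [this, M.head_rev, hc]
    · have : d₁ = c := by
        by_contra hne'
        exact hcon d₁ c hne' h1 (h.1.trans hd') h2 (h.2.trans hd)
      left
      rw [this, hc]
  have hlink : (M.boundary φ ⊓ M.boundary ψ).IsLink (M.edge d₁) (M.tail d₁) (M.head d₁) :=
    ⟨boundary_isLink.2 ⟨Or.inr h2, isLink_edge d₁⟩, boundary_isLink.2 ⟨Or.inl h1, isLink_edge d₁⟩⟩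
  refine ⟨⟨_, hlink.left_mem⟩, fun x hx y hy => ?_⟩
  rcases hends x hx with rfl | rfl <;> rcases hends y hy with rfl | rfl
  · exact Relation.ReflTransGen.refl
  · exact Relation.ReflTransGen.single hlink.adj
  · exact Relation.ReflTransGen.single hlink.symm.adj
  · exact Relation.ReflTransGen.refl

end IsCubicPlane

end CombMap

/-! ## Critically frustrated cubic graphs -/

namespace Graph

variable {α β : Type*}

/-- The number of the edges in `S` that join `u` and `v`. -/
noncomputable def mult (G : Graph α β) (S : Set β) (u v : α) : ℕ := {e ∈ S | G.IsLink e u v}.ncard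

variable {G : Graph α β} {S : Set β}

theorem mult_comm (u v : α) : G.mult S u v = G.mult S v u := by
  simp only [mult, G.isLink_comm (x := u)]

variable [Finite β]

theorem mult_ne_zero_iff {u v : α} : G.mult S u v ≠ 0 ↔ ∃ e ∈ S, G.IsLink e u v := by
  rw [mult, ← Nat.pos_iff_ne_zero, Set.ncard_pos]
  rfl

/-- Disjointness of `A` and `B` ensures that no edge is counted for two ordered pairs of ends. -/
theorem between_mult {A B : Finset α} (h : Disjoint A B) :
    between (G.mult S) A B = {e ∈ S | ∃ a ∈ A, ∃ b ∈ B, G.IsLink e a b}.ncard := by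
  classical
  have := Fintype.ofFinite β
  have h1 : {e ∈ S | ∃ a ∈ A, ∃ b ∈ B, G.IsLink e a b} =
      (((A ×ˢ B).biUnion fun p => {e : β | e ∈ S ∧ G.IsLink e p.1 p.2} : Finset β) : Set β) := by
    ext e
    simp only [Set.mem_ofPred_eq, Finset.coe_biUnion, Finset.mem_coe, Finset.mem_product,
      Finset.coe_filter, Finset.mem_univ, true_and, Set.mem_iUnion, exists_prop, Prod.exists]
    constructor
    · rintro ⟨hS, a, ha, b, hb, hab⟩
      exact ⟨a, b, ⟨ha, hb⟩, hS, hab⟩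
    · rintro ⟨a, b, ⟨ha, hb⟩, hS, hab⟩
      exact ⟨hS, a, ha, b, hb, hab⟩
  rw [h1, Set.ncard_coe_finset, Finset.card_biUnion, Finset.sum_product, between]
  · refine Finset.sum_congr rfl fun a _ => Finset.sum_congr rfl fun b _ => ?_
    rw [mult, ← Set.ncard_coe_finset]
    congr 1
    ext e
    simp
  · rintro ⟨a, b⟩ hab ⟨a', b'⟩ hab' hne
    rw [Function.onFun, Finset.disjoint_left]
    intro e he he'
    simp only [Finset.mem_filter, Finset.mem_univ, true_and] at he he'
    rw [Finset.mem_coe, Finset.mem_product] at hab hab'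
    rcases he.2.eq_and_eq_or_eq_and_eq he'.2 with ⟨h1, h2⟩ | ⟨h1, h2⟩
    · exact hne (Prod.ext h1 h2)
    · exact Finset.disjoint_left.1 h hab.1 (h1 ▸ hab'.2)

theorem sum_mult [Fintype α] (u : α) : ∑ v, G.mult S u v = (S ∩ G.incidenceSet u).ncard := by
  classical
  have := Fintype.ofFinite β
  have h1 : S ∩ G.incidenceSet u =
      ((Finset.univ.biUnion fun v => {e : β | e ∈ S ∧ G.IsLink e u v} : Finset β) : Set β) := by
    ext e
    simp only [Set.mem_inter_iff, mem_incidenceSet, Finset.coe_biUnion, Finset.mem_coe,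
      Finset.coe_filter, Finset.mem_univ, true_and, Set.mem_iUnion, exists_prop,
      Set.mem_ofPred_eq]
    exact ⟨fun ⟨h, v, hv⟩ => ⟨v, h, hv⟩, fun ⟨v, h, hv⟩ => ⟨h, v, hv⟩⟩
  rw [h1, Set.ncard_coe_finset, Finset.card_biUnion]
  · refine Finset.sum_congr rfl fun b _ => ?_
    rw [mult, ← Set.ncard_coe_finset]
    congr 1
    ext e
    simp
  · intro a _ b _ hne
    rw [Function.onFun, Finset.disjoint_left]
    intro e he he'
    simp only [Finset.mem_filter, Finset.mem_univ, true_and] at he he'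
    exact hne (he.2.right_unique he'.2)

theorem mult_univ (S : Set β) (u v : α) :
    G.mult Set.univ u v = G.mult Sᶜ u v + G.mult S u v := by
  rw [mult, mult, mult, ← Set.ncard_union_eq]
  · congr 1
    ext e
    by_cases he : e ∈ S <;> simp [he]
  · rw [Set.disjoint_left]
    exact fun e h h' => h.1 h'.1

theorem between_mult_univ (S : Set β) (A B : Finset α) :
    between (G.mult Set.univ) A B = between (G.mult Sᶜ) A B + between (G.mult S) A B := by
  simp only [between, ← Finset.sum_add_distrib]
  exact Finset.sum_congr rfl fun a _ => Finset.sum_congr rfl fun b _ => mult_univ S a b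

theorem cut_compl (X : Set α) : G.cut Xᶜ = G.cut X := by
  ext e
  constructor
  · rintro ⟨x, hx, y, hy, h⟩
    exact ⟨y, not_not.1 hy, x, hx, h.symm⟩
  · rintro ⟨x, hx, y, hy, h⟩
    exact ⟨y, hy, x, not_not.2 hx, h.symm⟩

theorem between_compl_eq_cut [Fintype α] [DecidableEq α] (A : Finset α) :
    between (G.mult S) A Aᶜ = (S ∩ G.cut A).ncard := by
  rw [between_mult disjoint_compl_right]
  congr 1
  ext e
  simp [cut]

end Graph

namespace SignedGraph

variable {α β : Type*} [Finite β] {S : SignedGraph α β} {k : ℕ}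

theorem ncard_symmDiff_add (A B : Set β) :
    (symmDiff A B).ncard + (A ∩ B).ncard = A.ncard + (Aᶜ ∩ B).ncard := by
  have h1 : (symmDiff A B).ncard = (A \ B).ncard + (B \ A).ncard :=
    Set.ncard_union_eq disjoint_sdiff_sdiff
  have h2 := Set.ncard_inter_add_ncard_sdiff_eq_ncard A B
  have h3 : Aᶜ ∩ B = B \ A := by rw [Set.inter_comm]; rfl
  rw [h3]
  omega

/-- Switching at `∂(X)` exchanges the negative and positive edges of the cut, and cannot produce
fewer than `k` negative edges. -/
theorem cut_balance (hV : S.graph.vertexSet = Set.univ) (hS : S.frustrationIndex = k)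
    (hk : S.neg.ncard = k) (X : Set α) :
    (S.neg ∩ S.graph.cut X).ncard ≤ (S.negᶜ ∩ S.graph.cut X).ncard := by
  have h : S.frustrationIndex ≤ (S.switch X).neg.ncard :=
    Nat.sInf_le ⟨S.switch X, ⟨X, by rw [hV]; exact Set.subset_univ _, rfl⟩, rfl⟩
  have h2 := ncard_symmDiff_add S.neg (S.graph.cut X)
  change _ ≤ (symmDiff S.neg (S.graph.cut X)).ncard at h
  omega

/-- Some switching of the graph without `e` has `k - 1` negative edges. Switching the whole graph at
the same `X` has at least `k`, so `e` becomes negative and the total is exactly `k`: the edge is in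
the cut and the cut is equilibrated. -/
theorem exists_equilibrated_cut (hV : S.graph.vertexSet = Set.univ) (hS : S.IsCritical k)
    (hk : S.neg.ncard = k) {e : β} (he : e ∈ S.graph.edgeSet) (hn : e ∉ S.neg) :
    ∃ X, e ∈ S.graph.cut X ∧
      (S.neg ∩ S.graph.cut X).ncard = (S.negᶜ ∩ S.graph.cut X).ncard := by
  -- The infimum is attained, since switching at the empty set shows that the set of values is
  -- nonempty.
  obtain ⟨T, ⟨X, -, rfl⟩, hT⟩ := Nat.sInf_mem (s := {n | ∃ T, (S.deleteEdge e).SwitchingEquiv T ∧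
    T.neg.ncard = n}) ⟨_, _, ⟨∅, Set.empty_subset _, rfl⟩, rfl⟩
  have hcrit := hS.2 e he
  change _ = (S.deleteEdge e).frustrationIndex at hT
  have hneg : ((S.deleteEdge e).switch X).neg = symmDiff S.neg (S.graph.cut X) \ {e} := by
    change symmDiff (S.neg \ {e}) ((S.graph.deleteEdges {e}).cut X) = _
    have : (S.graph.deleteEdges {e}).cut X = S.graph.cut X \ {e} := by
      ext f
      simp only [Graph.cut, Graph.deleteEdges_isLink, Set.mem_ofPred_eq, Set.mem_sdiff]
      constructor
      · rintro ⟨x, hx, y, hy, h⟩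
        exact ⟨⟨x, hx, y, hy, h.1⟩, h.2⟩
      · rintro ⟨⟨x, hx, y, hy, h⟩, h'⟩
        exact ⟨x, hx, y, hy, h, h'⟩
    rw [this]
    ext f
    simp only [Set.mem_symmDiff, Set.mem_sdiff]
    tauto
  rw [hneg] at hT
  have hbal := cut_balance hV hS.1 hk X
  have hsd := ncard_symmDiff_add S.neg (S.graph.cut X)
  have hcut : e ∈ S.graph.cut X := by
    by_contra hcut
    rw [Set.sdiff_singleton_eq_self] at hT
    · omega
    · rw [Set.mem_symmDiff]
      tauto
  have := Set.ncard_sdiff_singleton_add_one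
    (show e ∈ symmDiff S.neg (S.graph.cut X) from Or.inr ⟨hcut, hn⟩)
  exact ⟨X, hcut, by omega⟩

/-- A critically frustrated cubic loopless graph with a minimum signature is tight on the sets that
span no negative edge. -/
theorem isTightCubic [Fintype α] [DecidableEq α] (hV : S.graph.vertexSet = Set.univ)
    (hS : S.IsCritical k) (hk : S.neg.ncard = k) (hloop : S.graph.Loopless)
    (hdeg : ∀ u, (S.graph.incidenceSet u).ncard = 3) :
    IsTightCubic (S.graph.mult Set.univ)
      (fun H => ∀ u ∈ H, ∀ v ∈ H, S.graph.mult S.neg u v = 0) where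
  symm := Graph.mult_comm
  loopless := by
    intro u
    by_contra h
    obtain ⟨e, -, he⟩ := Graph.mult_ne_zero_iff.1 h
    exact hloop.not_isLoopAt e u he
  degree := by
    intro u
    rw [Graph.sum_mult, Set.univ_inter, hdeg]
  mono := fun H K hKH hH u hu v hv => hH u (hKH hu) v (hKH hv)
  tight := by
    intro H hH u hu v hv huv
    obtain ⟨e, -, he⟩ := Graph.mult_ne_zero_iff.1 huv
    have hn : e ∉ S.neg := fun h => Graph.mult_ne_zero_iff.2 ⟨e, h, he⟩ (hH u hu v hv)
    obtain ⟨X, huX, hvX, heq⟩ : ∃ X, u ∈ X ∧ v ∉ X ∧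
        (S.neg ∩ S.graph.cut X).ncard = (S.negᶜ ∩ S.graph.cut X).ncard := by
      obtain ⟨X, ⟨x, hx, y, hy, hxy⟩, heq⟩ := exists_equilibrated_cut hV hS hk he.edge_mem hn
      rcases he.eq_and_eq_or_eq_and_eq hxy with ⟨rfl, rfl⟩ | ⟨rfl, rfl⟩
      · exact ⟨X, hx, hy, heq⟩
      · exact ⟨Xᶜ, hy, not_not.2 hx, by rw [Graph.cut_compl]; exact heq⟩
    lift X to Finset α using X.toFinite
    rw [Finset.mem_coe] at huX hvX
    rw [← Graph.between_compl_eq_cut, ← Graph.between_compl_eq_cut] at heq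
    -- Let s(A, B) count positive minus negative edges, and put P = H ∩ X, Q = H \ X, O = X \ H, W =
    -- (X ∪ H)ᶜ. The equation for X reads s(P,Q) + s(P,W) + s(O,Q) + s(O,W) = 0. Subtracting it from
    -- the balance of O gives s(P,Q) ≤ s(O,P) − s(P,W) ≤ d(P,Hᶜ); subtracting it from the balance of
    -- X ∪ H gives s(P,Q) ≤ s(Q,W) − s(O,Q) ≤ d(Q,Hᶜ). No negative edge joins P and Q, so s(P,Q) =
    -- d(P,Q).
    have b1 := cut_balance hV hS.1 hk (X \ H : Finset α)
    have b2 := cut_balance hV hS.1 hk (X ∪ H : Finset α)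
    rw [← Graph.between_compl_eq_cut, ← Graph.between_compl_eq_cut] at b1 b2
    have hsym : ∀ T : Set β, ∀ A B, between (S.graph.mult T) A B = between (S.graph.mult T) B A :=
      fun T => between_comm Graph.mult_comm
    have hzero : between (S.graph.mult S.neg) (H ∩ X) (H \ X) = 0 := by
      refine Finset.sum_eq_zero fun a ha => Finset.sum_eq_zero fun b hb => ?_
      exact hH a (Finset.mem_inter.1 ha).1 b (Finset.mem_sdiff.1 hb).1
    have eX : X = H ∩ X ∪ X \ H := by ext x; simp; tauto
    have eXc : Xᶜ = H \ X ∪ (X ∪ H)ᶜ := by ext x; simp; tauto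
    have eO : (X \ H)ᶜ = (H ∩ X) ∪ (H \ X ∪ (X ∪ H)ᶜ) := by ext x; simp; tauto
    have eU : X ∪ H = H ∩ X ∪ (X \ H ∪ H \ X) := by ext x; simp; tauto
    have eHc : Hᶜ = X \ H ∪ (X ∪ H)ᶜ := by ext x; simp; tauto
    have eHP : H \ (H ∩ X) = H \ X := by ext x; simp
    have dPO : Disjoint (H ∩ X) (X \ H) := by
      rw [Finset.disjoint_left]; intro x; simp; tauto
    have dPQ : Disjoint (H ∩ X) (H \ X) := by
      rw [Finset.disjoint_left]; intro x; simp; tauto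
    have dPW : Disjoint (H ∩ X) (X ∪ H)ᶜ := by
      rw [Finset.disjoint_left]; intro x; simp; tauto
    have dOQ : Disjoint (X \ H) (H \ X) := by
      rw [Finset.disjoint_left]; intro x; simp; tauto
    have dOW : Disjoint (X \ H) (X ∪ H)ᶜ := by
      rw [Finset.disjoint_left]; intro x; simp; tauto
    have dQW : Disjoint (H \ X) (X ∪ H)ᶜ := by
      rw [Finset.disjoint_left]; intro x; simp; tauto
    refine ⟨H ∩ X, Finset.inter_subset_left, Finset.mem_inter.2 ⟨hu, huX⟩,
      by simp [hv, hvX], ?_⟩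
    rw [eHP, Graph.between_mult_univ S.neg, Graph.between_mult_univ S.neg,
      Graph.between_mult_univ S.neg]
    have xX : ∀ T : Set β, between (S.graph.mult T) X Xᶜ =
        between (S.graph.mult T) (H ∩ X) (H \ X) + between (S.graph.mult T) (H ∩ X) (X ∪ H)ᶜ +
        (between (S.graph.mult T) (X \ H) (H \ X) + between (S.graph.mult T) (X \ H) (X ∪ H)ᶜ) := by
      intro T
      rw [← between_union_right dQW, ← between_union_right dQW, ← eXc, ← between_union_left dPO,
        ← eX]
    have xO : ∀ T : Set β, between (S.graph.mult T) (X \ H) (X \ H)ᶜ =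
        between (S.graph.mult T) (H ∩ X) (X \ H) + (between (S.graph.mult T) (X \ H) (H \ X) +
          between (S.graph.mult T) (X \ H) (X ∪ H)ᶜ) := by
      intro T
      rw [hsym T (H ∩ X), ← between_union_right dQW, ← between_union_right, ← eO]
      exact Finset.disjoint_union_right.2 ⟨dPQ, dPW⟩
    have xU : ∀ T : Set β, between (S.graph.mult T) (X ∪ H) (X ∪ H)ᶜ =
        between (S.graph.mult T) (H ∩ X) (X ∪ H)ᶜ + (between (S.graph.mult T) (X \ H) (X ∪ H)ᶜ +
          between (S.graph.mult T) (H \ X) (X ∪ H)ᶜ) := by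
      intro T
      rw [← between_union_left dOQ, ← between_union_left, ← eU]
      exact Finset.disjoint_union_right.2 ⟨dPO, dPQ⟩
    have xP : ∀ T : Set β, between (S.graph.mult T) (H ∩ X) Hᶜ =
        between (S.graph.mult T) (H ∩ X) (X \ H) + between (S.graph.mult T) (H ∩ X) (X ∪ H)ᶜ := by
      intro T
      rw [← between_union_right dOW, ← eHc]
    have xQ : ∀ T : Set β, between (S.graph.mult T) (H \ X) Hᶜ =
        between (S.graph.mult T) (X \ H) (H \ X) + between (S.graph.mult T) (H \ X) (X ∪ H)ᶜ := by
      intro T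
      rw [hsym T (X \ H), ← between_union_right dOW, ← eHc]
    rw [xX, xX] at heq
    rw [xO, xO] at b1
    rw [xU, xU] at b2
    rw [xP, xP, xQ, xQ]
    omega

end SignedGraph

/-! ## The graph of a canonical embedding -/

namespace CanonicalEmbedding

variable {k : ℕ} {D : Type*} [Finite D] (Γ : CanonicalEmbedding k D)

instance : Finite Γ.Vert := inferInstanceAs (Finite (_ ⊕ _))

instance : Finite Γ.Ed := inferInstanceAs (Finite (_ ⊕ _))

omit [Finite D] in
theorem isCubicPlane : Γ.map.IsCubicPlane := ⟨Γ.plane, Γ.cubic, Γ.twoConnected⟩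

omit [Finite D] in
theorem face_next_pow (n : ℕ) : Γ.map.face ((Γ.map.next ^ n) Γ.start) = Γ.outer :=
  Quotient.sound (s := Equiv.Perm.SameCycle.setoid Γ.map.next) ⟨-n, by simp⟩

omit [Finite D] in
theorem face_dart (i : Fin (2 * k)) : Γ.map.face (Γ.dart i) = Γ.outer := Γ.face_next_pow _

/-- The length of the outer cycle. -/
noncomputable def outerLength : ℕ := {d | Γ.map.face d = Γ.map.face Γ.start}.ncard

omit [Finite D] in
theorem outerLength_eq :
    Γ.outerLength = {d | Γ.map.next.SameCycle Γ.start d}.ncard := by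
  rw [outerLength]
  congr 1
  ext d
  constructor
  · intro h
    exact (Quotient.exact h : Γ.map.next.SameCycle d Γ.start).symm
  · intro h
    exact Quotient.sound (s := Equiv.Perm.SameCycle.setoid Γ.map.next) h.symm

omit [Finite D] in
theorem pos_lt_outerLength (i : Fin (2 * k)) : Γ.pos i < Γ.outerLength := Γ.pos_lt i

theorem next_pow_inj {p q : ℕ} (hp : p < Γ.outerLength) (hq : q < Γ.outerLength)
    (h : (Γ.map.next ^ p) Γ.start = (Γ.map.next ^ q) Γ.start) : p = q := by
  rw [outerLength_eq] at hp hq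
  exact Equiv.Perm.pow_injOn_sameCycle hp hq h

theorem exists_next_pow {d : D} (h : Γ.map.face d = Γ.outer) :
    ∃ p < Γ.outerLength, (Γ.map.next ^ p) Γ.start = d := by
  rw [outerLength_eq]
  exact Equiv.Perm.exists_pow_eq_of_sameCycle
    (Quotient.exact h : Γ.map.next.SameCycle d Γ.start).symm

theorem dart_eq_iff {i j : Fin (2 * k)} : Γ.dart i = Γ.dart j ↔ Γ.pos i = Γ.pos j :=
  ⟨fun h => Γ.next_pow_inj (Γ.pos_lt_outerLength i) (Γ.pos_lt_outerLength j) h,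
    fun h => by rw [dart, dart, h]⟩

theorem edge_dart_eq_iff {i j : Fin (2 * k)} :
    Γ.map.edge (Γ.dart i) = Γ.map.edge (Γ.dart j) ↔ Γ.pos i = Γ.pos j := by
  rw [← dart_eq_iff]
  exact ⟨fun h => Γ.isCubicPlane.eq_of_face_edge ((Γ.face_dart i).trans (Γ.face_dart j).symm) h,
    fun h => by rw [h]⟩

theorem rev_dart_ne (i j : Fin (2 * k)) : Γ.map.rev (Γ.dart i) ≠ Γ.dart j := by
  intro h
  apply Γ.isCubicPlane.face_ne_face_rev (Γ.dart i)
  rw [h, face_dart, face_dart]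

instance loopless_graph : Γ.graph.Loopless := by
  refine ⟨fun e x hx => ?_⟩
  have hx : Γ.Link e x x := by rcases hx with h | h <;> exact h
  generalize hy : x = y at hx
  have hxy : Γ.Link e x y := by rwa [← hy] at hx ⊢
  cases hxy with
  | whole d h => exact Γ.isCubicPlane.tail_ne_head d (Sum.inl.inj hy)
  | first i h => cases hy
  | middle i j hij h =>
    have := Sum.inr.inj hy
    omega
  | last i h => cases hy
  | negative i =>
    have := congrArg Fin.val (Sum.inr.inj hy)
    simp only at this
    have := i.isLt
    omega

/-- The segment that ends in `z_i`. -/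
noncomputable def segmentBefore (i : Fin (2 * k)) : Γ.Ed :=
  open Classical in
  if h : ∃ j : Fin (2 * k), i.val = j.val + 1 ∧ Γ.dart j = Γ.dart i then .inr (.inl h.choose)
  else .inl (Γ.map.edge (Γ.dart i))

omit [Finite D] in
theorem segmentBefore_of_succ {i j : Fin (2 * k)} (hij : i.val = j.val + 1)
    (h : Γ.dart j = Γ.dart i) : Γ.segmentBefore i = .inr (.inl j) := by
  have hex : ∃ j : Fin (2 * k), i.val = j.val + 1 ∧ Γ.dart j = Γ.dart i := ⟨j, hij, h⟩
  rw [segmentBefore, dif_pos hex]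
  have := hex.choose_spec.1
  congr 2
  exact Fin.ext (by omega)

omit [Finite D] in
theorem segmentBefore_of_first {i : Fin (2 * k)}
    (h : ∀ j < i, Γ.map.edge (Γ.dart j) ≠ Γ.map.edge (Γ.dart i)) :
    Γ.segmentBefore i = .inl (Γ.map.edge (Γ.dart i)) := by
  rw [segmentBefore, dif_neg]
  rintro ⟨j, hj, hd⟩
  exact h j (Fin.lt_def.2 (by omega)) (by rw [hd])

/-- The index of the negative edge at `z_i`. -/
def negativeIndex (i : Fin (2 * k)) : Fin k :=
  if h : i.val < k then ⟨i.val, h⟩ else ⟨i.val - k, by omega⟩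

omit [Finite D] in
theorem inc_negative_iff {i : Fin (2 * k)} {j : Fin k} :
    Γ.graph.Inc (.inr (.inr j)) (.inr i) ↔ j = negativeIndex i := by
  have hj := j.isLt
  have hi := i.isLt
  constructor
  · rintro ⟨y, h | h⟩
    · cases h
      unfold negativeIndex
      rw [dif_pos j.isLt]
    · cases h
      unfold negativeIndex
      rw [dif_neg (by simp)]
      ext
      simp
  · intro h
    unfold negativeIndex at h
    split_ifs at h with h'
    · have : i = ⟨j.val, by omega⟩ := by ext; simp [h]
      rw [this]
      exact ⟨_, Or.inl (.negative j)⟩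
    · have : i = ⟨k + j.val, by omega⟩ := by
        ext
        have := congrArg Fin.val h
        simp only at this ⊢
        omega
      rw [this]
      exact ⟨_, Or.inr (.negative j)⟩

omit [Finite D] in
theorem inc_after (i : Fin (2 * k)) : Γ.graph.Inc (.inr (.inl i)) (.inr i) := by
  by_cases h : ∃ j : Fin (2 * k), j.val = i.val + 1 ∧ Γ.dart i = Γ.dart j
  · obtain ⟨j, hij, hd⟩ := h
    exact ⟨_, Or.inl (.middle i j hij hd)⟩
  · push Not at h
    exact ⟨_, Or.inl (.last i h)⟩

theorem inc_segmentBefore (i : Fin (2 * k)) : Γ.graph.Inc (Γ.segmentBefore i) (.inr i) := by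
  by_cases h : ∃ j : Fin (2 * k), i.val = j.val + 1 ∧ Γ.dart j = Γ.dart i
  · obtain ⟨j, hij, hd⟩ := h
    rw [Γ.segmentBefore_of_succ hij hd]
    exact ⟨_, Or.inr (.middle j i hij hd)⟩
  · push Not at h
    have hfirst : ∀ j < i, Γ.map.edge (Γ.dart j) ≠ Γ.map.edge (Γ.dart i) := by
      intro j hj he
      rw [edge_dart_eq_iff] at he
      have hj' := Fin.lt_def.1 hj
      have hi := i.isLt
      -- As `pos` is monotone, an earlier vertex on the same edge forces `z_{i-1}` onto it as well.
      refine h ⟨i.val - 1, by omega⟩ (by simp only; omega) (Γ.dart_eq_iff.2 ?_)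
      have h1 : Γ.pos j ≤ Γ.pos ⟨i.val - 1, by omega⟩ := Γ.pos_mono (Fin.le_def.2 (by simp only; omega))
      have h2 : Γ.pos ⟨i.val - 1, by omega⟩ ≤ Γ.pos i := Γ.pos_mono (Fin.le_def.2 (by simp only; omega))
      omega
    rw [Γ.segmentBefore_of_first hfirst]
    exact ⟨_, Or.inr (.first i hfirst)⟩

theorem incidenceSet_inr (i : Fin (2 * k)) : Γ.graph.incidenceSet (.inr i) =
    {Γ.segmentBefore i, .inr (.inl i), .inr (.inr (negativeIndex i))} := by
  ext e
  simp only [Graph.mem_incidenceSet, Set.mem_insert_iff, Set.mem_singleton_iff]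
  constructor
  · intro hinc
    have hinc' := hinc
    obtain ⟨y, h | h⟩ := hinc
    · cases h with
      | middle => exact Or.inr (Or.inl rfl)
      | last => exact Or.inr (Or.inl rfl)
      | negative j => exact Or.inr (Or.inr (congrArg (fun j => Sum.inr (Sum.inr j)) (Γ.inc_negative_iff.1 hinc')))
    · cases h with
      | first _ h => exact Or.inl (Γ.segmentBefore_of_first h).symm
      | middle j _ hij hd => exact Or.inl (Γ.segmentBefore_of_succ hij hd).symm
      | negative j => exact Or.inr (Or.inr (congrArg (fun j => Sum.inr (Sum.inr j)) (Γ.inc_negative_iff.1 hinc')))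
  · rintro (rfl | rfl | rfl)
    · exact Γ.inc_segmentBefore i
    · exact Γ.inc_after i
    · exact Γ.inc_negative_iff.2 rfl

omit [Finite D] in
theorem segmentBefore_ne_after (i : Fin (2 * k)) : Γ.segmentBefore i ≠ .inr (.inl i) := by
  unfold segmentBefore
  split_ifs with h
  · intro h'
    have h1 := Sum.inl.inj (Sum.inr.inj h')
    have h2 := h.choose_spec.1
    rw [h1] at h2
    omega
  · simp

omit [Finite D] in
theorem segmentBefore_ne_negative (i : Fin (2 * k)) (j : Fin k) :
    Γ.segmentBefore i ≠ .inr (.inr j) := by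
  unfold segmentBefore
  split_ifs with h <;> simp

theorem ncard_incidenceSet_inr (i : Fin (2 * k)) :
    (Γ.graph.incidenceSet (.inr i)).ncard = 3 := by
  rw [incidenceSet_inr, Set.ncard_eq_three]
  exact ⟨_, _, _, Γ.segmentBefore_ne_after i, Γ.segmentBefore_ne_negative i _, by simp, rfl⟩

/-- The segment of `G` at the tail of the dart `d`. -/
noncomputable def segment (d : D) : Γ.Ed :=
  open Classical in
  if h : ∃ i : Fin (2 * k), Γ.dart i = Γ.map.rev d ∧
    ∀ j : Fin (2 * k), j.val = i.val + 1 → Γ.dart i ≠ Γ.dart j then .inr (.inl h.choose)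
  else .inl (Γ.map.edge d)

omit [Finite D] in
theorem segment_of_forall_ne {d : D} (h : ∀ i, Γ.dart i ≠ Γ.map.rev d) :
    Γ.segment d = .inl (Γ.map.edge d) := by
  rw [segment, dif_neg]
  rintro ⟨i, hi, -⟩
  exact h i hi

theorem segment_rev_dart {i : Fin (2 * k)}
    (h : ∀ j : Fin (2 * k), j.val = i.val + 1 → Γ.dart i ≠ Γ.dart j) :
    Γ.segment (Γ.map.rev (Γ.dart i)) = .inr (.inl i) := by
  have hex : ∃ i' : Fin (2 * k), Γ.dart i' = Γ.map.rev (Γ.map.rev (Γ.dart i)) ∧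
      ∀ j : Fin (2 * k), j.val = i'.val + 1 → Γ.dart i' ≠ Γ.dart j :=
    ⟨i, (Γ.map.rev_rev _).symm, h⟩
  rw [segment, dif_pos hex]
  congr 2
  obtain ⟨h1, h2⟩ := hex.choose_spec
  set i' := hex.choose
  rw [Γ.map.rev_rev, dart_eq_iff] at h1
  -- By monotonicity of `pos`, an index followed by a larger one on the same dart is followed
  -- directly by one, so the last index on a dart is unique.
  have key : ∀ a b : Fin (2 * k), a.val < b.val → Γ.pos a = Γ.pos b →
      ∃ c : Fin (2 * k), c.val = a.val + 1 ∧ Γ.dart a = Γ.dart c := by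
    intro a b hab hp
    refine ⟨⟨a.val + 1, by omega⟩, rfl, Γ.dart_eq_iff.2 ?_⟩
    have h1 : Γ.pos a ≤ Γ.pos ⟨a.val + 1, by omega⟩ := Γ.pos_mono (Fin.le_def.2 (by simp only; omega))
    have h2 : Γ.pos ⟨a.val + 1, by omega⟩ ≤ Γ.pos b := Γ.pos_mono (Fin.le_def.2 (by simp only; omega))
    omega
  rcases lt_trichotomy i'.val i.val with hlt | heq | hlt
  · obtain ⟨c, hc, hd⟩ := key i' i hlt h1
    exact absurd hd (h2 c hc)
  · exact Fin.ext heq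
  · obtain ⟨c, hc, hd⟩ := key i i' hlt h1.symm
    exact absurd hd (h c hc)

theorem exists_last {d : D} (h : ∃ i, Γ.dart i = d) : ∃ i, Γ.dart i = d ∧
    ∀ j : Fin (2 * k), j.val = i.val + 1 → Γ.dart i ≠ Γ.dart j := by
  obtain ⟨i, hi, hmax⟩ := (Set.toFinite {i | Γ.dart i = d}).exists_maximalFor id _ h
  refine ⟨i, hi, fun j hj hd => ?_⟩
  have := hmax (j := j) (hd.symm.trans hi) (Fin.le_def.2 (by simp only [id]; omega))
  have := Fin.le_def.1 this
  simp only [id] at this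
  omega

theorem exists_first {d : D} (h : ∃ i, Γ.dart i = d) : ∃ i, Γ.dart i = d ∧
    ∀ j < i, Γ.map.edge (Γ.dart j) ≠ Γ.map.edge (Γ.dart i) := by
  obtain ⟨i, hi, hmin⟩ := (Set.toFinite {i | Γ.dart i = d}).exists_minimalFor id _ h
  refine ⟨i, hi, fun j hj he => ?_⟩
  rw [edge_dart_eq_iff, ← dart_eq_iff] at he
  exact absurd (hmin (j := j) (he.trans hi) hj.le) (not_le.2 hj)

theorem inc_segment (d : D) : Γ.graph.Inc (Γ.segment d) (.inl (Γ.map.tail d)) := by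
  by_cases h : ∃ i, Γ.dart i = Γ.map.rev d
  · obtain ⟨i, hi, hlast⟩ := Γ.exists_last h
    have hd : d = Γ.map.rev (Γ.dart i) := by rw [hi, Γ.map.rev_rev]
    rw [hd, Γ.segment_rev_dart hlast]
    exact ⟨_, Or.inr (.last i hlast)⟩
  · push Not at h
    rw [Γ.segment_of_forall_ne h]
    by_cases h' : ∃ i, Γ.dart i = d
    · obtain ⟨i, rfl, hfirst⟩ := Γ.exists_first h'
      exact ⟨_, Or.inl (.first i hfirst)⟩
    · push Not at h'
      refine ⟨_, Or.inl (.whole d fun i he => ?_)⟩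
      rcases Γ.map.edge_eq_iff.1 he with h1 | h1
      · exact h' i h1.symm
      · exact h i (by rw [h1, Γ.map.rev_rev])

/-- Subdividing changes the names of the edges at an old vertex but not their number: `segment`
carries the cubicity of `G'` over to `G`. -/
theorem incidenceSet_inl (v : Γ.map.Vertex) :
    Γ.graph.incidenceSet (.inl v) = Γ.segment '' {d | Γ.map.tail d = v} := by
  ext e
  constructor
  · rintro ⟨y, h | h⟩
    · cases h with
      | whole d h =>
        refine ⟨d, rfl, Γ.segment_of_forall_ne fun i hi => h i ?_⟩
        rw [hi, Γ.map.edge_rev]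
      | first i h =>
        exact ⟨Γ.dart i, rfl, Γ.segment_of_forall_ne fun j hj => Γ.rev_dart_ne i j hj.symm⟩
    · cases h with
      | whole d h =>
        refine ⟨Γ.map.rev d, rfl, ?_⟩
        rw [Γ.segment_of_forall_ne fun i hi => h i ?_, Γ.map.edge_rev]
        rw [hi, Γ.map.rev_rev]
      | last i h => exact ⟨Γ.map.rev (Γ.dart i), rfl, Γ.segment_rev_dart h⟩
  · rintro ⟨d, rfl, rfl⟩
    exact Γ.inc_segment d

theorem ncard_incidenceSet_inl (v : Γ.map.Vertex) :
    (Γ.graph.incidenceSet (.inl v)).ncard = 3 := by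
  rw [incidenceSet_inl, Set.InjOn.ncard_image, Γ.isCubicPlane.ncard_tail_eq]
  intro d hd d' hd' he
  unfold segment at he
  split_ifs at he with h1 h2 h2
  · have h := Sum.inl.inj (Sum.inr.inj he)
    have e1 := h1.choose_spec.1
    have e2 := h2.choose_spec.1
    rw [h] at e1
    exact Γ.map.rev.injective (e1.symm.trans e2)
  · rcases Γ.map.edge_eq_iff.1 (Sum.inl.inj he) with h | h
    · exact h.symm
    · have := Γ.isCubicPlane.tail_ne_head d
      rw [← Γ.map.tail_rev, ← h] at this
      exact absurd (hd.trans hd'.symm) this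

theorem ncard_neg : Γ.signedGraph.neg.ncard = k := by
  change (Set.range fun i : Fin k => (Sum.inr (Sum.inr i) : Γ.Ed)).ncard = k
  rw [← Set.image_univ, Set.InjOn.ncard_image, Set.ncard_univ, Nat.card_eq_fintype_card,
    Fintype.card_fin]
  intro i _ j _ h
  exact Sum.inr.inj (Sum.inr.inj h)

theorem isTightCubic [Fintype Γ.Vert] [DecidableEq Γ.Vert] (hG : Γ.signedGraph.IsCritical k) :
    IsTightCubic (Γ.graph.mult Set.univ)
      (fun H => ∀ u ∈ H, ∀ v ∈ H, Γ.graph.mult Γ.signedGraph.neg u v = 0) :=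
  SignedGraph.isTightCubic rfl hG Γ.ncard_neg Γ.loopless_graph fun u => by
    cases u with
    | inl v => exact Γ.ncard_incidenceSet_inl v
    | inr i => exact Γ.ncard_incidenceSet_inr i

end CanonicalEmbedding

/-! ## Pairs of edges shared with the outer cycle -/

/-- A downward closed property on `Fin n` is given by a threshold. -/
theorem Fin.exists_threshold {n : ℕ} {p : Fin n → Prop} (h : ∀ i j, i ≤ j → p j → p i) :
    ∃ a ≤ n, ∀ i : Fin n, i.val < a ↔ p i := by
  classical
  have hex : ∃ a, ∀ i : Fin n, p i → i.val < a := ⟨n, fun i _ => i.isLt⟩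
  refine ⟨Nat.find hex, Nat.find_min' hex fun i _ => i.isLt, fun i => ⟨fun hi => ?_, fun hi => ?_⟩⟩
  · have := Nat.find_min hex hi
    push Not at this
    obtain ⟨j, hj, hij⟩ := this
    exact h i j (Fin.le_def.2 hij) hj
  · exact Nat.find_spec hex i hi

theorem Fin.ncard_interval {n a b : ℕ} (hb : b ≤ n) :
    {i : Fin n | a ≤ i.val ∧ i.val < b}.ncard = b - a := by
  rw [← Nat.card_Ico, ← Set.ncard_coe_finset, ← Set.InjOn.ncard_image Fin.val_injective.injOn]
  congr 1
  ext x
  simp only [Set.mem_image, Set.mem_ofPred_eq, Finset.coe_Ico, Set.mem_Ico]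
  exact ⟨fun ⟨i, hi, h⟩ => h ▸ hi, fun h => ⟨⟨x, by omega⟩, h, rfl⟩⟩

namespace CanonicalEmbedding

variable {k : ℕ} {D : Type*} (Γ : CanonicalEmbedding k D)

/-- The dart at position `p` of the outer cycle. -/
def outerDart (p : ℕ) : D := (Γ.map.next ^ p) Γ.start

theorem face_outerDart (p : ℕ) : Γ.map.face (Γ.outerDart p) = Γ.outer := Γ.face_next_pow p

theorem dart_eq_outerDart (i : Fin (2 * k)) : Γ.dart i = Γ.outerDart (Γ.pos i) := rfl

theorem tail_outerDart_succ (p : ℕ) :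
    Γ.map.tail (Γ.outerDart (p + 1)) = Γ.map.head (Γ.outerDart p) := by
  rw [outerDart, pow_succ', Equiv.Perm.mul_apply, Γ.map.tail_next, outerDart]

/-- The vertices of `G` given by sets of vertices of `G'` and of inserted vertices. -/
def vertsOf (X : Set Γ.map.Vertex) (Y : Set (Fin (2 * k))) : Set Γ.Vert :=
  {u | Sum.elim (· ∈ X) (· ∈ Y) u}

theorem inl_mem_vertsOf {X : Set Γ.map.Vertex} {Y : Set (Fin (2 * k))} {v : Γ.map.Vertex} :
    .inl v ∈ Γ.vertsOf X Y ↔ v ∈ X := Iff.rfl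

theorem inr_mem_vertsOf {X : Set Γ.map.Vertex} {Y : Set (Fin (2 * k))} {i : Fin (2 * k)} :
    .inr i ∈ Γ.vertsOf X Y ↔ i ∈ Y := Iff.rfl

theorem compl_vertsOf (X : Set Γ.map.Vertex) (Y : Set (Fin (2 * k))) :
    (Γ.vertsOf X Y)ᶜ = Γ.vertsOf Xᶜ Yᶜ := by
  ext u
  cases u <;> rfl

theorem exists_link_of_mem_cut {e : Γ.Ed} {H : Set Γ.Vert} (h : e ∈ Γ.graph.cut H) :
    ∃ x y, Γ.Link e x y ∧ ¬ (x ∈ H ↔ y ∈ H) := by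
  obtain ⟨x, hx, y, hy, h | h⟩ := h
  · exact ⟨x, y, h, by tauto⟩
  · exact ⟨y, x, h, by tauto⟩

theorem notMem_neg_iff {e : Γ.Ed} : e ∈ Γ.signedGraph.negᶜ ↔ ∀ i : Fin k, e ≠ .inr (.inr i) := by
  change e ∉ Set.range _ ↔ _
  simp [eq_comm]

/-- The segment of the edge at position `p` that lies between the inserted vertices with indices less
than `a` and the others. -/
noncomputable def segmentAt (p a : ℕ) : Γ.Ed :=
  open Classical in
  if h : ∃ i : Fin (2 * k), i.val + 1 = a ∧ Γ.pos i = p then .inr (.inl h.choose)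
  else .inl (Γ.map.edge (Γ.outerDart p))

theorem segmentAt_of_succ {p a : ℕ} {i : Fin (2 * k)} (hi : i.val + 1 = a) (hp : Γ.pos i = p) :
    Γ.segmentAt p a = .inr (.inl i) := by
  have hex : ∃ i : Fin (2 * k), i.val + 1 = a ∧ Γ.pos i = p := ⟨i, hi, hp⟩
  rw [segmentAt, dif_pos hex]
  have := hex.choose_spec.1
  congr 2
  exact Fin.ext (by omega)

theorem segmentAt_of_forall {p a : ℕ} (h : ∀ i : Fin (2 * k), i.val + 1 = a → Γ.pos i ≠ p) :
    Γ.segmentAt p a = .inl (Γ.map.edge (Γ.outerDart p)) := by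
  rw [segmentAt, dif_neg]
  rintro ⟨i, hi, hp⟩
  exact h i hi hp

theorem negative_mem_cut {X : Set Γ.map.Vertex} {Y : Set (Fin (2 * k))} {i : Fin k}
    (h : ¬ ((⟨i.val, by omega⟩ : Fin (2 * k)) ∈ Y ↔ (⟨k + i.val, by omega⟩ : Fin (2 * k)) ∈ Y)) :
    .inr (.inr i) ∈ Γ.signedGraph.neg ∩ Γ.graph.cut (Γ.vertsOf X Y) := by
  refine ⟨⟨i, rfl⟩, ?_⟩
  by_cases h' : (⟨i.val, by omega⟩ : Fin (2 * k)) ∈ Y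
  · exact ⟨_, Γ.inr_mem_vertsOf.2 h', _, fun h'' => h ⟨fun _ => Γ.inr_mem_vertsOf.1 h'', fun _ => h'⟩,
      Or.inl (.negative i)⟩
  · exact ⟨_, Γ.inr_mem_vertsOf.2 (by tauto), _, h', Or.inr (.negative i)⟩

variable [Finite D]

theorem edge_outerDart_inj {p q : ℕ} (hp : p < Γ.outerLength) (hq : q < Γ.outerLength)
    (h : Γ.map.edge (Γ.outerDart p) = Γ.map.edge (Γ.outerDart q)) : p = q :=
  Γ.next_pow_inj hp hq (Γ.isCubicPlane.eq_of_face_edge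
    ((Γ.face_outerDart p).trans (Γ.face_outerDart q).symm) h)

/-! ### The cut of G over a pair of edges of the outer cycle -/

section Pair

variable {Γ} {p₁ p₂ : ℕ} (h12 : p₁ < p₂) (h2 : p₂ < Γ.outerLength) {X : Set Γ.map.Vertex}
  (hX : Γ.map.graph.cut X = {Γ.map.edge (Γ.outerDart p₁), Γ.map.edge (Γ.outerDart p₂)})
  (hhead : Γ.map.head (Γ.outerDart p₁) ∈ X)
include h12 h2 hX hhead

/-- Along the outer cycle, membership in `X` changes exactly at the two cut edges. The bound on `q`
includes the return to the starting vertex, so that heads of all darts are covered. -/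
theorem tail_outerDart_mem_iff {q : ℕ} (hq : q ≤ Γ.outerLength) :
    Γ.map.tail (Γ.outerDart q) ∈ X ↔ p₁ < q ∧ q ≤ p₂ := by
  have hstep : ∀ q < Γ.outerLength,
      ((Γ.map.tail (Γ.outerDart q) ∈ X ↔ Γ.map.tail (Γ.outerDart (q + 1)) ∈ X) ↔
        q ≠ p₁ ∧ q ≠ p₂) := by
    intro q hq
    rw [tail_outerDart_succ, ← not_iff_not, ← CombMap.edge_mem_cut_iff, hX, Set.mem_insert_iff,
      Set.mem_singleton_iff]
    constructor
    · rintro (h | h)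
      · have := Γ.edge_outerDart_inj hq (h12.trans h2) h
        tauto
      · have := Γ.edge_outerDart_inj hq h2 h
        tauto
    · intro h
      by_cases h' : q = p₁
      · exact Or.inl (by rw [h'])
      · exact Or.inr (by rw [show q = p₂ by tauto])
  have h1 : Γ.map.tail (Γ.outerDart p₁) ∉ X := by
    have := (hstep p₁ (h12.trans h2)).not.2 (by tauto)
    rw [tail_outerDart_succ] at this
    tauto
  have hconst : ∀ q ≤ p₁, (Γ.map.tail (Γ.outerDart q) ∈ X ↔ Γ.map.tail (Γ.outerDart 0) ∈ X) := by
    intro q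
    induction q with
    | zero => intro _; rfl
    | succ q ih =>
      intro hq
      rw [← ih (by omega), ← (hstep q (by omega)).2 ⟨by omega, by omega⟩]
  have h0 : Γ.map.tail (Γ.outerDart 0) ∉ X := by rwa [← hconst p₁ le_rfl]
  induction q with
  | zero => simp [h0]
  | succ q ih =>
    have ih' : Γ.map.tail (Γ.outerDart q) ∈ X ↔ p₁ < q ∧ q ≤ p₂ := ih (by omega)
    have hs := hstep q (by omega)
    by_cases hq1 : q = p₁
    · have : ¬ (q ≠ p₁ ∧ q ≠ p₂) := by tauto
      rw [← hs, ih'] at this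
      have hh : p₁ < q + 1 ∧ q + 1 ≤ p₂ := by omega
      have hn : ¬ (p₁ < q ∧ q ≤ p₂) := by omega
      exact ⟨fun _ => hh, fun _ => by
        by_contra hc
        exact this ⟨fun h => absurd h hn, fun h => absurd h hc⟩⟩
    · by_cases hq2 : q = p₂
      · have : ¬ (q ≠ p₁ ∧ q ≠ p₂) := by tauto
        rw [← hs, ih'] at this
        have hh : ¬ (p₁ < q + 1 ∧ q + 1 ≤ p₂) := by omega
        have hy : p₁ < q ∧ q ≤ p₂ := by omega
        exact ⟨fun hx => absurd ⟨fun _ => hx, fun _ => hy⟩ this, fun h => absurd h hh⟩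
      · rw [← hs.2 ⟨hq1, hq2⟩, ih']
        omega

theorem head_outerDart_mem_iff {q : ℕ} (hq : q < Γ.outerLength) :
    Γ.map.head (Γ.outerDart q) ∈ X ↔ p₁ ≤ q ∧ q < p₂ := by
  rw [← tail_outerDart_succ, tail_outerDart_mem_iff h12 h2 hX hhead (by omega)]
  omega

variable {a b : ℕ} (ha : a ≤ 2 * k) (hb : b ≤ 2 * k)
  (ha₁ : ∀ i : Fin (2 * k), Γ.pos i < p₁ → i.val < a)
  (ha₂ : ∀ i : Fin (2 * k), p₁ < Γ.pos i → a ≤ i.val)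
  (hb₁ : ∀ i : Fin (2 * k), Γ.pos i < p₂ → i.val < b)
  (hb₂ : ∀ i : Fin (2 * k), p₂ < Γ.pos i → b ≤ i.val)
include ha hb ha₁ ha₂ hb₁ hb₂

/-- The thresholds `a` and `b` may divide the vertices inserted on the two cut edges at any place.
Over every other edge of `G'` all vertices lie on one side, and over each of these two edges only
the segment at the threshold changes sides. -/
theorem positive_cut_subset :
    Γ.signedGraph.negᶜ ∩ Γ.graph.cut (Γ.vertsOf X {i | a ≤ i.val ∧ i.val < b}) ⊆
      {Γ.segmentAt p₁ a, Γ.segmentAt p₂ b} := by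
  have htail := fun q (hq : q < Γ.outerLength) => tail_outerDart_mem_iff h12 h2 hX hhead hq.le
  have hhd := fun q (hq : q < Γ.outerLength) => head_outerDart_mem_iff h12 h2 hX hhead hq
  rintro e ⟨hpos, hcut⟩
  rw [notMem_neg_iff] at hpos
  obtain ⟨x, y, hlink, hsep⟩ := Γ.exists_link_of_mem_cut hcut
  rw [Set.mem_insert_iff, Set.mem_singleton_iff]
  cases hlink with
  | whole d h =>
    rw [inl_mem_vertsOf, inl_mem_vertsOf, ← CombMap.edge_mem_cut_iff, hX, Set.mem_insert_iff,
      Set.mem_singleton_iff] at hsep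
    rcases hsep with he | he
    · left
      rw [Γ.segmentAt_of_forall, he]
      intro i _ hp
      exact h i (by rw [he, dart_eq_outerDart, hp])
    · right
      rw [Γ.segmentAt_of_forall, he]
      intro i _ hp
      exact h i (by rw [he, dart_eq_outerDart, hp])
  | first i h =>
    rw [inl_mem_vertsOf, inr_mem_vertsOf, dart_eq_outerDart, htail _ (Γ.pos_lt_outerLength i),
      Set.mem_ofPred_eq] at hsep
    have a1 := ha₁ i
    have a2 := ha₂ i
    have b1 := hb₁ i
    have b2 := hb₂ i
    have hbefore : ∀ j : Fin (2 * k), j.val < i.val → Γ.pos j < Γ.pos i := by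
      intro j hj
      have := Γ.pos_mono (Fin.le_def.2 hj.le)
      have := h j (Fin.lt_def.2 hj)
      rw [Ne, edge_dart_eq_iff] at this
      omega
    rcases lt_trichotomy (Γ.pos i) p₁ with hp | hp | hp
    · omega
    · left
      rw [Γ.segmentAt_of_forall, dart_eq_outerDart, hp]
      intro j hj hpj
      have := hbefore j (by omega)
      omega
    · right
      have hp2 : Γ.pos i = p₂ := by omega
      rw [Γ.segmentAt_of_forall, dart_eq_outerDart, hp2]
      intro j hj hpj
      have := hbefore j (by omega)
      omega
  | middle i j hij h =>
    rw [inr_mem_vertsOf, inr_mem_vertsOf, Set.mem_ofPred_eq, Set.mem_ofPred_eq] at hsep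
    rw [dart_eq_iff] at h
    have a1 := ha₁ j
    have a2 := ha₂ i
    have b1 := hb₁ j
    have b2 := hb₂ i
    by_cases hja : j.val = a
    · left
      rw [Γ.segmentAt_of_succ (i := i) (by omega) (by omega)]
    · right
      rw [Γ.segmentAt_of_succ (i := i) (by omega) (by omega)]
  | last i h =>
    rw [inl_mem_vertsOf, inr_mem_vertsOf, dart_eq_outerDart, hhd _ (Γ.pos_lt_outerLength i),
      Set.mem_ofPred_eq] at hsep
    have a1 := ha₁ i
    have a2 := ha₂ i
    have b1 := hb₁ i
    have b2 := hb₂ i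
    have hafter : ∀ c ≤ 2 * k, (∀ j : Fin (2 * k), Γ.pos i < Γ.pos j → c ≤ j.val) →
        c ≤ i.val + 1 := by
      intro c hc hcj
      by_cases hi : i.val + 1 < 2 * k
      · refine hcj ⟨i.val + 1, hi⟩ ?_
        have h1 := h ⟨i.val + 1, hi⟩ rfl
        rw [Ne, dart_eq_iff] at h1
        have h2 : Γ.pos i ≤ Γ.pos ⟨i.val + 1, hi⟩ := Γ.pos_mono (Fin.le_def.2 (by simp only; omega))
        omega
      · omega
    rcases lt_trichotomy (Γ.pos i) p₁ with hp | hp | hp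
    · omega
    · left
      have := hafter a ha (by rw [hp]; exact ha₂)
      rw [Γ.segmentAt_of_succ (i := i) (by omega) (by omega)]
    · right
      have hp2 : Γ.pos i = p₂ := by omega
      have := hafter b hb (by rw [hp2]; exact hb₂)
      rw [Γ.segmentAt_of_succ (i := i) (by omega) (by omega)]
  | negative i => exact absurd rfl (hpos i)

theorem ncard_positive_cut_le : (Γ.signedGraph.negᶜ ∩
    Γ.graph.cut (Γ.vertsOf X {i | a ≤ i.val ∧ i.val < b})).ncard ≤ 2 := by
  refine (Set.ncard_le_ncard
    (positive_cut_subset h12 h2 hX hhead ha hb ha₁ ha₂ hb₁ hb₂)).trans ?_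
  exact (Set.ncard_insert_le _ _).trans (by rw [Set.ncard_singleton])

end Pair

theorem three_le_ncard_negative_cut {a b : ℕ} (hb : b ≤ 2 * k) (hk : 3 ≤ k) (h3 : a + 3 ≤ b)
    (h3' : b + 3 ≤ a + 2 * k)
    (X : Set Γ.map.Vertex) : 3 ≤ (Γ.signedGraph.neg ∩
      Γ.graph.cut (Γ.vertsOf X {i | a ≤ i.val ∧ i.val < b})).ncard := by
  have hg : ∃ g : Fin 3 → Fin k, Function.Injective g ∧ ∀ l,
      ¬ ((a ≤ (g l).val ∧ (g l).val < b) ↔ (a ≤ k + (g l).val ∧ k + (g l).val < b)) := by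
    -- The interval or its cyclic complement has length at most `k`, so it contains no antipodal
    -- pair. Its first three members, starting at `s` and read modulo `2k`, are ends of three
    -- distinct negative edges that leave it.
    set s : ℕ := if b ≤ a + k then a else b with hs
    refine ⟨fun l => ⟨if s + l.val < k then s + l.val else if s + l.val < 2 * k then s + l.val - k
      else s + l.val - 2 * k, ?_⟩, fun l l' h => ?_, fun l => ?_⟩
    · have := l.isLt
      split_ifs at hs ⊢ <;> omega
    · have h := congrArg Fin.val h
      have := l.isLt
      have := l'.isLt
      ext
      simp only at h
      split_ifs at hs h <;> omega
    · have := l.isLt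
      simp only
      split_ifs at hs ⊢ <;> omega
  obtain ⟨g, hinj, hg⟩ := hg
  have hsub : Set.range (fun l => (.inr (.inr (g l)) : Γ.Ed)) ⊆ Γ.signedGraph.neg ∩
      Γ.graph.cut (Γ.vertsOf X {i | a ≤ i.val ∧ i.val < b}) := by
    rintro _ ⟨l, rfl⟩
    exact Γ.negative_mem_cut (hg l)
  refine le_trans ?_ (Set.ncard_le_ncard hsub)
  rw [← Set.image_univ, Set.InjOn.ncard_image, Set.ncard_univ, Nat.card_eq_fintype_card,
    Fintype.card_fin]
  intro l _ l' _ h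
  exact hinj (Sum.inr.inj (Sum.inr.inj h))

theorem length_of_ncard_positive_cut_le {X : Set Γ.map.Vertex} {a b : ℕ} (hb : b ≤ 2 * k) (hk : 3 ≤ k)
    (hG : Γ.signedGraph.IsCritical k) (hle : (Γ.signedGraph.negᶜ ∩
      Γ.graph.cut (Γ.vertsOf X {i | a ≤ i.val ∧ i.val < b})).ncard ≤ 2) :
    b ≤ a + 2 ∨ a + 2 * k ≤ b + 2 := by
  by_contra! hcon
  have h1 := Γ.three_le_ncard_negative_cut (a := a) hb hk (by omega) (by omega) X
  have h2 : (Γ.signedGraph.neg ∩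
      Γ.graph.cut (Γ.vertsOf X {i | a ≤ i.val ∧ i.val < b})).ncard ≤ (Γ.signedGraph.negᶜ ∩
      Γ.graph.cut (Γ.vertsOf X {i | a ≤ i.val ∧ i.val < b})).ncard :=
    SignedGraph.cut_balance (S := Γ.signedGraph) rfl hG.1 Γ.ncard_neg _
  omega

/-! ### Vertex sets of G with small cuts -/

theorem eq_inr_of_isLink_neg {e : Γ.Ed} (he : e ∈ Γ.signedGraph.neg) {u v : Γ.Vert}
    (h : Γ.graph.IsLink e u v) : ∃ i j, u = .inr i ∧ v = .inr j ∧
      e = .inr (.inr (negativeIndex i)) ∧ e = .inr (.inr (negativeIndex j)) := by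
  obtain ⟨l, rfl⟩ := he
  obtain ⟨i, j, rfl, rfl⟩ : ∃ i j, u = .inr i ∧ v = .inr j := by
    rcases h with h | h <;> cases h <;> exact ⟨_, _, rfl, rfl⟩
  refine ⟨i, j, rfl, rfl, ?_, ?_⟩
  · rw [← Γ.inc_negative_iff.1 h.inc_left]
  · rw [← Γ.inc_negative_iff.1 h.inc_right]

theorem mult_neg_eq_zero {X : Set Γ.map.Vertex} {Y : Set (Fin (2 * k))}
    (hYi : Set.InjOn negativeIndex Y) {u v : Γ.Vert} (hu : u ∈ Γ.vertsOf X Y)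
    (hv : v ∈ Γ.vertsOf X Y) : Γ.graph.mult Γ.signedGraph.neg u v = 0 := by
  by_contra h
  obtain ⟨e, he, hl⟩ := Graph.mult_ne_zero_iff.1 h
  obtain ⟨i, j, rfl, rfl, h1, h2⟩ := Γ.eq_inr_of_isLink_neg he hl
  have hij := hYi hu hv (Sum.inr.inj (Sum.inr.inj (h1.symm.trans h2)))
  subst hij
  exact hl.ne rfl

/-- A negative edge of the cut is determined by its end in `Y`. -/
theorem ncard_negative_cut_le (X : Set Γ.map.Vertex) (Y : Set (Fin (2 * k))) :
    (Γ.signedGraph.neg ∩ Γ.graph.cut (Γ.vertsOf X Y)).ncard ≤ Y.ncard := by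
  refine (Set.ncard_le_ncard (t := (fun i => (.inr (.inr (negativeIndex i)) : Γ.Ed)) '' Y) ?_).trans
    Set.ncard_image_le
  rintro e ⟨he, u, hu, v, hv, hl⟩
  obtain ⟨i, j, rfl, rfl, h1, h2⟩ := Γ.eq_inr_of_isLink_neg he hl
  exact ⟨i, hu, h1.symm⟩

theorem negativeIndex_injOn {Y : Set (Fin (2 * k))} (hY : ∀ i ∈ Y, ∀ j ∈ Y, i.val + k ≠ j.val) :
    Set.InjOn negativeIndex Y := by
  intro i hi j hj h
  have h1 := hY i hi j hj
  have h2 := hY j hj i hi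
  unfold negativeIndex at h
  split_ifs at h with h3 h4 h4 <;> have h := congrArg Fin.val h <;> simp only at h <;>
    ext <;> omega

/-- A set of vertices with at most two positive and two negative edges in its cut consists of two
vertices of `G'` and two inserted vertices. -/
theorem ncard_eq_two_of_small_cut (hG : Γ.signedGraph.IsCritical k) {X : Set Γ.map.Vertex}
    {Y : Set (Fin (2 * k))}
    (hle : (Γ.signedGraph.negᶜ ∩ Γ.graph.cut (Γ.vertsOf X Y)).ncard ≤ 2)
    (hY : Y.ncard ≤ 2) (hYi : Set.InjOn negativeIndex Y) (hX : X.Nontrivial) :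
    X.ncard = 2 ∧ Y.ncard = 2 := by
  classical
  have := Fintype.ofFinite Γ.Vert
  have ht := Γ.isTightCubic hG
  obtain ⟨H, hH⟩ : ∃ H : Finset Γ.Vert, (H : Set Γ.Vert) = Γ.vertsOf X Y :=
    ⟨(Γ.vertsOf X Y).toFinset, by simp⟩
  have hmem : ∀ u, u ∈ H ↔ u ∈ Γ.vertsOf X Y := fun u => by rw [← hH, Finset.mem_coe]
  have hpos : ∀ u ∈ H, ∀ v ∈ H, Γ.graph.mult Γ.signedGraph.neg u v = 0 := fun u hu v hv =>
    Γ.mult_neg_eq_zero hYi ((hmem u).1 hu) ((hmem v).1 hv)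
  have hb : between (Γ.graph.mult Set.univ) H Hᶜ ≤ 2 + Y.ncard := by
    rw [Graph.between_mult_univ Γ.signedGraph.neg, Graph.between_compl_eq_cut,
      Graph.between_compl_eq_cut, hH]
    exact add_le_add hle (Γ.ncard_negative_cut_le X Y)
  have hcard : H.card = X.ncard + Y.ncard := by
    rw [← Set.ncard_coe_finset, hH]
    have : Γ.vertsOf X Y = Sum.inl '' X ∪ Sum.inr '' Y := by
      ext u
      cases u <;> simp [vertsOf]
    rw [this, Set.ncard_union_eq, Set.ncard_image_of_injective _ Sum.inl_injective,
      Set.ncard_image_of_injective _ Sum.inr_injective]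
    rw [Set.disjoint_left]
    rintro _ ⟨x, -, rfl⟩ ⟨y, -, h⟩
    cases h
  have hX2 : 2 ≤ X.ncard := Set.one_lt_ncard_iff_nontrivial.2 hX
  have hne : H.Nonempty := Finset.card_pos.1 (by omega)
  -- The boundary is between 3 and 2 + |Y|, so `Y` is nonempty. If |Y| = 1 the boundary is 3 and `H`
  -- is a single vertex, against |X| ≥ 2. If |Y| = 2 the boundary is at most 4, and |X| + 2 ≤ 4.
  have h3 := ht.three_le_boundary hpos hne
  have h1 := fun h => ht.card_le_one hpos h
  have h4 := fun h => ht.card_le_four hpos h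
  omega

/-- The two sides of a cut that consists of two edges between the outer face and another face have
at least two vertices. -/
theorem nontrivial_of_cut_eq {d₁ d₂ : D} (hne : d₁ ≠ d₂) (h1 : Γ.map.face d₁ = Γ.map.face d₂)
    (h2 : Γ.map.face (Γ.map.rev d₁) = Γ.map.face (Γ.map.rev d₂)) {X : Set Γ.map.Vertex}
    (hX : Γ.map.graph.cut X = {Γ.map.edge d₁, Γ.map.edge d₂}) : X.Nontrivial := by
  have hend : ∀ d, Γ.map.edge d ∈ Γ.map.graph.cut X →
      ∃ c, (c = d ∨ c = Γ.map.rev d) ∧ Γ.map.tail c ∈ X := by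
    intro d hd
    rw [CombMap.edge_mem_cut_iff] at hd
    by_cases h : Γ.map.tail d ∈ X
    · exact ⟨d, Or.inl rfl, h⟩
    · exact ⟨Γ.map.rev d, Or.inr rfl, by rw [Γ.map.tail_rev]; tauto⟩
  obtain ⟨c₁, hc₁, hm₁⟩ := hend d₁ (by rw [hX]; simp)
  obtain ⟨c₂, hc₂, hm₂⟩ := hend d₂ (by rw [hX]; simp)
  refine ⟨_, hm₁, _, hm₂, fun ht => ?_⟩
  have hM := Γ.isCubicPlane
  rcases hc₁ with rfl | rfl <;> rcases hc₂ with rfl | rfl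
  · exact hne (hM.eq_of_sides ht (Or.inl ⟨h1, h2⟩))
  · have := hM.eq_of_sides ht (Or.inr ⟨by rw [Γ.map.rev_rev, h1], h2⟩)
    rw [this, Γ.map.rev_rev] at h2
    rw [this] at h1
    exact hM.face_ne_face_rev d₂ h1.symm
  · have := hM.eq_of_sides ht (Or.inr ⟨h2, by rw [Γ.map.rev_rev, h1]⟩)
    rw [← this, Γ.map.rev_rev] at h2
    exact hM.face_ne_face_rev d₁ h2.symm
  · exact hne (Γ.map.rev.injective (hM.eq_of_sides ht
      (Or.inl ⟨h2, by rw [Γ.map.rev_rev, Γ.map.rev_rev, h1]⟩)))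

/-- Two edges shared by the outer cycle and another face boundary carry no inserted vertices, and one
of the two parts that they separate has two vertices and weight two. -/
theorem shared_pair (hk : 4 ≤ k) (hG : Γ.signedGraph.IsCritical k) {p₁ p₂ : ℕ} (h12 : p₁ < p₂)
    (h2 : p₂ < Γ.outerLength)
    (hface : Γ.map.face (Γ.map.rev (Γ.outerDart p₁)) = Γ.map.face (Γ.map.rev (Γ.outerDart p₂))) :
    (∀ i, Γ.pos i ≠ p₁ ∧ Γ.pos i ≠ p₂) ∧
    ({i | p₁ < Γ.pos i ∧ Γ.pos i < p₂}.ncard = 2 ∨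
      {i | p₁ < Γ.pos i ∧ Γ.pos i < p₂}.ncard + 2 = 2 * k) ∧
    ∃ X : Set Γ.map.Vertex,
      Γ.map.graph.cut X = {Γ.map.edge (Γ.outerDart p₁), Γ.map.edge (Γ.outerDart p₂)} ∧
      X.ncard = 2 ∧ {i | Γ.map.tail (Γ.dart i) ∈ X}.ncard = 2 := by
  have hdne : Γ.outerDart p₁ ≠ Γ.outerDart p₂ := fun h =>
    h12.ne (Γ.next_pow_inj (h12.trans h2) h2 h)
  have hfo : Γ.map.face (Γ.outerDart p₁) = Γ.map.face (Γ.outerDart p₂) := by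
    rw [face_outerDart, face_outerDart]
  obtain ⟨X, hX, hhead⟩ : ∃ X, Γ.map.graph.cut X =
      {Γ.map.edge (Γ.outerDart p₁), Γ.map.edge (Γ.outerDart p₂)} ∧
      Γ.map.head (Γ.outerDart p₁) ∈ X := by
    obtain ⟨X, hX⟩ := CombMap.exists_cut_pair Γ.plane
      (fun h => h12.ne (Γ.edge_outerDart_inj (h12.trans h2) h2 h)) hfo hface
    by_cases h : Γ.map.head (Γ.outerDart p₁) ∈ X
    · exact ⟨X, hX, h⟩
    · exact ⟨Xᶜ, by rw [Graph.cut_compl, hX], h⟩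
  have hX' : Γ.map.graph.cut Xᶜ = {Γ.map.edge (Γ.outerDart p₁), Γ.map.edge (Γ.outerDart p₂)} := by
    rw [Graph.cut_compl, hX]
  have hthr : ∀ p, ∃ a ≤ 2 * k, ∀ i : Fin (2 * k), i.val < a ↔ Γ.pos i < p := fun p =>
    Fin.exists_threshold fun i j hij hj => (Γ.pos_mono hij).trans_lt hj
  -- The indices in [α₀, α₁) lie on the first edge, those in [α₁, β₀) strictly between the two
  -- edges, and those in [β₀, β₁) on the second.
  obtain ⟨α₀, hα₀, A₀⟩ := hthr p₁
  obtain ⟨α₁, hα₁, A₁⟩ := hthr (p₁ + 1)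
  obtain ⟨β₀, hβ₀, B₀⟩ := hthr p₂
  obtain ⟨β₁, hβ₁, B₁⟩ := hthr (p₂ + 1)
  have mono : ∀ {p q a b : ℕ}, p ≤ q → a ≤ 2 * k → (∀ i : Fin (2 * k), i.val < a ↔ Γ.pos i < p) →
      (∀ i : Fin (2 * k), i.val < b ↔ Γ.pos i < q) → a ≤ b := by
    intro p q a b hpq ha h h'
    by_contra! hlt
    have h1 := (h ⟨b, by omega⟩).1 hlt
    have h2 := (h' ⟨b, by omega⟩).2 (by omega)
    simp at h2
  have o1 : α₀ ≤ α₁ := mono (by omega) hα₀ A₀ A₁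
  have o2 : α₁ ≤ β₀ := mono (by omega) hα₁ A₁ B₀
  have o3 : β₀ ≤ β₁ := mono (by omega) hβ₀ B₀ B₁
  have hcut : ∀ a b, α₀ ≤ a → a ≤ α₁ → β₀ ≤ b → b ≤ β₁ → (Γ.signedGraph.negᶜ ∩
      Γ.graph.cut (Γ.vertsOf X {i | a ≤ i.val ∧ i.val < b})).ncard ≤ 2 := by
    intro a b h1 h1' h3 h3'
    refine ncard_positive_cut_le h12 h2 hX hhead (by omega) (by omega) ?_ ?_ ?_ ?_
    · intro i hi
      have := (A₀ i).2 hi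
      omega
    · intro i hi
      by_contra hlt
      have := (A₁ i).1 (by omega)
      omega
    · intro i hi
      have := (B₀ i).2 hi
      omega
    · intro i hi
      by_contra hlt
      have := (B₁ i).1 (by omega)
      omega
  have hlen : ∀ a b, α₀ ≤ a → a ≤ α₁ → β₀ ≤ b → b ≤ β₁ → b ≤ a + 2 ∨ a + 2 * k ≤ b + 2 := by
    intro a b h1 h1' h3 h3'
    exact Γ.length_of_ncard_positive_cut_le (by omega) (by omega) hG (hcut a b h1 h1' h3 h3')
  -- The ends of the interval move in steps of one, and length 3 is forbidden because 3 < 2k − 2. So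
  -- if the shortest interval has at most two members, so has the longest one.
  have hcase : β₁ ≤ α₀ + 2 ∨ α₁ + 2 * k ≤ β₀ + 2 := by
    rcases hlen α₁ β₀ o1 le_rfl le_rfl o3 with h | h
    · left
      by_contra! hlt
      by_cases h' : α₀ + 3 ≤ β₀
      · have := hlen (β₀ - 3) β₀ (by omega) (by omega) le_rfl o3
        omega
      · have := hlen α₀ (α₀ + 3) le_rfl o1 (by omega) (by omega)
        omega
    · exact Or.inr h
  have hin : {i : Fin (2 * k) | p₁ < Γ.pos i ∧ Γ.pos i < p₂} =
      {i : Fin (2 * k) | α₁ ≤ i.val ∧ i.val < β₀} := by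
    ext i
    have h1 := A₁ i
    have h2 := B₀ i
    simp only [Set.mem_ofPred_eq]
    omega
  rw [hin, Fin.ncard_interval hβ₀]
  have htail : ∀ i, Γ.map.tail (Γ.dart i) ∈ X ↔ p₁ < Γ.pos i ∧ Γ.pos i ≤ p₂ := fun i =>
    tail_outerDart_mem_iff h12 h2 hX hhead (Γ.pos_lt_outerLength i).le
  have hclear : α₀ = α₁ → β₀ = β₁ → ∀ i, Γ.pos i ≠ p₁ ∧ Γ.pos i ≠ p₂ := by
    intro e1 e2 i
    have := A₀ i
    have := A₁ i
    have := B₀ i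
    have := B₁ i
    omega
  rcases hcase with hc | hc
  · obtain ⟨n1, n2⟩ := Γ.ncard_eq_two_of_small_cut hG (hcut α₁ β₀ o1 le_rfl le_rfl o3)
      (by rw [Fin.ncard_interval hβ₀]; omega)
      (negativeIndex_injOn (by
        intro i hi j hj
        simp only [Set.mem_ofPred_eq] at hi hj
        omega))
      (Γ.nontrivial_of_cut_eq hdne hfo hface hX)
    have n2' := n2
    rw [Fin.ncard_interval hβ₀] at n2'
    -- The shortest interval has exactly two members and the longest at most two, so no index lies
    -- on either edge. In the other case the same argument applies to the complements.
    have hcl := hclear (by omega) (by omega)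
    refine ⟨hcl, Or.inl n2', X, hX, n1, ?_⟩
    refine (congrArg Set.ncard ?_).trans n2
    rw [← hin]
    ext i
    have := hcl i
    simp only [Set.mem_ofPred_eq, htail]
    omega
  · have hle := hcut α₀ β₁ le_rfl o1 o3 le_rfl
    rw [← Graph.cut_compl, compl_vertsOf] at hle
    have hcc : {i : Fin (2 * k) | α₀ ≤ i.val ∧ i.val < β₁}ᶜ.ncard = 2 * k - (β₁ - α₀) := by
      rw [Set.ncard_compl, Fin.ncard_interval hβ₁, Nat.card_eq_fintype_card, Fintype.card_fin]
    obtain ⟨n1, n2⟩ := Γ.ncard_eq_two_of_small_cut hG hle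
      (by rw [hcc]; omega)
      (negativeIndex_injOn (by
        intro i hi j hj
        simp only [Set.mem_compl_iff, Set.mem_ofPred_eq] at hi hj
        omega))
      (Γ.nontrivial_of_cut_eq hdne hfo hface hX')
    rw [hcc] at n2
    have hcl := hclear (by omega) (by omega)
    refine ⟨hcl, Or.inr (by omega), Xᶜ, hX', n1, ?_⟩
    refine (congrArg Set.ncard ?_).trans (hcc.trans n2)
    ext i
    have h1 := hcl i
    have h2 := A₀ i
    have h3 := B₁ i
    simp only [Set.mem_compl_iff, Set.mem_ofPred_eq, htail]
    omega

end CanonicalEmbedding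

/-! ## The structure at a bridge face -/

namespace Graph

variable {α β : Type*}

/-- If no edge joins `X` and its complement, and both induce connected graphs, then these are the
components. -/
theorem isComponentOf_iff_of_separated {K : Graph α β} {X : Set α} (hV : K.vertexSet = Set.univ)
    (hsep : ∀ e x y, K.IsLink e x y → x ∈ X → y ∈ X) (h₁ : (K.induce X).IsConn)
    (h₂ : (K.induce Xᶜ).IsConn) (A : Graph α β) :
    A.IsComponentOf K ↔ A = K.induce X ∨ A = K.induce Xᶜ := by
  have hle : ∀ Y : Set α, K.induce Y ≤ K := fun Y => K.induce_le (by rw [hV]; exact Set.subset_univ Y)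
  have hbelow : ∀ Y : Set α, (∀ e x y, K.IsLink e x y → x ∈ Y → y ∈ Y) → ∀ H : Graph α β,
      H ≤ K → H.IsConn → ∀ x ∈ H.vertexSet, x ∈ Y → H ≤ K.induce Y := by
    intro Y hY H hHK hH x hx hxY
    have hsub : ∀ y ∈ H.vertexSet, y ∈ Y := by
      intro y hy
      have := hH.2 x hx y hy
      clear hy
      induction this with
      | refl => exact hxY
      | tail _ hadj ih =>
        obtain ⟨e, he⟩ := hadj
        exact hY e _ _ (he.mono hHK) ih
    exact ⟨hsub, fun e a b h => ⟨h.mono hHK, hsub a h.left_mem, hsub b h.right_mem⟩⟩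
  have hsep' : ∀ e x y, K.IsLink e x y → x ∈ Xᶜ → y ∈ Xᶜ :=
    fun e x y h hx hy => hx (hsep e y x h.symm hy)
  have hmax : ∀ Y : Set α, (∀ e x y, K.IsLink e x y → x ∈ Y → y ∈ Y) → (K.induce Y).IsConn →
      (K.induce Y).IsComponentOf K := by
    intro Y hY hc
    refine ⟨⟨hle Y, hc⟩, fun H hH hYH => ?_⟩
    obtain ⟨x, hx⟩ := hc.1
    exact hbelow Y hY H hH.1 hH.2 x (hYH.vertexSet_mono hx) hx
  constructor
  · intro hA
    obtain ⟨x, hx⟩ := hA.1.2.1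
    by_cases hxX : x ∈ X
    · left
      have h := hbelow X hsep A hA.1.1 hA.1.2 x hx hxX
      exact le_antisymm h (hA.2 ⟨hle X, h₁⟩ h)
    · right
      have h := hbelow Xᶜ hsep' A hA.1.1 hA.1.2 x hx hxX
      exact le_antisymm h (hA.2 ⟨hle Xᶜ, h₂⟩ h)
  · rintro (rfl | rfl)
    · exact hmax X hsep h₁
    · exact hmax Xᶜ hsep' h₂

theorem reachable_symm {H : Graph α β} {a b : α} (h : Relation.ReflTransGen H.Adj a b) :
    Relation.ReflTransGen H.Adj b a :=
  (Relation.ReflTransGen.stdSymm (r := H.Adj)).symm _ _ h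

theorem isConn_of_reachable {H : Graph α β} {a : α} (ha : a ∈ H.vertexSet)
    (h : ∀ x ∈ H.vertexSet, Relation.ReflTransGen H.Adj a x) : H.IsConn :=
  ⟨⟨a, ha⟩, fun x hx y hy => (reachable_symm (h x hx)).trans (h y hy)⟩

theorem deg_eq_two {H : Graph α β} {a b d : α} {p s : β} {E : Set β}
    (hE : H.edgeSet ⊆ insert p (insert s E))
    (hp : H.IsLink p a b) (hs : H.IsLink s d a) (hab : a ≠ b) (had : a ≠ d) (hps : p ≠ s)
    (hother : ∀ e ∈ E, ¬ H.Inc e a) : H.deg a = 2 := by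
  have h1 : H.incidenceSet a = {p, s} := by
    ext e
    simp only [mem_incidenceSet, Set.mem_insert_iff, Set.mem_singleton_iff]
    constructor
    · intro he
      rcases hE he.edge_mem with h | h | h
      · exact Or.inl h
      · exact Or.inr h
      · exact absurd he (hother e h)
    · rintro (rfl | rfl)
      · exact hp.inc_left
      · exact hs.inc_right
  have h2 : H.loopSet a = ∅ := by
    ext e
    simp only [mem_loopSet, Set.mem_empty_iff_false, iff_false]
    intro he
    have : e ∈ H.incidenceSet a := he.inc
    rw [h1] at this
    rcases this with rfl | rfl
    · exact hab (IsLink.right_unique he hp)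
    · exact had (IsLink.right_unique he hs.symm)
  rw [deg, h1, h2, Set.ncard_empty, Set.ncard_pair hps]

theorem isCyc_of_four {H : Graph α β} {a b c d : α} {p q r s : β}
    (hV : H.vertexSet = {a, b, c, d}) (hE : H.edgeSet ⊆ {p, q, r, s})
    (hp : H.IsLink p a b) (hq : H.IsLink q b c) (hr : H.IsLink r c d) (hs : H.IsLink s d a)
    (hv : [a, b, c, d].Nodup) (he : [p, q, r, s].Nodup) :
    H.IsCyc ∧ H.edgeSet.ncard = 4 := by
  simp only [List.nodup_cons, List.mem_cons, List.not_mem_nil, or_false, not_or, not_false_eq_true,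
    List.nodup_nil, and_true] at hv he
  obtain ⟨⟨hab, hac, had⟩, ⟨hbc, hbd⟩, hcd⟩ := hv
  obtain ⟨⟨hpq, hpr, hps⟩, ⟨hqr, hqs⟩, hrs⟩ := he
  have hno : ∀ {e x y v}, H.IsLink e x y → v ≠ x → v ≠ y → ¬ H.Inc e v := by
    intro e x y v h h1 h2 hinc
    rcases hinc.eq_or_eq_of_isLink h with h | h
    · exact h1 h
    · exact h2 h
  have hE' : ∀ e ∈ H.edgeSet, e = p ∨ e = q ∨ e = r ∨ e = s := fun e he => hE he
  refine ⟨⟨⟨⟨a, hp.left_mem⟩, ?_⟩, ?_⟩, ?_⟩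
  · have ha : ∀ x ∈ H.vertexSet, Relation.ReflTransGen H.Adj a x := by
      intro x hx
      rw [hV] at hx
      have hb' : Relation.ReflTransGen H.Adj a b := .single hp.adj
      have hc' : Relation.ReflTransGen H.Adj a c := hb'.tail hq.adj
      rcases hx with rfl | rfl | rfl | rfl
      · exact .refl
      · exact hb'
      · exact hc'
      · exact hc'.tail hr.adj
    exact (isConn_of_reachable hp.left_mem ha).2
  · intro x hx
    rw [hV] at hx
    rcases hx with rfl | rfl | rfl | rfl
    · refine deg_eq_two (E := {q, r}) ?_ hp hs hab had hps ?_
      · intro e he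
        rcases hE' e he with rfl | rfl | rfl | rfl <;> simp
      · rintro e (rfl | rfl)
        · exact hno hq hab hac
        · exact hno hr hac had
    · refine deg_eq_two (E := {r, s}) ?_ hq hp hbc (Ne.symm hab) (Ne.symm hpq) ?_
      · intro e he
        rcases hE' e he with rfl | rfl | rfl | rfl <;> simp
      · rintro e (rfl | rfl)
        · exact hno hr hbc hbd
        · exact hno hs hbd (Ne.symm hab)
    · refine deg_eq_two (E := {s, p}) ?_ hr hq hcd (Ne.symm hbc) (Ne.symm hqr) ?_
      · intro e he
        rcases hE' e he with rfl | rfl | rfl | rfl <;> simp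
      · rintro e (rfl | rfl)
        · exact hno hs hcd (Ne.symm hac)
        · exact hno hp (Ne.symm hac) (Ne.symm hbc)
    · refine deg_eq_two (E := {p, q}) ?_ hs hr (Ne.symm had) (Ne.symm hcd) (Ne.symm hrs) ?_
      · intro e he
        rcases hE' e he with rfl | rfl | rfl | rfl <;> simp
      · rintro e (rfl | rfl)
        · exact hno hp (Ne.symm had) (Ne.symm hbd)
        · exact hno hq (Ne.symm hbd) (Ne.symm hcd)
  · have : H.edgeSet = {p, q, r, s} := by
      refine hE.antisymm ?_
      rintro e (rfl | rfl | rfl | rfl)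
      · exact hp.edge_mem
      · exact hq.edge_mem
      · exact hr.edge_mem
      · exact hs.edge_mem
    rw [this, Set.ncard_insert_of_notMem (by simp [hpq, hpr, hps]),
      Set.ncard_insert_of_notMem (by simp [hqr, hqs]), Set.ncard_pair hrs]

end Graph

/-! ### Digons in cubic plane maps -/

namespace CombMap.IsCubicPlane

variable {D : Type*} [Finite D] {M : CombMap D} (hM : M.IsCubicPlane)
include hM

theorem edge_rot_ne (c : D) : M.edge (M.rot c) ≠ M.edge c := by
  intro h
  rcases M.edge_eq_iff.1 h with h | h
  · exact hM.rot_ne c h.symm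
  · have := hM.tail_ne_head (M.rot c)
    rw [← M.tail_rev, ← h, M.tail_rot] at this
    exact this rfl

theorem edge_rot_rot_ne (c : D) : M.edge (M.rot (M.rot c)) ≠ M.edge c := by
  have := hM.edge_rot_ne (M.rot (M.rot c))
  rw [hM.rot_rot_rot] at this
  exact this.symm

/-- Two vertices whose cut has two edges, one at each vertex, form a digon. -/
theorem rev_rot_of_cut_pair {c₁ c₂ : D} (hne : M.tail c₁ ≠ M.tail c₂)
    (hcut : M.graph.cut {M.tail c₁, M.tail c₂} = {M.edge c₁, M.edge c₂}) :
    M.rev (M.rot c₁) = M.rot (M.rot c₂) ∧ M.rev (M.rot c₂) = M.rot (M.rot c₁) := by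
  have hhead : ∀ c, c = c₁ ∨ c = c₂ → M.head c ∉ ({M.tail c₁, M.tail c₂} : Set M.Vertex) := by
    intro c hc hmem
    have h : M.edge c ∈ M.graph.cut {M.tail c₁, M.tail c₂} := by
      rw [hcut]
      rcases hc with rfl | rfl <;> simp
    rw [edge_mem_cut_iff] at h
    apply h
    rcases hc with rfl | rfl <;> simp [hmem]
  have key : ∀ b, M.tail b = M.tail c₁ → M.edge b ≠ M.edge c₁ →
      M.rev b = M.rot c₂ ∨ M.rev b = M.rot (M.rot c₂) := by
    intro b hb hbe
    have hbe2 : M.edge b ≠ M.edge c₂ := by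
      intro h
      rcases M.edge_eq_iff.1 h with h | h
      · rw [h, hb] at hne
        exact hne rfl
      · apply hhead c₂ (Or.inr rfl)
        rw [h, M.head_rev, hb]
        simp
    have hnc : M.edge b ∉ M.graph.cut {M.tail c₁, M.tail c₂} := by
      rw [hcut]
      simp [hbe, hbe2]
    rw [edge_mem_cut_iff, not_not] at hnc
    have hh := hnc.1 (by simp [hb])
    have hne' := hM.tail_ne_head b
    rcases hh with hh | hh
    · exact absurd (hb.trans hh.symm) hne'
    · rcases hM.tail_eq_iff.1 (show M.tail c₂ = M.tail (M.rev b) from hh.symm) with h | h | h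
      · exfalso
        apply hbe2
        rw [← h, M.edge_rev]
      · exact Or.inl h
      · exact Or.inr h
  have k1 := key (M.rot c₁) (M.tail_rot _) (hM.edge_rot_ne c₁)
  have k2 := key (M.rot (M.rot c₁)) (by rw [M.tail_rot, M.tail_rot]) (hM.edge_rot_rot_ne c₁)
  have hinj : M.rev (M.rot c₁) ≠ M.rev (M.rot (M.rot c₁)) := fun h =>
    hM.rot_ne (M.rot c₁) (M.rev.injective h).symm
  rcases k1 with k1 | k1 <;> rcases k2 with k2 | k2
  · exact absurd (k1.trans k2.symm) hinj
  · exfalso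
    -- This matching would twist the digon: `next` would take `rot c₁` to `rot (rot c₂)` and on to
    -- `c₁`, putting both sides of the edge of `c₁` into one face.
    apply hM.face_rot_ne c₁
    have e1 : M.next (M.rot c₁) = M.rot (M.rot c₂) := by rw [next_apply, k1]
    have e2 : M.next (M.rot (M.rot c₂)) = c₁ := by
      rw [next_apply, ← k2, M.rev_rev, hM.rot_rot_rot]
    rw [← M.face_next (M.rot c₁), e1, ← M.face_next, e2]
  · exact ⟨k1, by rw [← k2, M.rev_rev]⟩
  · exact absurd (k1.trans k2.symm) hinj

end CombMap.IsCubicPlane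

namespace CanonicalEmbedding

variable {k : ℕ} {D : Type*} [Finite D] (Γ : CanonicalEmbedding k D)

/-- The configuration at a bridge face `F`: the tails of `c₁` and `c₂` form a digon, which is
separated from the rest of `G'` by the edges of `c₁` and `c₂`; these are the edges that `F` shares
with the outer cycle. The digon has the face `F` on one side, and on the other side the
outer face; `z_i` and `z_j` are the vertices inserted on its outer edge. -/
structure IsBridgeConfig (F : Γ.map.Face) (c₁ c₂ : D) (i j : Fin (2 * k)) : Prop where
  face_ne : F ≠ Γ.outer
  shared : Γ.sharedEdges F = {Γ.map.edge c₁, Γ.map.edge c₂}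
  tail_ne : Γ.map.tail c₁ ≠ Γ.map.tail c₂
  cut : Γ.map.graph.cut {Γ.map.tail c₁, Γ.map.tail c₂} = {Γ.map.edge c₁, Γ.map.edge c₂}
  rev₁ : Γ.map.rev (Γ.map.rot c₁) = Γ.map.rot (Γ.map.rot c₂)
  rev₂ : Γ.map.rev (Γ.map.rot c₂) = Γ.map.rot (Γ.map.rot c₁)
  face₁ : Γ.map.face c₁ = F
  face₁' : Γ.map.face (Γ.map.rot c₁) = Γ.outer
  face₂ : Γ.map.face c₂ = Γ.outer
  face₂' : Γ.map.face (Γ.map.rot c₂) = F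
  clear : ∀ l, Γ.map.edge (Γ.dart l) ≠ Γ.map.edge c₁ ∧ Γ.map.edge (Γ.dart l) ≠ Γ.map.edge c₂
  succ : j.val = i.val + 1
  tail_dart : ∀ l, Γ.map.tail (Γ.dart l) ∈ ({Γ.map.tail c₁, Γ.map.tail c₂} : Set _) ↔ l = i ∨ l = j
  dart_eq : ∀ l, Γ.dart l = Γ.map.rot c₁ ↔ l = i ∨ l = j

variable {Γ}

theorem edge_mem_sharedEdges_iff {F : Γ.map.Face} (hF : F ≠ Γ.outer) {e : Γ.map.Edge} :
    e ∈ Γ.sharedEdges F ↔ ∃ d, Γ.map.edge d = e ∧ Γ.map.face d = Γ.outer ∧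
      Γ.map.face (Γ.map.rev d) = F := by
  obtain ⟨d, rfl⟩ := Γ.map.exists_edge_eq e
  rw [sharedEdges, outerCycle, Set.mem_inter_iff, CombMap.edge_mem_boundary,
    CombMap.edge_mem_boundary]
  constructor
  · rintro ⟨h1 | h1, h2 | h2⟩
    · exact absurd (h1.symm.trans h2) hF
    · exact ⟨Γ.map.rev d, Γ.map.edge_rev d, h2, by rw [Γ.map.rev_rev, h1]⟩
    · exact ⟨d, rfl, h2, h1⟩
    · exact absurd (h1.symm.trans h2) hF
  · rintro ⟨d', he, h1, h2⟩
    rcases Γ.map.edge_eq_iff.1 he with rfl | rfl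
    · exact ⟨Or.inr h2, Or.inl h1⟩
    · rw [Γ.map.rev_rev]
      exact ⟨Or.inl h2, Or.inr h1⟩

/-- A face boundary shares at most two edges with the outer cycle. -/
theorem not_three_shared (hk : 4 ≤ k) (hG : Γ.signedGraph.IsCritical k) {p q r : ℕ} (hpq : p < q)
    (hqr : q < r) (hr : r < Γ.outerLength)
    (h1 : Γ.map.face (Γ.map.rev (Γ.outerDart p)) = Γ.map.face (Γ.map.rev (Γ.outerDart q)))
    (h2 : Γ.map.face (Γ.map.rev (Γ.outerDart q)) = Γ.map.face (Γ.map.rev (Γ.outerDart r))) :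
    False := by
  obtain ⟨c1, n1, -⟩ := Γ.shared_pair hk hG hpq (hqr.trans hr) h1
  obtain ⟨-, n2, -⟩ := Γ.shared_pair hk hG hqr hr h2
  obtain ⟨-, n3, -⟩ := Γ.shared_pair hk hG (hpq.trans hqr) hr (h1.trans h2)
  -- No inserted vertex lies on the middle edge, so the two weights add up to the third. All three
  -- are 2 or 2k − 2, which is impossible for k ≥ 4; for k = 3 the sum 2 + 2 = 2k − 2 would be
  -- allowed.
  have : {i | p < Γ.pos i ∧ Γ.pos i < r} =
      {i | p < Γ.pos i ∧ Γ.pos i < q} ∪ {i | q < Γ.pos i ∧ Γ.pos i < r} := by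
    ext i
    have := (c1 i).2
    simp only [Set.mem_union, Set.mem_ofPred_eq]
    omega
  rw [this, Set.ncard_union_eq] at n3
  · omega
  · rw [Set.disjoint_left]
    intro i hi hi'
    simp only [Set.mem_ofPred_eq] at hi hi'
    omega

/-- The small side given by `shared_pair` is a digon by `rev_rot_of_cut_pair`. The remaining work is
to name its ends so that `c₁` is the one with `F` on its left; the faces of the other darts then
follow from the digon relations. -/
theorem exists_bridgeConfig (hk : 4 ≤ k) (hG : Γ.signedGraph.IsCritical k) {F : Γ.map.Face}
    (hF : Γ.IsBridgeFace F) : ∃ c₁ c₂ i j, Γ.IsBridgeConfig F c₁ c₂ i j := by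
  have hM := Γ.isCubicPlane
  obtain ⟨hne, p₁, p₂, h12, hp2, hf1, hf2⟩ : F ≠ Γ.outer ∧ ∃ p₁ p₂, p₁ < p₂ ∧
      p₂ < Γ.outerLength ∧ Γ.map.face (Γ.map.rev (Γ.outerDart p₁)) = F ∧
      Γ.map.face (Γ.map.rev (Γ.outerDart p₂)) = F := by
    obtain ⟨hne, d₁, d₂, hd, h1, h2, h3, h4⟩ := hM.exists_two_shared hF.1 hF.2
    obtain ⟨p, hp, rfl⟩ := Γ.exists_next_pow h1
    obtain ⟨q, hq, rfl⟩ := Γ.exists_next_pow h2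
    refine ⟨hne, ?_⟩
    rcases lt_trichotomy p q with h | rfl | h
    · exact ⟨p, q, h, hq, h3, h4⟩
    · exact absurd rfl hd
    · exact ⟨q, p, h, hp, h4, h3⟩
  have hshared : Γ.sharedEdges F =
      {Γ.map.edge (Γ.outerDart p₁), Γ.map.edge (Γ.outerDart p₂)} := by
    ext e
    rw [edge_mem_sharedEdges_iff hne, Set.mem_insert_iff, Set.mem_singleton_iff]
    constructor
    · rintro ⟨d, rfl, h1, h2⟩
      obtain ⟨q, hq, rfl⟩ := Γ.exists_next_pow h1
      change Γ.map.face (Γ.map.rev (Γ.outerDart q)) = F at h2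
      by_cases hq1 : q = p₁
      · left; rw [hq1]; rfl
      · by_cases hq2 : q = p₂
        · right; rw [hq2]; rfl
        · exfalso
          rcases lt_or_gt_of_ne hq1 with h | h
          · exact not_three_shared hk hG h h12 hp2 (h2.trans hf1.symm) (hf1.trans hf2.symm)
          · rcases lt_or_gt_of_ne hq2 with h' | h'
            · exact not_three_shared hk hG h h' hp2 (hf1.trans h2.symm) (h2.trans hf2.symm)
            · exact not_three_shared hk hG h12 h' hq (hf1.trans hf2.symm) (hf2.trans h2.symm)
    · rintro (rfl | rfl)
      · exact ⟨_, rfl, Γ.face_outerDart _, hf1⟩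
      · exact ⟨_, rfl, Γ.face_outerDart _, hf2⟩
  obtain ⟨hclear, -, X, hX, hX2, hY2⟩ := Γ.shared_pair hk hG h12 hp2 (hf1.trans hf2.symm)
  have hend : ∀ p, Γ.map.edge (Γ.outerDart p) ∈ Γ.map.graph.cut X →
      Γ.map.face (Γ.map.rev (Γ.outerDart p)) = F →
      ∃ c, Γ.map.edge c = Γ.map.edge (Γ.outerDart p) ∧ Γ.map.tail c ∈ X ∧
        ((Γ.map.face c = F ∧ Γ.map.face (Γ.map.rot c) = Γ.outer) ∨
          (Γ.map.face c = Γ.outer ∧ Γ.map.face (Γ.map.rot c) = F)) := by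
    intro p hp hpF
    rw [CombMap.edge_mem_cut_iff] at hp
    by_cases h : Γ.map.tail (Γ.outerDart p) ∈ X
    · exact ⟨_, rfl, h, Or.inr ⟨Γ.face_outerDart p, by rw [Γ.map.face_rot, hpF]⟩⟩
    · refine ⟨Γ.map.rev (Γ.outerDart p), Γ.map.edge_rev _, by rw [Γ.map.tail_rev]; tauto,
        Or.inl ⟨hpF, ?_⟩⟩
      rw [Γ.map.face_rot, Γ.map.rev_rev, Γ.face_outerDart]
  obtain ⟨b₁, he₁, hb₁, hs₁⟩ := hend p₁ (by rw [hX]; simp) hf1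
  obtain ⟨b₂, he₂, hb₂, hs₂⟩ := hend p₂ (by rw [hX]; simp) hf2
  have hedge : Γ.map.edge b₁ ≠ Γ.map.edge b₂ := by
    rw [he₁, he₂]
    exact fun h => h12.ne (Γ.edge_outerDart_inj (h12.trans hp2) hp2 h)
  have htne : Γ.map.tail b₁ ≠ Γ.map.tail b₂ := by
    intro h
    apply hedge
    rw [hM.eq_of_sides h]
    rw [Γ.map.face_rot] at hs₁ hs₂
    rcases hs₁ with ⟨h1, h2⟩ | ⟨h1, h2⟩ <;> rcases hs₂ with ⟨h3, h4⟩ | ⟨h3, h4⟩ <;>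
      rw [h1, h2, h3, h4] <;> tauto
  have hXeq : X = {Γ.map.tail b₁, Γ.map.tail b₂} := by
    refine (Set.eq_of_subset_of_ncard_le ?_ ?_ (Set.toFinite X)).symm
    · rintro v (rfl | rfl)
      · exact hb₁
      · exact hb₂
    · rw [hX2, Set.ncard_pair htne]
  have hsharedb : Γ.sharedEdges F = {Γ.map.edge b₁, Γ.map.edge b₂} := by rw [hshared, he₁, he₂]
  have hcutb : Γ.map.graph.cut {Γ.map.tail b₁, Γ.map.tail b₂} =
      {Γ.map.edge b₁, Γ.map.edge b₂} := by rw [← hXeq, hX, he₁, he₂]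
  obtain ⟨r₁, r₂⟩ := hM.rev_rot_of_cut_pair htne hcutb
  have hclearb : ∀ l, Γ.map.edge (Γ.dart l) ≠ Γ.map.edge b₁ ∧
      Γ.map.edge (Γ.dart l) ≠ Γ.map.edge b₂ := by
    intro l
    rw [he₁, he₂, dart_eq_outerDart]
    have hl := Γ.pos_lt_outerLength l
    exact ⟨fun h => (hclear l).1 (Γ.edge_outerDart_inj hl (h12.trans hp2) h),
      fun h => (hclear l).2 (Γ.edge_outerDart_inj hl hp2 h)⟩
  rw [hXeq] at hY2
  have main : ∀ c₁ c₂, Γ.sharedEdges F = {Γ.map.edge c₁, Γ.map.edge c₂} →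
      Γ.map.tail c₁ ≠ Γ.map.tail c₂ →
      Γ.map.graph.cut {Γ.map.tail c₁, Γ.map.tail c₂} = {Γ.map.edge c₁, Γ.map.edge c₂} →
      Γ.map.rev (Γ.map.rot c₁) = Γ.map.rot (Γ.map.rot c₂) →
      Γ.map.rev (Γ.map.rot c₂) = Γ.map.rot (Γ.map.rot c₁) →
      (∀ l, Γ.map.edge (Γ.dart l) ≠ Γ.map.edge c₁ ∧ Γ.map.edge (Γ.dart l) ≠ Γ.map.edge c₂) →
      {l | Γ.map.tail (Γ.dart l) ∈ ({Γ.map.tail c₁, Γ.map.tail c₂} : Set _)}.ncard = 2 →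
      Γ.map.face c₁ = F → Γ.map.face (Γ.map.rot c₁) = Γ.outer →
      ∃ c₁ c₂ i j, Γ.IsBridgeConfig F c₁ c₂ i j := by
    intro c₁ c₂ hsh htn hcu r₁ r₂ hcl hY hf hf'
    have hf₂ : Γ.map.face c₂ = Γ.outer := by
      rw [← hM.rot_rot_rot c₂, ← r₁, ← Γ.map.next_apply, Γ.map.face_next, hf']
    have hf₂' : Γ.map.face (Γ.map.rot c₂) = F := by
      rw [← Γ.map.face_next, Γ.map.next_apply, r₂, hM.rot_rot_rot, hf]
    -- Among the darts that start in the digon, those of `c₁` and `c₂` carry no inserted vertex, and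
    -- of the others only `rot c₁` belongs to the outer face.
    have hiff : ∀ l, Γ.map.tail (Γ.dart l) ∈ ({Γ.map.tail c₁, Γ.map.tail c₂} : Set _) ↔
        Γ.dart l = Γ.map.rot c₁ := by
      intro l
      constructor
      · rintro (h | h)
        · rcases hM.tail_eq_iff.1 h.symm with h | h | h
          · exact absurd (by rw [h]) (hcl l).1
          · exact h
          · exfalso
            have := hM.face_rot_ne (Γ.map.rot c₁)
            rw [← h, face_dart, hf'] at this
            exact this rfl
        · rcases hM.tail_eq_iff.1 h.symm with h | h | h
          · exact absurd (by rw [h]) (hcl l).2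
          · exfalso
            rw [← h, face_dart] at hf₂'
            exact hne hf₂'.symm
          · exfalso
            have := hM.face_rot_rot_ne c₂
            rw [← h, face_dart, hf₂] at this
            exact this rfl
      · intro h
        left
        rw [h, Γ.map.tail_rot]
    obtain ⟨i, j, hij, hYij⟩ : ∃ i j : Fin (2 * k), i < j ∧
        {l | Γ.map.tail (Γ.dart l) ∈ ({Γ.map.tail c₁, Γ.map.tail c₂} : Set _)} = {i, j} := by
      obtain ⟨i, j, hij, hY⟩ := Set.ncard_eq_two.1 hY
      rcases lt_or_gt_of_ne hij with h | h
      · exact ⟨i, j, h, hY⟩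
      · exact ⟨j, i, h, by rw [hY, Set.pair_comm]⟩
    have htd : ∀ l, Γ.map.tail (Γ.dart l) ∈ ({Γ.map.tail c₁, Γ.map.tail c₂} : Set _) ↔
        l = i ∨ l = j := fun l => by
      have := Set.ext_iff.1 hYij l
      exact this
    have hde : ∀ l, Γ.dart l = Γ.map.rot c₁ ↔ l = i ∨ l = j := fun l => (hiff l).symm.trans (htd l)
    have hsucc : j.val = i.val + 1 := by
      have hij' := Fin.lt_def.1 hij
      have hi := (hde i).2 (Or.inl rfl)
      have hj := (hde j).2 (Or.inr rfl)
      have hpos := Γ.dart_eq_iff.1 (hi.trans hj.symm)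
      have hjl := j.isLt
      have h1 : Γ.pos i ≤ Γ.pos ⟨i.val + 1, by omega⟩ :=
        Γ.pos_mono (Fin.le_def.2 (by simp only; omega))
      have h2 : Γ.pos ⟨i.val + 1, by omega⟩ ≤ Γ.pos j :=
        Γ.pos_mono (Fin.le_def.2 (by simp only; omega))
      -- Monotonicity puts `z_{i+1}` on the same dart, so its index is one of the two available
      -- ones.
      have h3 : Γ.dart ⟨i.val + 1, by omega⟩ = Γ.dart i := Γ.dart_eq_iff.2 (by omega)
      rcases (hde _).1 (h3.trans hi) with h | h
      · have := congrArg Fin.val h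
        simp only at this
        omega
      · have := congrArg Fin.val h
        simp only at this
        omega
    exact ⟨c₁, c₂, i, j, hne, hsh, htn, hcu, r₁, r₂, hf, hf', hf₂, hf₂', hcl, hsucc, htd, hde⟩
  rcases hs₁ with ⟨h1, h2⟩ | ⟨h1, h2⟩
  · exact main b₁ b₂ hsharedb htne hcutb r₁ r₂ hclearb hY2 h1 h2
  · have hf₂ : Γ.map.face b₂ = F := by
      rw [← hM.rot_rot_rot b₂, ← r₁, ← Γ.map.next_apply, Γ.map.face_next, h2]
    have hf₂' : Γ.map.face (Γ.map.rot b₂) = Γ.outer := by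
      rw [← Γ.map.face_next, Γ.map.next_apply, r₂, hM.rot_rot_rot, h1]
    exact main b₂ b₁ (by rw [hsharedb, Set.pair_comm]) htne.symm
      (by rw [Set.pair_comm, hcutb, Set.pair_comm]) r₂ r₁ (fun l => (hclearb l).symm)
      (by rw [Set.pair_comm]; exact hY2) hf₂ hf₂'

end CanonicalEmbedding

/-! ### The two components and their weights -/

namespace CanonicalEmbedding

variable {k : ℕ} {D : Type*} [Finite D] {Γ : CanonicalEmbedding k D}

namespace IsBridgeConfig

variable {F : Γ.map.Face} {c₁ c₂ : D} {i j : Fin (2 * k)} (h : Γ.IsBridgeConfig F c₁ c₂ i j)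
include h

/-- The permutation `next` interchanges the two darts on the inner side of the digon, so they form a
whole face. -/
theorem face_digon_iff {d : D} : Γ.map.face d = Γ.map.face (Γ.map.rot (Γ.map.rot c₁)) ↔
    d = Γ.map.rot (Γ.map.rot c₁) ∨ d = Γ.map.rot (Γ.map.rot c₂) := by
  have hM := Γ.isCubicPlane
  have n1 : Γ.map.next (Γ.map.rot (Γ.map.rot c₁)) = Γ.map.rot (Γ.map.rot c₂) := by
    rw [Γ.map.next_apply, ← h.rev₂, Γ.map.rev_rev]
  have n2 : Γ.map.next (Γ.map.rot (Γ.map.rot c₂)) = Γ.map.rot (Γ.map.rot c₁) := by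
    rw [Γ.map.next_apply, ← h.rev₁, Γ.map.rev_rev]
  constructor
  · intro hd
    obtain ⟨n, -, rfl⟩ := Equiv.Perm.SameCycle.exists_pow_eq'
      (Quotient.exact hd.symm : Γ.map.next.SameCycle _ d)
    clear hd
    induction n with
    | zero => exact Or.inl rfl
    | succ n ih =>
      rw [pow_succ', Equiv.Perm.mul_apply]
      rcases ih with ih | ih
      · rw [ih, n1]; exact Or.inr rfl
      · rw [ih, n2]; exact Or.inl rfl
  · rintro (rfl | rfl)
    · rfl
    · rw [← n1, Γ.map.face_next]

theorem face_digon_ne_outer : Γ.map.face (Γ.map.rot (Γ.map.rot c₁)) ≠ Γ.outer := by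
  rw [← h.face₁']
  exact Γ.isCubicPlane.face_rot_ne _

theorem edge_mem_digon_iff {d : D} :
    Γ.map.edge d ∈ (Γ.map.boundary (Γ.map.face (Γ.map.rot (Γ.map.rot c₁)))).edgeSet ↔
      Γ.map.edge d = Γ.map.edge (Γ.map.rot c₁) ∨ Γ.map.edge d = Γ.map.edge (Γ.map.rot c₂) := by
  rw [CombMap.edge_mem_boundary, h.face_digon_iff, h.face_digon_iff, ← h.rev₁, ← h.rev₂,
    Γ.map.rev.injective.eq_iff, Γ.map.rev.injective.eq_iff]
  have hrev : ∀ {a b : D}, a = Γ.map.rev b ↔ b = Γ.map.rev a := by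
    intro a b
    constructor <;> rintro rfl <;> rw [Γ.map.rev_rev]
  rw [Γ.map.edge_eq_iff, Γ.map.edge_eq_iff, hrev (a := d), hrev (a := d), eq_comm (a := d),
    eq_comm (a := d)]
  tauto

theorem boundary_digon_vertexSet :
    (Γ.map.boundary (Γ.map.face (Γ.map.rot (Γ.map.rot c₁)))).vertexSet =
      {Γ.map.tail c₁, Γ.map.tail c₂} := by
  ext v
  rw [CombMap.mem_boundary_vertexSet, Set.mem_insert_iff, Set.mem_singleton_iff]
  constructor
  · rintro ⟨d, hd, rfl⟩
    rcases h.face_digon_iff.1 hd with rfl | rfl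
    · left; rw [Γ.map.tail_rot, Γ.map.tail_rot]
    · right; rw [Γ.map.tail_rot, Γ.map.tail_rot]
  · rintro (rfl | rfl)
    · exact ⟨_, rfl, by rw [Γ.map.tail_rot, Γ.map.tail_rot]⟩
    · exact ⟨_, h.face_digon_iff.2 (Or.inr rfl), by rw [Γ.map.tail_rot, Γ.map.tail_rot]⟩

/-- The shared edges are the whole cut of the digon. This form as an induced subgraph is the one in
which the components are found. -/
theorem boundary_digon_eq : Γ.map.boundary (Γ.map.face (Γ.map.rot (Γ.map.rot c₁))) =
    (Γ.graph'.deleteEdges (Γ.sharedEdges F)).induce {Γ.map.tail c₁, Γ.map.tail c₂} := by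
  have hM := Γ.isCubicPlane
  have hsc : Γ.sharedEdges F = Γ.map.graph.cut {Γ.map.tail c₁, Γ.map.tail c₂} := by
    rw [h.shared, h.cut]
  refine Graph.ext h.boundary_digon_vertexSet fun e x y => ?_
  obtain ⟨d, rfl⟩ := Γ.map.exists_edge_eq e
  rw [Graph.induce_isLink, Graph.deleteEdges_isLink]
  constructor
  · intro hl
    have hx := hl.left_mem
    have hy := hl.right_mem
    rw [h.boundary_digon_vertexSet] at hx hy
    have hl' := (CombMap.boundary_isLink.1 hl).2
    refine ⟨⟨hl', ?_⟩, hx, hy⟩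
    rw [hsc]
    rintro ⟨a, ha, b, hb, hab⟩
    rcases hl'.eq_and_eq_or_eq_and_eq hab with ⟨rfl, rfl⟩ | ⟨rfl, rfl⟩
    · exact hb hy
    · exact hb hx
  · rintro ⟨⟨hl, hs⟩, hx, hy⟩
    have ht : Γ.map.tail d ∈ ({Γ.map.tail c₁, Γ.map.tail c₂} : Set _) := by
      rcases CombMap.isLink_edge_iff.1 hl with ⟨rfl, -⟩ | ⟨rfl, -⟩
      · exact hx
      · exact hy
    have hmem : Γ.map.edge d ∈
        (Γ.map.boundary (Γ.map.face (Γ.map.rot (Γ.map.rot c₁)))).edgeSet := by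
      rw [h.shared, Set.mem_insert_iff, Set.mem_singleton_iff, not_or] at hs
      rw [h.edge_mem_digon_iff]
      rcases ht with ht | ht
      · rcases hM.tail_eq_iff.1 ht.symm with rfl | rfl | rfl
        · exact absurd rfl hs.1
        · exact Or.inl rfl
        · right; rw [← h.rev₂, Γ.map.edge_rev]
      · rcases hM.tail_eq_iff.1 ht.symm with rfl | rfl | rfl
        · exact absurd rfl hs.2
        · exact Or.inr rfl
        · left; rw [← h.rev₁, Γ.map.edge_rev]
    exact CombMap.boundary_isLink.2 ⟨CombMap.edge_mem_boundary.1 hmem, hl⟩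

theorem head_notMem : Γ.map.head c₁ ∉ ({Γ.map.tail c₁, Γ.map.tail c₂} : Set _) := by
  intro hmem
  have : Γ.map.edge c₁ ∈ Γ.map.graph.cut {Γ.map.tail c₁, Γ.map.tail c₂} := by
    rw [h.cut]; exact Or.inl rfl
  rw [CombMap.edge_mem_cut_iff] at this
  exact this ⟨fun _ => hmem, fun _ => Or.inl rfl⟩

/-- Let `y` be a vertex outside the digon from which `head c₁` cannot be reached. An edge of `G'`
that leaves the set reachable from `y` must be shared, and the edge of `c₁` does not meet this set.
So the cut is empty or consists of the edge of `c₂`, against connectedness or bridgelessness of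
`G'`. -/
theorem isConn_compl : ((Γ.graph'.deleteEdges (Γ.sharedEdges F)).induce
    {Γ.map.tail c₁, Γ.map.tail c₂}ᶜ).IsConn := by
  have hM := Γ.isCubicPlane
  set X : Set Γ.map.Vertex := {Γ.map.tail c₁, Γ.map.tail c₂} with hX
  set K := (Γ.graph'.deleteEdges (Γ.sharedEdges F)).induce Xᶜ with hK
  refine Graph.isConn_of_reachable (a := Γ.map.head c₁) h.head_notMem fun y hy => ?_
  apply Graph.reachable_symm
  by_contra hnot
  have hsub : ∀ z, Relation.ReflTransGen K.Adj y z → z ∈ Xᶜ := by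
    intro z hz
    induction hz with
    | refl => exact hy
    | tail _ hadj _ => exact hadj.right_mem
  have htail : Γ.map.tail c₁ ∉ {z | Relation.ReflTransGen K.Adj y z} := fun hz =>
    hsub _ hz (Or.inl rfl)
  have hcut : Γ.map.graph.cut {z | Relation.ReflTransGen K.Adj y z} ⊆ {Γ.map.edge c₂} := by
    rintro e ⟨z, hz, w, hw, hl⟩
    have hshared : e ∈ Γ.sharedEdges F := by
      by_contra hs
      have hwX : w ∈ Xᶜ := by
        intro hwX
        apply hs
        rw [h.shared, ← h.cut]
        exact ⟨w, hwX, z, hsub z hz, hl.symm⟩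
      apply hw
      refine Relation.ReflTransGen.tail hz ⟨e, ?_⟩
      rw [hK, Graph.induce_isLink, Graph.deleteEdges_isLink]
      exact ⟨⟨hl, hs⟩, hsub z hz, hwX⟩
    rw [h.shared] at hshared
    rcases hshared with rfl | he
    · exfalso
      rcases CombMap.isLink_edge_iff.1 hl with ⟨rfl, rfl⟩ | ⟨rfl, rfl⟩
      · exact htail hz
      · exact hnot hz
    · exact he
  rcases Set.subset_singleton_iff_eq.1 hcut with he | he
  · apply htail
    refine Γ.map.vertex_induction hM.isConn (p := fun v => v ∈ {z | Relation.ReflTransGen K.Adj y z})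
      (v₀ := y) Relation.ReflTransGen.refl (fun d hd => ?_) _
    by_contra hd'
    have : Γ.map.edge d ∈ Γ.map.graph.cut {z | Relation.ReflTransGen K.Adj y z} :=
      CombMap.edge_mem_cut_iff.2 fun hiff => hd' (hiff.1 hd)
    rw [he] at this
    exact this
  · exact hM.cut_ne_singleton _ _ he

theorem isComponentOf_iff (A : Graph Γ.map.Vertex Γ.map.Edge) :
    A.IsComponentOf (Γ.graph'.deleteEdges (Γ.sharedEdges F)) ↔
      A = Γ.map.boundary (Γ.map.face (Γ.map.rot (Γ.map.rot c₁))) ∨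
      A = (Γ.graph'.deleteEdges (Γ.sharedEdges F)).induce {Γ.map.tail c₁, Γ.map.tail c₂}ᶜ := by
  rw [h.boundary_digon_eq]
  refine Graph.isComponentOf_iff_of_separated rfl ?_ ?_ h.isConn_compl A
  · intro e x y hl hx
    rw [Graph.deleteEdges_isLink, h.shared, ← h.cut] at hl
    by_contra hy
    exact hl.2 ⟨x, hx, y, hy, hl.1⟩
  · rw [← h.boundary_digon_eq]
    exact CombMap.boundary_isConn _

theorem edge_dart_mem_digon_iff (l : Fin (2 * k)) : Γ.map.edge (Γ.dart l) ∈
    (Γ.map.boundary (Γ.map.face (Γ.map.rot (Γ.map.rot c₁)))).edgeSet ↔ l = i ∨ l = j := by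
  have hM := Γ.isCubicPlane
  rw [h.edge_mem_digon_iff, ← h.dart_eq]
  constructor
  · rintro (he | he)
    · exact hM.eq_of_face_edge (by rw [face_dart, h.face₁']) he
    · exfalso
      rcases Γ.map.edge_eq_iff.1 he with he | he
      · have := h.face₂'
        rw [he, face_dart] at this
        exact h.face_ne this.symm
      · have := h.face_digon_ne_outer
        rw [← h.rev₂, he, Γ.map.rev_rev, face_dart] at this
        exact this rfl
  · intro he
    rw [he]
    exact Or.inl rfl

/-- An edge of `C_F` with an inserted vertex would be shared with `C'`, and the shared edges carry
none. -/
theorem edge_dart_ne_inner (l : Fin (2 * k)) {d : D} (hd : Γ.map.face d = F) :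
    Γ.map.edge (Γ.dart l) ≠ Γ.map.edge d := by
  intro he
  have : Γ.map.edge d ∈ Γ.sharedEdges F := by
    rw [edge_mem_sharedEdges_iff h.face_ne]
    refine ⟨Γ.dart l, he, Γ.face_dart l, ?_⟩
    rcases Γ.map.edge_eq_iff.1 he with rfl | rfl
    · exact absurd (hd.symm.trans (Γ.face_dart l)) h.face_ne
    · exact hd
  rw [h.shared, ← he] at this
  rcases this with he | he
  · exact (h.clear l).1 he
  · exact (h.clear l).2 he

theorem dart_i : Γ.dart i = Γ.map.rot c₁ := (h.dart_eq i).2 (Or.inl rfl)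

theorem dart_j : Γ.dart j = Γ.map.rot c₁ := (h.dart_eq j).2 (Or.inr rfl)

/-- With `link_middle`, `link_last` and the inner edge of the digon, this gives the 4-cycle through
`tail c₁`, `z_i`, `z_j`, `tail c₂`. -/
theorem link_first : Γ.Link (.inl (Γ.map.edge (Γ.map.rot c₁))) (.inl (Γ.map.tail c₁)) (.inr i) := by
  have := Link.first (Γ := Γ) i ?_
  · rwa [h.dart_i, Γ.map.tail_rot] at this
  · intro l hl he
    rw [edge_dart_eq_iff, ← dart_eq_iff, h.dart_i, h.dart_eq] at he
    have hs := h.succ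
    have hl := Fin.lt_def.1 hl
    rcases he with rfl | rfl <;> omega

theorem link_middle : Γ.Link (.inr (.inl i)) (.inr i) (.inr j) :=
  Link.middle i j h.succ (by rw [h.dart_i, h.dart_j])

theorem link_last : Γ.Link (.inr (.inl j)) (.inr j) (.inl (Γ.map.tail c₂)) := by
  have := Link.last (Γ := Γ) j ?_
  · rwa [h.dart_j, ← Γ.map.tail_rev, h.rev₁, Γ.map.tail_rot, Γ.map.tail_rot] at this
  · intro l hl he
    rw [h.dart_j, eq_comm, h.dart_eq] at he
    have hs := h.succ
    rcases he with rfl | rfl <;> omega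

theorem link_inner {d : D} (hd : Γ.map.face d = F) :
    Γ.Link (.inl (Γ.map.edge d)) (.inl (Γ.map.tail d)) (.inl (Γ.map.head d)) :=
  .whole d fun l => h.edge_dart_ne_inner l hd

theorem head_rot₂ : Γ.map.head (Γ.map.rot c₂) = Γ.map.tail c₁ := by
  rw [← Γ.map.tail_rev, h.rev₂, Γ.map.tail_rot, Γ.map.tail_rot]

theorem edge_rot_ne : Γ.map.edge (Γ.map.rot c₁) ≠ Γ.map.edge (Γ.map.rot c₂) := by
  rw [← h.dart_i]
  exact h.edge_dart_ne_inner i h.face₂'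

theorem isCyc_subdivided :
    (Γ.subdivided (Γ.map.boundary (Γ.map.face (Γ.map.rot (Γ.map.rot c₁))))).IsCyc ∧
    (Γ.subdivided (Γ.map.boundary (Γ.map.face (Γ.map.rot (Γ.map.rot c₁))))).edgeSet.ncard = 4 := by
  set A := Γ.map.boundary (Γ.map.face (Γ.map.rot (Γ.map.rot c₁))) with hA
  have hset : {l | Γ.map.edge (Γ.dart l) ∈ A.edgeSet} = {i, j} := by
    ext l
    exact h.edge_dart_mem_digon_iff l
  have hV : (Γ.subdivided A).vertexSet =
      {.inl (Γ.map.tail c₁), .inr i, .inr j, .inl (Γ.map.tail c₂)} := by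
    change Sum.inl '' A.vertexSet ∪ Sum.inr '' {l | Γ.map.edge (Γ.dart l) ∈ A.edgeSet} = _
    rw [hset, h.boundary_digon_vertexSet, Set.image_pair, Set.image_pair]
    ext u
    simp only [Set.mem_union, Set.mem_insert_iff, Set.mem_singleton_iff]
    tauto
  have hE : A.edgeSet = {Γ.map.edge (Γ.map.rot c₁), Γ.map.edge (Γ.map.rot c₂)} := by
    ext e
    obtain ⟨d, rfl⟩ := Γ.map.exists_edge_eq e
    exact h.edge_mem_digon_iff
  have hEs : Sum.inl '' A.edgeSet ∪ (fun l => (Sum.inr (Sum.inl l) : Γ.Ed)) ''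
      {l | Γ.map.edge (Γ.dart l) ∈ A.edgeSet} =
      {.inl (Γ.map.edge (Γ.map.rot c₁)), .inr (.inl i), .inr (.inl j),
        .inl (Γ.map.edge (Γ.map.rot c₂))} := by
    rw [hset, hE, Set.image_pair, Set.image_pair]
    ext u
    simp only [Set.mem_union, Set.mem_insert_iff, Set.mem_singleton_iff]
    tauto
  have hlink : ∀ e x y, (Γ.subdivided A).IsLink e x y ↔
      e ∈ ({.inl (Γ.map.edge (Γ.map.rot c₁)), .inr (.inl i), .inr (.inl j),
        .inl (Γ.map.edge (Γ.map.rot c₂))} : Set Γ.Ed) ∧ Γ.graph.IsLink e x y ∧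
      x ∈ ({.inl (Γ.map.tail c₁), .inr i, .inr j, .inl (Γ.map.tail c₂)} : Set Γ.Vert) ∧
      y ∈ ({.inl (Γ.map.tail c₁), .inr i, .inr j, .inl (Γ.map.tail c₂)} : Set Γ.Vert) := by
    intro e x y
    rw [← hEs, ← hV]
    rfl
  have hij : i ≠ j := by
    intro hij
    have := h.succ
    rw [hij] at this
    omega
  refine Graph.isCyc_of_four hV ?_ ((hlink (.inl (Γ.map.edge (Γ.map.rot c₁))) _ _).2 ?_)
    ((hlink (.inr (.inl i)) _ _).2 ?_) ((hlink (.inr (.inl j)) _ _).2 ?_)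
    ((hlink (.inl (Γ.map.edge (Γ.map.rot c₂))) _ _).2 ?_) ?_ ?_
  · intro e he
    obtain ⟨x, y, hxy⟩ := Graph.exists_isLink_of_mem_edgeSet he
    exact ((hlink e x y).1 hxy).1
  · exact ⟨by simp, Or.inl h.link_first, by simp, by simp⟩
  · exact ⟨by simp, Or.inl h.link_middle, by simp, by simp⟩
  · exact ⟨by simp, Or.inl h.link_last, by simp, by simp⟩
  · refine ⟨by simp, Or.inl ?_, by simp, by simp⟩
    have := h.link_inner h.face₂'
    rwa [h.head_rot₂, Γ.map.tail_rot] at this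
  · simp [h.tail_ne, hij]
  · simp [h.edge_rot_ne, hij]

/-- An inserted vertex other than `z_i` and `z_j` lies on an edge of `C'` that is not in the cut of
the digon and starts outside it. Such an edge has both ends in the second component. -/
theorem weight_eq : Γ.weight ((Γ.graph'.deleteEdges (Γ.sharedEdges F)).induce
    {Γ.map.tail c₁, Γ.map.tail c₂}ᶜ) = 2 * k - 2 := by
  classical
  set A := (Γ.graph'.deleteEdges (Γ.sharedEdges F)).induce {Γ.map.tail c₁, Γ.map.tail c₂}ᶜ with hA
  have hmem : ∀ l, Γ.map.edge (Γ.dart l) ∈ A.edgeSet ∩ Γ.outerCycle.edgeSet ↔ ¬ (l = i ∨ l = j) := by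
    intro l
    have hnc : Γ.map.edge (Γ.dart l) ∉ Γ.map.graph.cut {Γ.map.tail c₁, Γ.map.tail c₂} := by
      rw [h.cut]
      rintro (he | he)
      · exact (h.clear l).1 he
      · exact (h.clear l).2 he
    have hns : Γ.map.edge (Γ.dart l) ∉ Γ.sharedEdges F := by rwa [h.shared, ← h.cut]
    rw [CombMap.edge_mem_cut_iff, not_not] at hnc
    rw [← h.tail_dart]
    constructor
    · rintro ⟨hl, -⟩ ht
      obtain ⟨x, y, hxy⟩ := Graph.exists_isLink_of_mem_edgeSet hl
      rw [hA, Graph.induce_isLink, Graph.deleteEdges_isLink] at hxy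
      rcases CombMap.isLink_edge_iff.1 hxy.1.1 with ⟨rfl, -⟩ | ⟨rfl, -⟩
      · exact hxy.2.1 ht
      · exact hxy.2.2 ht
    · intro ht
      refine ⟨Graph.IsLink.edge_mem (x := Γ.map.tail (Γ.dart l)) (y := Γ.map.head (Γ.dart l)) ?_,
        CombMap.edge_mem_boundary.2 (Or.inl (Γ.face_dart l))⟩
      rw [hA, Graph.induce_isLink, Graph.deleteEdges_isLink]
      exact ⟨⟨CombMap.isLink_edge _, hns⟩, ht, fun h' => ht (hnc.2 h')⟩
  have hfin : (A.edgeSet ∩ Γ.outerCycle.edgeSet).Finite := Set.toFinite _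
  have hij : i ≠ j := by
    intro hij
    have := h.succ
    rw [hij] at this
    omega
  have hset : {l | Γ.map.edge (Γ.dart l) ∈ A.edgeSet ∩ Γ.outerCycle.edgeSet} = {i, j}ᶜ := by
    ext l
    exact hmem l
  have hcard : {l | Γ.map.edge (Γ.dart l) ∈ A.edgeSet ∩ Γ.outerCycle.edgeSet}.ncard = 2 * k - 2 := by
    rw [hset, Set.ncard_compl, Set.ncard_pair hij, Nat.card_eq_fintype_card, Fintype.card_fin]
  rw [weight, finsum_mem_eq_finite_toFinset_sum _ hfin, ← hcard]
  have hf : {l | Γ.map.edge (Γ.dart l) ∈ A.edgeSet ∩ Γ.outerCycle.edgeSet} =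
      (Finset.univ.filter fun l => Γ.map.edge (Γ.dart l) ∈ hfin.toFinset : Finset _) := by
    ext l
    simp
  -- The weight is a sum over edges; counting the inserted vertices by the edge that carries them
  -- turns it into a cardinality.
  rw [hf, Set.ncard_coe_finset, Finset.card_eq_sum_card_fiberwise (t := hfin.toFinset)
    (f := fun l => Γ.map.edge (Γ.dart l))]
  · refine Finset.sum_congr rfl fun e he => ?_
    rw [edgeWeight, ← Set.ncard_coe_finset]
    congr 1
    ext l
    simp only [Set.mem_ofPred_eq, Finset.coe_filter, Finset.mem_filter, Finset.mem_univ, true_and]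
    exact ⟨fun hl => ⟨hl ▸ he, hl⟩, fun hl => hl.2⟩
  · intro l hl
    simpa using hl

end IsBridgeConfig

end CanonicalEmbedding

/-! ## The length of a bridge face -/

theorem Graph.IsLink.notMem_cut {α β : Type*} {G : Graph α β} {X : Set α} {e : β} {x y : α}
    (hl : G.IsLink e x y) (hx : x ∈ X) (hy : y ∈ X) : e ∉ G.cut X := by
  rintro ⟨a, ha, b, hb, hab⟩
  rcases hl.eq_and_eq_or_eq_and_eq hab with ⟨rfl, rfl⟩ | ⟨rfl, rfl⟩
  · exact hb hy
  · exact hb hx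

/-- A face boundary that starts in a set of vertices and ends outside leaves the set. -/
theorem CombMap.exists_tail_mem_head_notMem {D : Type*} [Finite D] {M : CombMap D} {a b : D}
    (hab : M.face a = M.face b) {X : Set M.Vertex} (ha : M.tail a ∈ X) (hb : M.tail b ∉ X) :
    ∃ d, M.face d = M.face a ∧ M.tail d ∈ X ∧ M.head d ∉ X := by
  by_contra! hstay
  obtain ⟨n, -, rfl⟩ := Equiv.Perm.SameCycle.exists_pow_eq'
    (Quotient.exact hab : M.next.SameCycle a b)
  have key : ∀ n : ℕ, M.face ((M.next ^ n) a) = M.face a ∧ M.tail ((M.next ^ n) a) ∈ X := by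
    intro n
    induction n with
    | zero => exact ⟨rfl, ha⟩
    | succ n ih =>
      rw [pow_succ', Equiv.Perm.mul_apply, M.face_next, M.tail_next]
      exact ⟨ih.1, hstay _ ih.1 ih.2⟩
  exact hb (key n).2

namespace CanonicalEmbedding

variable {k : ℕ} {D : Type*} [Finite D] {Γ : CanonicalEmbedding k D}

namespace IsBridgeConfig

variable {F : Γ.map.Face} {c₁ c₂ : D} {i j : Fin (2 * k)} (h : Γ.IsBridgeConfig F c₁ c₂ i j)
include h

theorem segment_inner {d : D} (hd : Γ.map.face d = F) :
    Γ.segment d = .inl (Γ.map.edge d) := by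
  refine Γ.segment_of_forall_ne fun l hl => h.edge_dart_ne_inner l hd ?_
  rw [hl, Γ.map.edge_rev]

theorem segment_rev_inner {d : D} (hd : Γ.map.face d = F) :
    Γ.segment (Γ.map.rev d) = .inl (Γ.map.edge d) := by
  rw [Γ.segment_of_forall_ne, Γ.map.edge_rev]
  intro l hl
  rw [Γ.map.rev_rev] at hl
  exact h.edge_dart_ne_inner l hd (by rw [hl])

theorem segment_rot₁ : Γ.segment (Γ.map.rot c₁) = .inl (Γ.map.edge (Γ.map.rot c₁)) := by
  refine Γ.segment_of_forall_ne fun l hl => ?_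
  rw [← h.dart_i] at hl
  exact Γ.rev_dart_ne i l hl.symm

theorem segment_rot_rot₂ : Γ.segment (Γ.map.rot (Γ.map.rot c₂)) = .inr (.inl j) := by
  rw [← h.rev₁, ← h.dart_j]
  refine Γ.segment_rev_dart fun l hl he => ?_
  rw [h.dart_j, eq_comm, h.dart_eq] at he
  have hs := h.succ
  rcases he with rfl | rfl <;> omega

theorem segmentBefore_i : Γ.segmentBefore i = .inl (Γ.map.edge (Γ.map.rot c₁)) := by
  rw [Γ.segmentBefore_of_first, h.dart_i]
  intro l hl he
  rw [edge_dart_eq_iff, ← dart_eq_iff, h.dart_i, h.dart_eq] at he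
  have hs := h.succ
  have hl := Fin.lt_def.1 hl
  rcases he with rfl | rfl <;> omega

theorem segmentBefore_j : Γ.segmentBefore j = .inr (.inl i) :=
  Γ.segmentBefore_of_succ h.succ (by rw [h.dart_i, h.dart_j])

/-- At the tail of a dart `d` of `F` two edges belong to `C_F`, and only the one at `rot d` can
leave. For `d = c₁` and `d = rot c₂` it is the first or last segment of the outer digon edge, which
leads to `z_i` or `z_j`. -/
theorem positive_cut_subset_image : Γ.signedGraph.negᶜ ∩
    Γ.graph.cut (Γ.vertsOf {v | ∃ d, Γ.map.face d = F ∧ Γ.map.tail d = v} {i, j}) ⊆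
      (fun d => Γ.segment (Γ.map.rot d)) '' ({d | Γ.map.face d = F} \ {c₁, Γ.map.rot c₂}) := by
  have hM := Γ.isCubicPlane
  set X : Set Γ.map.Vertex := {v | ∃ d, Γ.map.face d = F ∧ Γ.map.tail d = v} with hX
  set H := Γ.vertsOf X {i, j} with hH
  have htail : ∀ {d}, Γ.map.face d = F → (.inl (Γ.map.tail d) : Γ.Vert) ∈ H := fun hd => ⟨_, hd, rfl⟩
  have hhead : ∀ {d}, Γ.map.face d = F → (.inl (Γ.map.head d) : Γ.Vert) ∈ H := fun {d} hd =>
    ⟨Γ.map.next d, by rw [Γ.map.face_next, hd], Γ.map.tail_next d⟩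
  have hi : (.inr i : Γ.Vert) ∈ H := Γ.inr_mem_vertsOf.2 (Or.inl rfl)
  have hj : (.inr j : Γ.Vert) ∈ H := Γ.inr_mem_vertsOf.2 (Or.inr rfl)
  have h1 : (.inl (Γ.map.tail c₁) : Γ.Vert) ∈ H := htail h.face₁
  have h2 : (.inl (Γ.map.tail c₂) : Γ.Vert) ∈ H := by
    rw [← Γ.map.tail_rot]; exact htail h.face₂'
  have hfirst : .inl (Γ.map.edge (Γ.map.rot c₁)) ∉ Γ.graph.cut H :=
    Graph.IsLink.notMem_cut (Or.inl h.link_first) h1 hi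
  have hmiddle : .inr (.inl i) ∉ Γ.graph.cut H :=
    Graph.IsLink.notMem_cut (Or.inl h.link_middle) hi hj
  have hlast : .inr (.inl j) ∉ Γ.graph.cut H :=
    Graph.IsLink.notMem_cut (Or.inl h.link_last) hj h2
  have hinner : ∀ {d}, Γ.map.face d = F → .inl (Γ.map.edge d) ∉ Γ.graph.cut H := fun hd =>
    Graph.IsLink.notMem_cut (Or.inl (h.link_inner hd)) (htail hd) (hhead hd)
  rintro e ⟨hpos, hcut⟩
  rw [notMem_neg_iff] at hpos
  obtain ⟨x, hx, y, -, hl⟩ := id hcut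
  have hinc : e ∈ Γ.graph.incidenceSet x := ⟨y, hl⟩
  rcases x with v | l
  · obtain ⟨d, hd, rfl⟩ := hx
    rw [incidenceSet_inl] at hinc
    obtain ⟨d', ht, rfl⟩ := hinc
    rcases hM.tail_eq_iff.1 (show Γ.map.tail d = Γ.map.tail d' from Eq.symm ht)
      with rfl | rfl | rfl
    · rw [h.segment_inner hd] at hcut
      exact absurd hcut (hinner hd)
    · refine ⟨d, ⟨hd, ?_⟩, rfl⟩
      rintro (rfl | rfl)
      · rw [h.segment_rot₁] at hcut
        exact hfirst hcut
      · rw [h.segment_rot_rot₂] at hcut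
        exact hlast hcut
    · have hd' : Γ.map.face (Γ.map.rev (Γ.map.rot (Γ.map.rot d))) = F := by
        rw [← Γ.map.face_rot, hM.rot_rot_rot, hd]
      have := h.segment_rev_inner hd'
      rw [Γ.map.rev_rev] at this
      rw [this] at hcut
      exact absurd hcut (hinner hd')
  · rw [incidenceSet_inr] at hinc
    exfalso
    rcases hinc with rfl | rfl | rfl
    · rcases hx with rfl | rfl
      · rw [h.segmentBefore_i] at hcut
        exact hfirst hcut
      · rw [h.segmentBefore_j] at hcut
        exact hmiddle hcut
    · rcases hx with rfl | rfl
      · exact hmiddle hcut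
      · exact hlast hcut
    · exact hpos _ rfl

theorem rot₂_ne : c₁ ≠ Γ.map.rot c₂ := by
  intro he
  apply h.tail_ne
  rw [he, Γ.map.tail_rot]

/-- A boundary of length at most 5 would span, with `z_i` and `z_j`, a set of boundary at most (5 −
2) + 2 = 5. A tight split of it has at most two edges across, too few for the three internally
disjoint paths between the ends of the digon. -/
theorem six_le (hk : 4 ≤ k) (hG : Γ.signedGraph.IsCritical k) :
    6 ≤ (Γ.map.boundary F).edgeSet.ncard := by
  classical
  have hM := Γ.isCubicPlane
  have := Fintype.ofFinite Γ.Vert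
  have ht := Γ.isTightCubic hG
  rw [hM.ncard_boundary_edgeSet]
  by_contra! hlt
  have hsucc := h.succ
  have hij : i ≠ j := by
    rintro rfl
    omega
  set X : Set Γ.map.Vertex := {v | ∃ d, Γ.map.face d = F ∧ Γ.map.tail d = v} with hX
  obtain ⟨H, hH⟩ : ∃ H : Finset Γ.Vert, (H : Set Γ.Vert) = Γ.vertsOf X {i, j} :=
    ⟨(Γ.vertsOf X {i, j}).toFinset, by simp⟩
  have hmem : ∀ u, u ∈ H ↔ u ∈ Γ.vertsOf X {i, j} := fun u => by rw [← hH, Finset.mem_coe]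
  have hYi : Set.InjOn negativeIndex ({i, j} : Set (Fin (2 * k))) := by
    apply negativeIndex_injOn
    rintro a (rfl | rfl) b (rfl | rfl) <;> omega
  have hpos : ∀ u ∈ H, ∀ v ∈ H, Γ.graph.mult Γ.signedGraph.neg u v = 0 := fun u hu v hv =>
    Γ.mult_neg_eq_zero hYi ((hmem u).1 hu) ((hmem v).1 hv)
  have hpc : (Γ.signedGraph.negᶜ ∩ Γ.graph.cut (Γ.vertsOf X {i, j})).ncard ≤
      {d | Γ.map.face d = F}.ncard - 2 := by
    refine (Set.ncard_le_ncard h.positive_cut_subset_image).trans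
      ((Set.ncard_image_le (Set.toFinite _)).trans ?_)
    rw [Set.ncard_sdiff, Set.ncard_pair h.rot₂_ne]
    rintro d (rfl | rfl)
    · exact h.face₁
    · exact h.face₂'
  have hnc := Γ.ncard_negative_cut_le X {i, j}
  rw [Set.ncard_pair hij] at hnc
  have hb : between (Γ.graph.mult Set.univ) H Hᶜ ≤ 5 := by
    rw [Graph.between_mult_univ Γ.signedGraph.neg, Graph.between_compl_eq_cut,
      Graph.between_compl_eq_cut, hH]
    omega
  have hlink := h.link_inner h.face₂'
  rw [h.head_rot₂, Γ.map.tail_rot] at hlink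
  have hu : (.inl (Γ.map.tail c₁) : Γ.Vert) ∈ H := (hmem _).2 ⟨c₁, h.face₁, rfl⟩
  have hv : (.inl (Γ.map.tail c₂) : Γ.Vert) ∈ H :=
    (hmem _).2 ⟨_, h.face₂', Γ.map.tail_rot _⟩
  have hi : (.inr i : Γ.Vert) ∈ H := (hmem _).2 (Or.inl rfl)
  have hj : (.inr j : Γ.Vert) ∈ H := (hmem _).2 (Or.inr rfl)
  obtain ⟨P, Q, hd, hun, huP, hvQ, -, hP, hQ, hsum, -⟩ := ht.exists_split hpos hu hv
    (Graph.mult_ne_zero_iff.2 ⟨_, Set.mem_univ _, Or.inr hlink⟩)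
  have hQof : ∀ {u}, u ∈ H → u ∉ P → u ∈ Q := fun {u} hu hn => by
    rw [← hun, Finset.mem_union] at hu
    tauto
  have hnP : (.inl (Γ.map.tail c₂) : Γ.Vert) ∉ P := fun hp => Finset.disjoint_left.1 hd hp hvQ
  -- The walk along `C_F` from `tail c₁` to `tail c₂` that avoids the inner digon edge leaves `P`
  -- somewhere.
  obtain ⟨d, hdF, hdP, hdQ⟩ := CombMap.exists_tail_mem_head_notMem
    (a := Γ.map.next (Γ.map.rot c₂)) (b := Γ.map.rot c₂) (Γ.map.face_next _)
    (X := {v | (.inl v : Γ.Vert) ∈ P})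
    (by rw [Γ.map.tail_next, h.head_rot₂]; exact huP) (by rw [Γ.map.tail_rot]; exact hnP)
  rw [Γ.map.face_next, h.face₂'] at hdF
  have hdne : Γ.map.edge d ≠ Γ.map.edge (Γ.map.rot c₂) := by
    intro he
    rw [hM.eq_of_face_edge (hdF.trans h.face₂'.symm) he, Set.mem_ofPred_eq, Γ.map.tail_rot] at hdP
    exact hnP hdP
  -- The path `tail c₁`, `z_i`, `z_j`, `tail c₂` also runs from `P` to `Q`.
  obtain ⟨f, hf, a, haP, b, hbQ, hab⟩ : ∃ f ∈ ({.inl (Γ.map.edge (Γ.map.rot c₁)), .inr (.inl i),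
      .inr (.inl j)} : Set Γ.Ed), ∃ a ∈ P, ∃ b ∈ Q, Γ.graph.IsLink f a b := by
    by_cases hiP : (.inr i : Γ.Vert) ∈ P
    · by_cases hjP : (.inr j : Γ.Vert) ∈ P
      · exact ⟨_, by simp, _, hjP, _, hvQ, Or.inl h.link_last⟩
      · exact ⟨_, by simp, _, hiP, _, hQof hj hjP, Or.inl h.link_middle⟩
    · exact ⟨_, by simp, _, huP, _, hQof hi hiP, Or.inl h.link_first⟩
  have hne : ∀ {d}, Γ.map.face d = F → f ≠ .inl (Γ.map.edge d) := by
    intro d hd he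
    rw [he] at hf
    simp only [Set.mem_insert_iff, Sum.inl.injEq, reduceCtorEq, Set.mem_singleton_iff,
      or_false] at hf
    rw [← h.dart_i] at hf
    exact h.edge_dart_ne_inner i hd hf.symm
  have hthree : 3 ≤ between (Γ.graph.mult Set.univ) P Q := by
    rw [Graph.between_mult hd]
    have hsub : {f, .inl (Γ.map.edge d), .inl (Γ.map.edge (Γ.map.rot c₂))} ⊆
        {e ∈ (Set.univ : Set Γ.Ed) | ∃ a ∈ P, ∃ b ∈ Q, Γ.graph.IsLink e a b} := by
      rintro e (rfl | rfl | rfl)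
      · exact ⟨Set.mem_univ _, a, haP, b, hbQ, hab⟩
      · refine ⟨Set.mem_univ _, _, hdP, _, hQof ((hmem _).2 ?_) hdQ, Or.inl (h.link_inner hdF)⟩
        exact ⟨Γ.map.next d, by rw [Γ.map.face_next, hdF], Γ.map.tail_next d⟩
      · exact ⟨Set.mem_univ _, _, huP, _, hvQ, Or.inr hlink⟩
    refine le_trans (le_of_eq (Eq.symm ?_)) (Set.ncard_le_ncard hsub)
    exact Set.ncard_eq_three.2 ⟨_, _, _, hne hdF, hne h.face₂',
      fun he => hdne (Sum.inl.inj he), rfl⟩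
  omega

end IsBridgeConfig

end CanonicalEmbedding

theorem proposition2p5 {D : Type*} [Finite D] {k : ℕ} (hk : 4 ≤ k)
    (Γ : CanonicalEmbedding k D) (hG : Γ.signedGraph.IsPrimeCritical k)
    (F : Γ.map.Face) (hF : Γ.IsBridgeFace F) :
    (∃ A₁ A₂ : Graph Γ.map.Vertex Γ.map.Edge, A₁ ≠ A₂ ∧
      (∀ A, A.IsComponentOf (Γ.graph'.deleteEdges (Γ.sharedEdges F)) ↔ A = A₁ ∨ A = A₂) ∧
      (∃ F' : Γ.map.Face, F' ≠ Γ.outer ∧ A₁ = Γ.map.boundary F' ∧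
        (Γ.subdivided A₁).IsCyc ∧ (Γ.subdivided A₁).edgeSet.ncard = 4) ∧
      Γ.weight A₂ = 2 * k - 2) ∧
    6 ≤ (Γ.map.boundary F).edgeSet.ncard := by
  obtain ⟨c₁, c₂, i, j, h⟩ := CanonicalEmbedding.exists_bridgeConfig hk hG.1 hF
  refine ⟨⟨_, _, fun hA => ?_, h.isComponentOf_iff, ⟨_, h.face_digon_ne_outer, rfl,
    h.isCyc_subdivided⟩, h.weight_eq⟩, h.six_le hk hG.1⟩
  -- The two components differ because `tail c₁` belongs only to the digon.
  have hmem : Γ.map.tail c₁ ∈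
      (Γ.map.boundary (Γ.map.face (Γ.map.rot (Γ.map.rot c₁)))).vertexSet := by
    rw [h.boundary_digon_vertexSet]
    exact Or.inl rfl
  rw [hA] at hmem
  exact hmem (Or.inl rfl)
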